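/- Let $d\ge 1$. For $f\in S(\mathbb{R}^d)$ put $\widehat f(\xi)=\int f(x)e^{-2\pi i\langle x,\xi\rangle}dx$, extended to $S'(\mathbb{R}^d)$. Let $\phi\in S(\mathbb{R}^d)$ be such that $\widehat\phi$ is supported in $\{2^{-1}\le|\xi|\le 2\}$ and $\sum_{k\in\mathbb{Z}}\widehat{\phi_k}(\xi)=1$ for $\xi\ne 0$, where $\phi_k:=2^{kd}\phi(2^k\cdot)$; let $\widehat\Phi:=1-\sum_{k\ge1}\widehat{\phi_k}$, and for $f\in S'$ let $\Pi_0f:=\Phi*f$ and $\Pi_kf:=\phi_k*f$ for $k\ge1$. For $\mu\in\mathbb{Z}$ let $\mathcal{D}_\mu$ be the set of dyadic cubes in $\mathbb{R}^d$ of side length $2^{-\mu}$. Let $m\in\mathbb{R}$ and let $a\in\mathcal{S}^m_{1,1}$, i.e. $a$ is smooth on $\mathbb{R}^d\times\mathbb{R}^d$ and for all multi-indices $\alpha,\beta$ there is $c_{\alpha,\beta}$ with $|\partial_\xi^\alpha\partial_x^\beta a(x,\xi)|\le c_{\alpha,\beta}(1+|\xi|)^{m-|\alpha|+|\beta|}$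 for all $x,\xi$. For $j,k\ge0$ put $a_{j,k}(x,\xi):=\big(\phi_j*a(\cdot,\xi)\big)(x)\,\widehat{\phi_k}(\xi)$, with $\Phi$ in place of $\phi_0$, and for $f\in S'$ let $T_{[a_{j,k}]}f(x):=\big\langle\widehat f,\ a_{j,k}(x,\cdot)e^{2\pi i\langle x,\cdot\rangle}\big\rangle$. Define $$T_{[a]}f:=\lim_{N\to\infty}\sum_{k=0}^N\sum_{j=0}^N T_{[a_{j,k}]}f,\qquad f\in S',$$ whenever the limit exists in $S'$. Let $0<q<\infty$ and $s>\tau_q:=\frac{d}{\min(1,q)}-d$. Then there is a constant $C>0$, independent of $\mu$ and $f$, such that for all $\mu\in\mathbb{N}=\{1,2,\dots\}$ and all $f\in S'$ the following holds. Put $$A_\mu(f):=\sup_{0\le k\le\mu-1}\big\|2^{k(s+m)}\Pi_kf\big\|_{L^\infty}+\sup_{R\in\mathcal{D}_\mu}\Big(\frac1{|R|}\int_R\sum_{k=\mu}^\infty 2^{(s+m)kq}|\Pi_kf(x)|^q\,dx\Big)^{1/q}\in[0,\infty].$$ If $A_\mu(f)<\infty$, then $T_{[a]}f$ is defined; and whenever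 $T_{[a]}f$ is defined, $$\sup_{P\in\mathcal{D}_\mu}\Big(\frac1{|P|}\int_P\sum_{k=\mu}^\infty 2^{skq}\big|\Pi_kT_{[a]}f(x)\big|^q\,dx\Big)^{1/q}\le C\,A_\mu(f).$$ -/

import Mathlib

open MeasureTheory Filter Topology SchwartzMap FourierTransform
open scoped ContDiff ENNReal NNReal Convolution

noncomputable section

namespace TypeOneOne

/-- `ℝ^d` with its Euclidean norm. -/
abbrev Rd (d : ℕ) : Type := EuclideanSpace ℝ (Fin d)

variable {d : ℕ}

/-! ### Littlewood–Paley decomposition -/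

/-- The dilate `φ_k = 2^{kd} φ(2^k ·)`. -/
def dilate (φ : 𝓢(Rd d, ℂ)) (k : ℤ) : 𝓢(Rd d, ℂ) :=
  ((2 : ℂ) ^ (k * d)) • SchwartzMap.compCLMOfContinuousLinearEquiv ℂ
    (ContinuousLinearEquiv.smulLeft (Units.mk0 ((2 : ℝ) ^ k) (by positivity))) φ

theorem dilate_apply (φ : 𝓢(Rd d, ℂ)) (k : ℤ) (x : Rd d) :
    dilate φ k x = (2 : ℂ) ^ (k * d) * φ ((2 : ℝ) ^ k • x) := rfl

/-- `φ` generates a dyadic resolution of unity: `φ̂` is supported in `{1/2 ≤ |ξ| ≤ 2}` and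
`∑_{k ∈ ℤ} φ̂_k(ξ) = 1` for `ξ ≠ 0`. -/
structure IsLittlewoodPaley (φ : 𝓢(Rd d, ℂ)) : Prop where
  support_subset : tsupport (𝓕 φ : 𝓢(Rd d, ℂ)) ⊆ {ξ | 1 / 2 ≤ ‖ξ‖ ∧ ‖ξ‖ ≤ 2}
  hasSum_one : ∀ ξ : Rd d, ξ ≠ 0 → HasSum (fun k : ℤ => (𝓕 (dilate φ k) : 𝓢(Rd d, ℂ)) ξ) 1

theorem fourier_dilate (φ : 𝓢(Rd d, ℂ)) (k : ℤ) (ξ : Rd d) :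
    (𝓕 (dilate φ k) : 𝓢(Rd d, ℂ)) ξ = (𝓕 φ : 𝓢(Rd d, ℂ)) ((2 : ℝ) ^ (-k) • ξ) := by
  rw [SchwartzMap.fourier_coe, SchwartzMap.fourier_coe, Real.fourier_eq, Real.fourier_eq]
  have h2 : (2 : ℝ) ^ k ≠ 0 := by positivity
  have key := Measure.integral_comp_smul (volume : Measure (Rd d))
    (fun v : Rd d => Real.fourierChar (-(inner ℝ v ((2 : ℝ) ^ (-k) • ξ))) • φ v) ((2 : ℝ) ^ k)
  have hpt : ∀ v : Rd d, Real.fourierChar (-(inner ℝ v ξ)) • dilate φ k v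
      = (2 : ℂ) ^ (k * d) * (Real.fourierChar
        (-(inner ℝ ((2 : ℝ) ^ k • v) ((2 : ℝ) ^ (-k) • ξ))) • φ ((2 : ℝ) ^ k • v)) := by
    intro v
    have : (inner ℝ ((2 : ℝ) ^ k • v) ((2 : ℝ) ^ (-k) • ξ) : ℝ) = inner ℝ v ξ := by
      rw [real_inner_smul_left, real_inner_smul_right, zpow_neg, ← mul_assoc,
        mul_inv_cancel₀ h2, one_mul]
    rw [this, dilate_apply, Circle.smul_def, Circle.smul_def, smul_eq_mul, smul_eq_mul]
    ring
  simp_rw [hpt]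
  rw [integral_const_mul, key, finrank_euclideanSpace_fin, Complex.real_smul, ← mul_assoc]
  have : (2 : ℂ) ^ (k * d) * ((|(((2 : ℝ) ^ k) ^ d)⁻¹| : ℝ) : ℂ) = 1 := by
    rw [abs_of_pos (by positivity), zpow_mul, zpow_natCast]
    push_cast
    exact mul_inv_cancel₀ (pow_ne_zero _ (zpow_ne_zero _ two_ne_zero))
  rw [this, one_mul]

/-- The low-frequency multiplier `Φ̂ = 1 - ∑_{k ≥ 1} φ̂_k`. -/
def lowMultiplier (φ : 𝓢(Rd d, ℂ)) (ξ : Rd d) : ℂ :=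
  1 - ∑' k : ℕ, (𝓕 (dilate φ ((k : ℤ) + 1)) : 𝓢(Rd d, ℂ)) ξ

theorem fourier_dilate_eq_zero {φ : 𝓢(Rd d, ℂ)} (hφ : IsLittlewoodPaley φ) {k : ℤ} {ξ : Rd d}
    (h : ‖ξ‖ < 2 ^ (k - 1) ∨ 2 ^ (k + 1) < ‖ξ‖) :
    (𝓕 (dilate φ k) : 𝓢(Rd d, ℂ)) ξ = 0 := by
  rw [fourier_dilate]
  by_contra hne
  have hm := hφ.support_subset (subset_tsupport _ hne)
  simp only [Set.mem_ofPred_eq, norm_smul, norm_zpow, Real.norm_ofNat] at hm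
  have h2 : (0 : ℝ) < 2 ^ (-k) := by positivity
  have e1 : (2 : ℝ) ^ (-k) * 2 ^ (k - 1) = 1 / 2 := by
    rw [← zpow_add₀ two_ne_zero, show -k + (k - 1) = -1 by ring]; norm_num
  have e2 : (2 : ℝ) ^ (-k) * 2 ^ (k + 1) = 2 := by
    rw [← zpow_add₀ two_ne_zero, show -k + (k + 1) = 1 by ring]; norm_num
  rcases h with h | h
  · have := mul_lt_mul_of_pos_left h h2
    linarith [hm.1]
  · have := mul_lt_mul_of_pos_left h h2
    linarith [hm.2]

theorem contDiff_lowMultiplier {φ : 𝓢(Rd d, ℂ)} (hφ : IsLittlewoodPaley φ) :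
    ContDiff ℝ ∞ (lowMultiplier φ) := by
  rw [contDiff_iff_contDiffAt]
  intro ξ₀
  obtain ⟨K, hK⟩ := pow_unbounded_of_one_lt (‖ξ₀‖ + 1) (one_lt_two : (1 : ℝ) < 2)
  have hev : lowMultiplier φ =ᶠ[𝓝 ξ₀] fun ξ => 1 - ∑ k ∈ Finset.range (K + 1),
      (𝓕 (dilate φ ((k : ℤ) + 1)) : 𝓢(Rd d, ℂ)) ξ := by
    filter_upwards [Metric.ball_mem_nhds ξ₀ one_pos] with ξ hξ
    rw [lowMultiplier, tsum_eq_sum]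
    intro k hk
    apply fourier_dilate_eq_zero hφ
    left
    rw [add_sub_cancel_right, zpow_natCast]
    have hk' : K ≤ k := by
      simp only [Finset.mem_range, not_lt] at hk
      omega
    have h1 : ‖ξ‖ < ‖ξ₀‖ + 1 := by
      rw [Metric.mem_ball, dist_eq_norm] at hξ
      have := norm_sub_norm_le ξ ξ₀
      linarith
    calc ‖ξ‖ < 2 ^ K := h1.trans hK
      _ ≤ 2 ^ k := pow_le_pow_right₀ one_le_two hk'
  refine ContDiffAt.congr_of_eventuallyEq ?_ hev
  refine ContDiff.contDiffAt (contDiff_const.sub (ContDiff.sum fun k _ => ?_))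
  exact (𝓕 (dilate φ ((k : ℤ) + 1)) : 𝓢(Rd d, ℂ)).smooth ⊤

theorem hasCompactSupport_lowMultiplier {φ : 𝓢(Rd d, ℂ)} (hφ : IsLittlewoodPaley φ) :
    HasCompactSupport (lowMultiplier φ) := by
  refine HasCompactSupport.intro (isCompact_closedBall (0 : Rd d) 2) fun ξ hξ => ?_
  have hn : 2 < ‖ξ‖ := by simpa using hξ
  have h0 : ξ ≠ 0 := by
    rintro rfl
    simp at hn
    linarith
  have hinj : Function.Injective fun k : ℕ => (k : ℤ) + 1 := by
    intro a b hab
    simpa using hab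
  have hs := (hinj.hasSum_iff (f := fun k : ℤ => (𝓕 (dilate φ k) : 𝓢(Rd d, ℂ)) ξ)
    (a := 1) (fun k hk => by
      apply fourier_dilate_eq_zero hφ
      right
      have hk0 : k + 1 ≤ 1 := by
        by_contra hcon
        exact hk ⟨(k - 1).toNat, by simp only; omega⟩
      calc (2 : ℝ) ^ (k + 1) ≤ 2 ^ (1 : ℤ) := zpow_le_zpow_right₀ one_le_two hk0
        _ < ‖ξ‖ := by simpa using hn)).mpr (hφ.hasSum_one ξ h0)
  have := hs.tsum_eq
  simp only [Function.comp_def] at this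
  rw [lowMultiplier, this, sub_self]

/-- The Schwartz function `Φ` with `Φ̂ = 1 - ∑_{k ≥ 1} φ̂_k`. -/
def lowPass {φ : 𝓢(Rd d, ℂ)} (hφ : IsLittlewoodPaley φ) : 𝓢(Rd d, ℂ) :=
  𝓕⁻ ((hasCompactSupport_lowMultiplier hφ).toSchwartzMap (contDiff_lowMultiplier hφ))

/-- The functions `Φ, φ_1, φ_2, …`. -/
def lpKernel {φ : 𝓢(Rd d, ℂ)} (hφ : IsLittlewoodPaley φ) (k : ℕ) : 𝓢(Rd d, ℂ) :=
  if k = 0 then lowPass hφ else dilate φ k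

/-- The function `y ↦ g (x - y)`. -/
def reflectAt (g : 𝓢(Rd d, ℂ)) (x : Rd d) : 𝓢(Rd d, ℂ) :=
  SchwartzMap.compSubConstCLM ℂ x
    (SchwartzMap.compCLMOfContinuousLinearEquiv ℂ (ContinuousLinearEquiv.neg ℝ) g)

theorem reflectAt_apply (g : 𝓢(Rd d, ℂ)) (x y : Rd d) : reflectAt g x y = g (x - y) := by
  simp [reflectAt]

/-- `Π_k f = φ_k ∗ f` (`Φ ∗ f` for `k = 0`), as the smooth function `x ↦ ⟨f, φ_k(x - ·)⟩`. -/
def lpProj {φ : 𝓢(Rd d, ℂ)} (hφ : IsLittlewoodPaley φ) (k : ℕ) (f : 𝓢'(Rd d, ℂ))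
    (x : Rd d) : ℂ :=
  f (reflectAt (lpKernel hφ k) x)

/-! ### Symbols and pseudo-differential operators -/

/-- Hörmander's class `S^m_{ρ,δ}`: `a(x, ξ)` is smooth and, for all orders `α` in `ξ` and `β` in
`x`, `|∂_ξ^α ∂_x^β a(x, ξ)| ≤ c (1 + |ξ|)^{m - ρ|α| + δ|β|}`. The norm of the mixed derivative of
orders `(α, β)`, as a multilinear map, bounds all partial derivatives of these orders and is bounded
by a multiple of their maximum. -/
structure IsSymbol (ρ δ m : ℝ) (a : Rd d → Rd d → ℂ) : Prop where
  smooth : ContDiff ℝ ∞ (fun p : Rd d × Rd d => a p.1 p.2)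
  bound : ∀ α β : ℕ, ∃ c : ℝ, ∀ x ξ : Rd d,
    ‖iteratedFDeriv ℝ α (fun η => iteratedFDeriv ℝ β (fun y => a y η) x) ξ‖
      ≤ c * (1 + ‖ξ‖) ^ (m - ρ * α + δ * β)

/-- `a_{j,k}(x, ξ) = (φ_j ∗ a(·, ξ))(x) φ̂_k(ξ)`. -/
def symbolPiece {φ : 𝓢(Rd d, ℂ)} (hφ : IsLittlewoodPaley φ) (a : Rd d → Rd d → ℂ)
    (j k : ℕ) (x ξ : Rd d) : ℂ :=
  ((lpKernel hφ j) ⋆[ContinuousLinearMap.mul ℝ ℂ, volume] (fun y => a y ξ)) x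
    * (𝓕 (lpKernel hφ k) : 𝓢(Rd d, ℂ)) ξ

theorem contDiff_integral_of_dominated (n : ℕ) : ∀ {V : Type} [NormedAddCommGroup V]
    [NormedSpace ℝ V] [CompleteSpace V] (G : Rd d → Rd d → V)
    (_ : ContDiff ℝ ∞ (fun p : Rd d × Rd d => G p.1 p.2))
    (_ : ∀ (i : ℕ) (ξ₀ : Rd d), ∃ s ∈ 𝓝 ξ₀, ∃ b : Rd d → ℝ, Integrable b ∧
      ∀ z, ∀ ξ ∈ s, ‖iteratedFDeriv ℝ i (G z) ξ‖ ≤ b z),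
    ContDiff ℝ n (fun ξ => ∫ z, G z ξ) := by
  have hdiff : ∀ {V : Type} [NormedAddCommGroup V]
      [NormedSpace ℝ V] [CompleteSpace V] (G : Rd d → Rd d → V)
      (_ : ContDiff ℝ ∞ (fun p : Rd d × Rd d => G p.1 p.2))
      (_ : ∀ (i : ℕ) (ξ₀ : Rd d), ∃ s ∈ 𝓝 ξ₀, ∃ b : Rd d → ℝ, Integrable b ∧
        ∀ z, ∀ ξ ∈ s, ‖iteratedFDeriv ℝ i (G z) ξ‖ ≤ b z) (ξ₀ : Rd d),
      HasFDerivAt (fun ξ => ∫ z, G z ξ) (∫ z, fderiv ℝ (G z) ξ₀) ξ₀ := by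
    intro V _ _ _ G hG hb ξ₀
    have hGz : ∀ z, ContDiff ℝ ∞ (G z) := fun z => hG.comp (contDiff_prodMk_right z)
    have hG' : ContDiff ℝ ∞ (fun p : Rd d × Rd d => fderiv ℝ (G p.1) p.2) :=
      ContDiff.fderiv (f := fun (p : Rd d × Rd d) η => G p.1 η)
        (hG.comp ((contDiff_fst.comp contDiff_fst).prodMk contDiff_snd)) contDiff_snd (by simp)
    obtain ⟨s, hs, b, hbi, hbd⟩ := hb 1 ξ₀
    obtain ⟨s₀, hs₀, b₀, hbi₀, hbd₀⟩ := hb 0 ξ₀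
    have hmeas : ∀ ξ, AEStronglyMeasurable (fun z => G z ξ) volume := fun ξ =>
      (hG.continuous.comp (Continuous.prodMk_left ξ)).aestronglyMeasurable
    refine hasFDerivAt_integral_of_dominated_of_fderiv_le (bound := b)
      (F := fun ξ z => G z ξ) (F' := fun ξ z => fderiv ℝ (G z) ξ) hs
      (Eventually.of_forall hmeas) ?_ ?_ ?_ hbi ?_
    · refine hbi₀.mono' (hmeas ξ₀) (Eventually.of_forall fun z => ?_)
      simpa using hbd₀ z ξ₀ (mem_of_mem_nhds hs₀)
    · exact (hG'.continuous.comp (Continuous.prodMk_left ξ₀)).aestronglyMeasurable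
    · refine Eventually.of_forall fun z ξ hξ => ?_
      have := hbd z ξ hξ
      rwa [norm_iteratedFDeriv_one] at this
    · exact Eventually.of_forall fun z ξ _ =>
        ((hGz z).differentiable (by simp) ξ).hasFDerivAt
  induction n with
  | zero =>
    intro V _ _ _ G hG hb
    rw [Nat.cast_zero, contDiff_zero]
    exact continuous_iff_continuousAt.2 fun ξ₀ => (hdiff G hG hb ξ₀).continuousAt
  | succ n ih =>
    intro V _ _ _ G hG hb
    rw [Nat.cast_succ, contDiff_succ_iff_hasFDerivAt]
    refine ⟨fun ξ => ∫ z, fderiv ℝ (G z) ξ, ih _ ?_ ?_, hdiff G hG hb⟩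
    · exact ContDiff.fderiv (f := fun (p : Rd d × Rd d) η => G p.1 η)
        (hG.comp ((contDiff_fst.comp contDiff_fst).prodMk contDiff_snd)) contDiff_snd (by simp)
    · intro i ξ₀
      obtain ⟨s, hs, b, hbi, hbd⟩ := hb (i + 1) ξ₀
      refine ⟨s, hs, b, hbi, fun z ξ hξ => ?_⟩
      rw [norm_iteratedFDeriv_fderiv]
      exact hbd z ξ hξ

theorem IsSymbol.norm_iteratedFDeriv_le {ρ δ m : ℝ} {a : Rd d → Rd d → ℂ}
    (ha : IsSymbol ρ δ m a) (i : ℕ) : ∃ c : ℝ, ∀ x ξ : Rd d,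
      ‖iteratedFDeriv ℝ i (a x) ξ‖ ≤ c * (1 + ‖ξ‖) ^ (m - ρ * i) := by
  obtain ⟨c, hc⟩ := ha.bound i 0
  refine ⟨c, fun x ξ => ?_⟩
  have h := hc x ξ
  have e : (fun η => iteratedFDeriv ℝ 0 (fun y => a y η) x)
      = (continuousMultilinearCurryFin0 ℝ (Rd d) ℂ).symm ∘ a x := by
    funext η
    rw [iteratedFDeriv_zero_eq_comp]
    rfl
  rw [e, LinearIsometryEquiv.norm_iteratedFDeriv_comp_left] at h
  simpa using h

/-- The pieces are smooth in `ξ`. -/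
theorem contDiff_symbolPiece {φ : 𝓢(Rd d, ℂ)} (hφ : IsLittlewoodPaley φ) {ρ δ m : ℝ}
    {a : Rd d → Rd d → ℂ} (ha : IsSymbol ρ δ m a) (j k : ℕ) (x : Rd d) :
    ContDiff ℝ ∞ (symbolPiece hφ a j k x) := by
  refine ContDiff.mul ?_ ((𝓕 (lpKernel hφ k) : 𝓢(Rd d, ℂ)).smooth ⊤)
  rw [contDiff_infty]
  intro n
  have haz : ∀ z, ContDiff ℝ ∞ (a z) := fun z => ha.smooth.comp (contDiff_prodMk_right z)
  refine contDiff_integral_of_dominated n (fun z ξ => lpKernel hφ j z * a (x - z) ξ) ?_ ?_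
  · refine ContDiff.mul (((lpKernel hφ j).smooth ⊤).comp contDiff_fst) ?_
    exact ha.smooth.comp ((contDiff_const.sub contDiff_fst).prodMk contDiff_snd)
  · intro i ξ₀
    obtain ⟨c, hc⟩ := ha.norm_iteratedFDeriv_le i
    have hcont : Continuous fun ξ : Rd d => c * (1 + ‖ξ‖) ^ (m - ρ * i) := by
      refine continuous_const.mul (Continuous.rpow_const (by fun_prop) fun ξ => Or.inl ?_)
      positivity
    refine ⟨{ξ | c * (1 + ‖ξ‖) ^ (m - ρ * i) < c * (1 + ‖ξ₀‖) ^ (m - ρ * i) + 1},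
      (hcont.tendsto ξ₀).eventually_lt_const (lt_add_one _),
      fun z => ‖lpKernel hφ j z‖ * (c * (1 + ‖ξ₀‖) ^ (m - ρ * i) + 1),
      (lpKernel hφ j).integrable.norm.mul_const _, fun z ξ hξ => ?_⟩
    have e : (fun ξ => lpKernel hφ j z * a (x - z) ξ) = lpKernel hφ j z • a (x - z) := rfl
    rw [e, iteratedFDeriv_const_smul_apply
      (((haz (x - z)).of_le (by exact_mod_cast le_top)).contDiffAt), norm_smul]
    exact mul_le_mul_of_nonneg_left ((hc _ _).trans (le_of_lt hξ)) (norm_nonneg _)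

theorem hasCompactSupport_fourier_lpKernel {φ : 𝓢(Rd d, ℂ)} (hφ : IsLittlewoodPaley φ) (k : ℕ) :
    HasCompactSupport (𝓕 (lpKernel hφ k) : 𝓢(Rd d, ℂ)) := by
  by_cases hk : k = 0
  · rw [lpKernel, if_pos hk, lowPass, FourierTransform.fourier_fourierInv_eq]
    exact hasCompactSupport_lowMultiplier hφ
  · rw [lpKernel, if_neg hk]
    refine HasCompactSupport.intro (isCompact_closedBall (0 : Rd d) (2 ^ ((k : ℤ) + 1)))
      fun ξ hξ => fourier_dilate_eq_zero hφ (Or.inr ?_)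
    simpa using hξ

/-- The Schwartz function `ξ ↦ a_{j,k}(x, ξ) e^{2πi⟨x, ξ⟩}`. -/
def pieceTest {φ : 𝓢(Rd d, ℂ)} (hφ : IsLittlewoodPaley φ) {ρ δ m : ℝ}
    {a : Rd d → Rd d → ℂ} (ha : IsSymbol ρ δ m a) (j k : ℕ) (x : Rd d) : 𝓢(Rd d, ℂ) :=
  HasCompactSupport.toSchwartzMap
    (f := fun ξ => symbolPiece hφ a j k x ξ
      * Complex.exp (2 * Real.pi * Complex.I * (inner ℝ x ξ : ℝ)))
    ((hasCompactSupport_fourier_lpKernel hφ k).mul_left.mul_right)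
    ((contDiff_symbolPiece hφ ha j k x).mul (ContDiff.cexp (contDiff_const.mul
      (Complex.ofRealCLM.contDiff.comp (contDiff_const.inner ℝ contDiff_id)))))

/-- `T_{[a_{j,k}]} f(x) = ∫ a_{j,k}(x, ξ) f̂(ξ) e^{2πi⟨x, ξ⟩} dξ`, for `f ∈ S'`, where the integral
is the pairing of the distribution `f̂` with the test function `a_{j,k}(x, ·) e^{2πi⟨x, ·⟩}`. -/
def pieceOp {φ : 𝓢(Rd d, ℂ)} (hφ : IsLittlewoodPaley φ) {ρ δ m : ℝ}
    {a : Rd d → Rd d → ℂ} (ha : IsSymbol ρ δ m a) (j k : ℕ) (f : 𝓢'(Rd d, ℂ)) (x : Rd d) : ℂ :=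
  (𝓕 f) (pieceTest hφ ha j k x)

/-- The tempered distribution `u` is (integration against) the function `g`. -/
def IsGivenBy (u : 𝓢'(Rd d, ℂ)) (g : Rd d → ℂ) : Prop :=
  ∀ ψ : 𝓢(Rd d, ℂ), Integrable (fun x => g x * ψ x) ∧ u ψ = ∫ x, g x * ψ x

/-- `u = T_{[a]} f`: the functions `∑_{k ≤ N} ∑_{j ≤ N} T_{[a_{j,k}]} f` are tempered distributions
and converge to `u` in `S'` as `N → ∞`. Limits in `S'` being unique, there is at most one such
`u`; that there is one says that `T_{[a]} f` is defined. -/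
def IsPseudoDiff {φ : 𝓢(Rd d, ℂ)} (hφ : IsLittlewoodPaley φ) {ρ δ m : ℝ}
    {a : Rd d → Rd d → ℂ} (ha : IsSymbol ρ δ m a) (f u : 𝓢'(Rd d, ℂ)) : Prop :=
  ∃ U : ℕ → 𝓢'(Rd d, ℂ),
    (∀ N, IsGivenBy (U N) fun x => ∑ k ∈ Finset.range (N + 1), ∑ j ∈ Finset.range (N + 1),
      pieceOp hφ ha j k f x) ∧
    Tendsto U atTop (𝓝 u)

/-! ### The localized quantities -/

/-- The dyadic cube `∏_i [2^{-μ} n_i, 2^{-μ} (n_i + 1))`; these are the elements of `D_μ`. -/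
def dyadicCube (μ : ℤ) (n : Fin d → ℤ) : Set (Rd d) :=
  {x | ∀ i, (2 : ℝ) ^ (-μ) * n i ≤ x i ∧ x i < (2 : ℝ) ^ (-μ) * (n i + 1)}

/-- `sup_{P ∈ D_μ} (|P|⁻¹ ∫_P ∑_{k ≥ μ} 2^{skq} |Π_k f(x)|^q dx)^{1/q}`, with values in `[0, ∞]`. -/
def localSup {φ : 𝓢(Rd d, ℂ)} (hφ : IsLittlewoodPaley φ) (s q : ℝ) (μ : ℕ)
    (f : 𝓢'(Rd d, ℂ)) : ℝ≥0∞ :=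
  ⨆ n : Fin d → ℤ,
    ((volume (dyadicCube (μ : ℤ) n))⁻¹ * ∫⁻ x in dyadicCube (μ : ℤ) n,
      ∑' k : Set.Ici μ, ENNReal.ofReal ((2 : ℝ) ^ (s * (k : ℕ) * q) * ‖lpProj hφ k f x‖ ^ q))
      ^ (1 / q)

/-- `sup_{0 ≤ k ≤ μ - 1} ‖2^{ks} Π_k f‖_{L^∞}`, with values in `[0, ∞]`. -/
def lowSup {φ : 𝓢(Rd d, ℂ)} (hφ : IsLittlewoodPaley φ) (s : ℝ) (μ : ℕ)
    (f : 𝓢'(Rd d, ℂ)) : ℝ≥0∞ :=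
  ⨆ k ∈ Finset.range μ,
    eLpNorm (fun x => (((2 : ℝ) ^ ((k : ℝ) * s) : ℝ) : ℂ) * lpProj hφ k f x) ⊤ volume

/-- `τ_q = d / min(1, q) - d`. -/
def tau (d : ℕ) (q : ℝ) : ℝ := d / min 1 q - d

end TypeOneOne

end

open TypeOneOne

/-! Write F_k = Π_k f. Summing a_{j,k} over j ≤ N convolves the symbol in x with a dilate of Φ,
because the kernels telescope (`sum_lpKernel`); these dilates form an approximate identity. Hence
T_{[a]} f = ∑_k T_k F_k, where T_k has the kernel K_k(x, x - z) and K_k(x, ·) is the inverse Fourier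
transform of a(x, ·) cut off to |ξ| ~ 2^k. Rescaling ξ by 2^k gives |K_k(x, y)| ≲ 2^{km} 2^{kd} (1 +
2^k|y|)^{-n} for every n (`IsSymbol.norm_symbolKernel_le`); only derivatives in ξ enter here.

The heart of the matter is the kernel of Π_l T_k (`IsSymbol.enorm_integral_dilate_mul_le_max`). It
is bounded by 2^{km} times a decaying weight at the coarser of the scales l, k, with an extra factor
2^{-L(l-k)}, L arbitrary, when l > k. For the gain, φ is written as a divergence of functions of the
same kind and one integrates by parts L times: each step yields 2^{-l}, while differentiating a(x,
ξ) e^{2πi⟨x,ξ⟩} in x raises the order of the symbol by one only and so costs 2^k.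

For l < k no gain is used, and the condition s > τ_q takes over. Trading 2^{sl} for 2^{sk} leaves
2^{-s(k-l)}. Passing from a weighted mean of |F_k| at scale l to a weighted q-mean costs nothing if
q ≥ 1, by Hölder, and 2^{(k-l)τ_q} if q < 1, since F_k is reproduced by a kernel at the finer scale
k (`rpow_lintegral_wt_mul_le`). Altogether the matrix (l, k) decays like 2^{-(s-τ_q)|l-k|}
(`offDiag_le`).

To localize (`cubeMean_tsum_le`), let l ≥ μ. For k < μ the decay factors through μ and sup norms
suffice. For k ≥ μ all weights live at scales at least as fine as the cubes, so averaging over a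
cube of D_μ produces a weight at scale μ, whose integral against a function is controlled by the
means over D_μ. Since l ≥ μ ≥ 1, the outer projection is never Φ, and the divergence trick always
applies.

Existence of T_{[a]} f: finiteness of A_μ(f) makes every F_k bounded and ∑_k 2^{km} ∫ (1 + |x|)^{-M}
|F_k| finite (`tsum_lintegral_wt_mul_lpProj_lt_top`). This majorizes all truncations uniformly, and
dominated convergence gives the limit in S' as a function. -/

noncomputable section

namespace TypeOneOne

variable {d : ℕ}

/-! ### Polynomially decaying weights -/

/-- The weight `2^{kd} (1 + 2^k |y|)^{-M}`. -/
def wt (k : ℕ) (M : ℝ) (y : Rd d) : ℝ := 2 ^ (k * d) * (1 + 2 ^ k * ‖y‖) ^ (-M)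

theorem one_le_one_add_mul_norm (k : ℕ) (y : Rd d) : (1 : ℝ) ≤ 1 + 2 ^ k * ‖y‖ := by
  have : (0 : ℝ) ≤ 2 ^ k * ‖y‖ := by positivity
  linarith

theorem wt_pos (k : ℕ) (M : ℝ) (y : Rd d) : 0 < wt k M y := by
  have := one_le_one_add_mul_norm k y
  unfold wt
  positivity

theorem continuous_wt (k : ℕ) (M : ℝ) : Continuous (wt k M : Rd d → ℝ) := by
  unfold wt
  refine continuous_const.mul (Continuous.rpow_const (by fun_prop) fun y => Or.inl ?_)
  have := one_le_one_add_mul_norm k y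
  positivity

theorem wt_anti (k : ℕ) {M N : ℝ} (h : M ≤ N) (y : Rd d) : wt k N y ≤ wt k M y := by
  unfold wt
  gcongr
  exact one_le_one_add_mul_norm k y

theorem wt_neg (k : ℕ) (M : ℝ) (y : Rd d) : wt k M (-y) = wt k M y := by
  simp [wt]

theorem wt_sub_comm (k : ℕ) (M : ℝ) (x y : Rd d) : wt k M (x - y) = wt k M (y - x) := by
  rw [← wt_neg, neg_sub]

theorem one_add_mul_norm_le (k : ℕ) (x y : Rd d) :
    1 + 2 ^ k * ‖x‖ ≤ (1 + 2 ^ k * ‖y‖) * (1 + 2 ^ k * ‖x - y‖) := by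
  have h1 : ‖x‖ ≤ ‖y‖ + ‖x - y‖ := by
    simpa using norm_add_le y (x - y)
  have h2 : (0 : ℝ) < 2 ^ k := by positivity
  nlinarith [mul_le_mul_of_nonneg_left h1 h2.le, mul_nonneg (mul_nonneg h2.le (norm_nonneg y))
    (mul_nonneg h2.le (norm_nonneg (x - y)))]

/-- Peetre's inequality: the centre of a weight can be moved at the price of M powers of the
rescaled distance. -/
theorem wt_le_mul (k : ℕ) {M : ℝ} (hM : 0 ≤ M) (x y : Rd d) :
    wt k M x ≤ wt k M y * (1 + 2 ^ k * ‖x - y‖) ^ M := by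
  have h1 := one_le_one_add_mul_norm k x
  have h2 := one_le_one_add_mul_norm k y
  have h3 := one_le_one_add_mul_norm k (x - y)
  have h := one_add_mul_norm_le k y x
  rw [norm_sub_rev y x] at h
  unfold wt
  rw [mul_assoc]
  gcongr
  rw [Real.rpow_neg (by positivity), Real.rpow_neg (by positivity), ← div_eq_inv_mul,
    inv_eq_one_div, div_le_div_iff₀ (by positivity) (by positivity), one_mul,
    ← Real.mul_rpow (by positivity) (by positivity), mul_comm (1 + 2 ^ k * ‖x - y‖)]
  exact Real.rpow_le_rpow (by positivity) h hM

theorem wt_mul_rpow (k : ℕ) (M N : ℝ) (y : Rd d) :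
    wt k N y * (1 + 2 ^ k * ‖y‖) ^ M = wt k (N - M) y := by
  have h1 := one_le_one_add_mul_norm k y
  unfold wt
  rw [mul_assoc, ← Real.rpow_add (by positivity)]
  congr 2
  ring

/-- The integral of every `wt k M`. -/
def wtMass (d : ℕ) (M : ℝ) : ℝ≥0∞ := ∫⁻ y : Rd d, ENNReal.ofReal ((1 + ‖y‖) ^ (-M))

theorem wtMass_lt_top {M : ℝ} (hM : d < M) : wtMass d M < ⊤ := by
  apply finite_integral_one_add_norm
  simpa using hM

theorem lintegral_wt (k : ℕ) (M : ℝ) :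
    ∫⁻ y : Rd d, ENNReal.ofReal (wt k M y) = wtMass d M := by
  have h2 : (2 : ℝ) ^ k ≠ 0 := by positivity
  have hmap := Measure.map_addHaar_smul (volume : Measure (Rd d)) h2
  have hme : Measurable fun y : Rd d => (2 : ℝ) ^ k • y := measurable_const_smul _
  have hf : Measurable fun y : Rd d => ENNReal.ofReal ((1 + ‖y‖) ^ (-M)) := by fun_prop
  have h := lintegral_map (μ := volume) hf hme
  rw [hmap, lintegral_smul_measure] at h
  have e : ∀ y : Rd d, ENNReal.ofReal (wt k M y) = ENNReal.ofReal (2 ^ (k * d)) *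
      ENNReal.ofReal ((1 + ‖(2 : ℝ) ^ k • y‖) ^ (-M)) := by
    intro y
    rw [← ENNReal.ofReal_mul (by positivity), norm_smul]
    simp [wt]
  simp_rw [e]
  rw [lintegral_const_mul' _ _ ENNReal.ofReal_ne_top, ← h, smul_eq_mul, ← mul_assoc,
    ← ENNReal.ofReal_mul (by positivity), finrank_euclideanSpace_fin, abs_of_pos (by positivity),
    ← pow_mul, mul_inv_cancel₀ (by positivity), ENNReal.ofReal_one, one_mul, wtMass]

theorem lintegral_wt_sub_left (k : ℕ) (M : ℝ) (x : Rd d) :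
    ∫⁻ y : Rd d, ENNReal.ofReal (wt k M (x - y)) = wtMass d M := by
  rw [lintegral_sub_left_eq_self (fun y => ENNReal.ofReal (wt k M y)) x, lintegral_wt]

theorem lintegral_wt_sub_right (k : ℕ) (M : ℝ) (x : Rd d) :
    ∫⁻ y : Rd d, ENNReal.ofReal (wt k M (y - x)) = wtMass d M := by
  rw [lintegral_sub_right_eq_self (fun y => ENNReal.ofReal (wt k M y)) x, lintegral_wt]

theorem one_add_mul_norm_mono {a b : ℕ} (hab : a ≤ b) (y : Rd d) :
    1 + (2 : ℝ) ^ a * ‖y‖ ≤ 1 + 2 ^ b * ‖y‖ := by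
  gcongr
  norm_num

/-- Peetre's inequality moves the coarse weight from y to z. The cost (1 + 2^a|y-z|)^M is at most (1
+ 2^b|y-z|)^M, which M powers of the fine weight absorb. -/
theorem wt_mul_wt_le {a b : ℕ} (hab : a ≤ b) {M : ℝ} (hM : 0 ≤ M) (x y z : Rd d) (N : ℝ) :
    wt a M (x - y) * wt b N (y - z) ≤ wt a M (x - z) * wt b (N - M) (y - z) := by
  have h1 := one_le_one_add_mul_norm a (y - z)
  have hp := wt_pos a M (x - z)
  have hp2 := wt_pos b N (y - z)
  calc wt a M (x - y) * wt b N (y - z)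
      ≤ wt a M (x - z) * (1 + 2 ^ a * ‖(x - y) - (x - z)‖) ^ M * wt b N (y - z) := by
        gcongr
        exact wt_le_mul a hM _ _
    _ ≤ wt a M (x - z) * (1 + 2 ^ b * ‖y - z‖) ^ M * wt b N (y - z) := by
        rw [sub_sub_sub_cancel_left, norm_sub_rev]
        gcongr
        norm_num
    _ = _ := by rw [mul_assoc, mul_comm ((1 + _) ^ M), wt_mul_rpow]

theorem lintegral_wt_mul_wt_le {a b : ℕ} (hab : a ≤ b) {M N : ℝ} (hM : 0 ≤ M)
    (x z : Rd d) :
    ∫⁻ y, ENNReal.ofReal (wt a M (x - y)) * ENNReal.ofReal (wt b N (y - z)) ≤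
      wtMass d (N - M) * ENNReal.ofReal (wt a M (x - z)) := by
  calc _ ≤ ∫⁻ y, ENNReal.ofReal (wt a M (x - z)) * ENNReal.ofReal (wt b (N - M) (y - z)) := by
        refine lintegral_mono fun y => ?_
        rw [← ENNReal.ofReal_mul (wt_pos _ _ _).le, ← ENNReal.ofReal_mul (wt_pos _ _ _).le]
        exact ENNReal.ofReal_le_ofReal (wt_mul_wt_le hab hM x y z N)
    _ = _ := by
        rw [lintegral_const_mul _ (by have := continuous_wt (d := d) b (N - M); fun_prop),
          lintegral_wt_sub_right, mul_comm]

/-- The convolution of two weights is dominated by the weight at the coarser scale. -/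
theorem lintegral_wt_mul_wt_le_min (a b : ℕ) {M N : ℝ} (hM : 0 ≤ M) (hN : M ≤ N) (x z : Rd d) :
    ∫⁻ y, ENNReal.ofReal (wt a N (x - y)) * ENNReal.ofReal (wt b N (y - z)) ≤
      wtMass d (N - M) * ENNReal.ofReal (wt (min a b) M (x - z)) := by
  rcases le_total a b with h | h
  · rw [min_eq_left h]
    refine le_trans (lintegral_mono fun y => ?_) (lintegral_wt_mul_wt_le h hM x z)
    gcongr
    exact wt_anti a hN _
  · rw [min_eq_right h]
    calc _ ≤ ∫⁻ y, ENNReal.ofReal (wt b M (z - y)) * ENNReal.ofReal (wt a N (y - x)) := by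
          refine lintegral_mono fun y => ?_
          rw [mul_comm, wt_sub_comm b N, wt_sub_comm a N]
          gcongr
          exact wt_anti b hN _
      _ ≤ _ := by
          rw [wt_sub_comm b M x z]
          exact lintegral_wt_mul_wt_le h hM z x

/-- Weights at different scales and centres are comparable. -/
theorem wt_le_const_mul_wt_zero (k : ℕ) {M : ℝ} (hM : 0 ≤ M) (x y : Rd d) :
    wt k M (x - y) ≤ 2 ^ (k * d) * (1 + ‖x‖) ^ M * wt 0 M y := by
  have h1 := one_le_one_add_mul_norm k (x - y)
  have h : wt k M (x - y) ≤ 2 ^ (k * d) * wt 0 M (x - y) := by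
    unfold wt
    simp only [zero_mul, pow_zero, one_mul]
    gcongr 2 ^ (k * d) * ?_
    refine Real.rpow_le_rpow_of_nonpos (by positivity) ?_ (by linarith)
    have : (1 : ℝ) ≤ 2 ^ k := one_le_pow₀ one_le_two
    nlinarith [norm_nonneg (x - y)]
  refine h.trans ?_
  rw [mul_assoc]
  gcongr
  have := wt_le_mul 0 hM (y - x) y
  rw [wt_sub_comm] 
  refine this.trans (le_of_eq ?_)
  simp [mul_comm]

theorem wt_zero_le (k : ℕ) {M : ℝ} (hM : 0 ≤ M) (y : Rd d) :
    wt 0 M y ≤ ((2 : ℝ) ^ k) ^ M * wt k M y := by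
  have h1 := one_le_one_add_mul_norm k y
  have h3 : (1 : ℝ) ≤ 2 ^ k := one_le_pow₀ one_le_two
  have h2 : (1 : ℝ) ≤ 2 ^ (k * d) := one_le_pow₀ one_le_two
  unfold wt
  simp only [zero_mul, pow_zero, one_mul]
  calc (1 + ‖y‖) ^ (-M) = ((2 : ℝ) ^ k) ^ M * ((2 : ℝ) ^ k * (1 + ‖y‖)) ^ (-M) := by
        rw [Real.mul_rpow (by positivity) (by positivity), ← mul_assoc, ← Real.rpow_add
          (by positivity)]
        simp
    _ ≤ ((2 : ℝ) ^ k) ^ M * (1 + 2 ^ k * ‖y‖) ^ (-M) := by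
        gcongr ?_ * ?_
        refine Real.rpow_le_rpow_of_nonpos (by positivity) ?_ (by linarith)
        nlinarith [norm_nonneg y]
    _ ≤ _ := by
        gcongr
        exact le_mul_of_one_le_left (by positivity) h2

/-! ### Dyadic cubes -/

theorem dyadicCube_eq_preimage (μ : ℤ) (n : Fin d → ℤ) :
    dyadicCube μ n = (MeasurableEquiv.toLp 2 (Fin d → ℝ)).symm ⁻¹'
      (Set.univ.pi fun i => Set.Ico ((2 : ℝ) ^ (-μ) * n i) ((2 : ℝ) ^ (-μ) * (n i + 1))) := by
  ext x
  simp [dyadicCube]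

theorem measurableSet_dyadicCube (μ : ℤ) (n : Fin d → ℤ) :
    MeasurableSet (dyadicCube μ n) := by
  rw [dyadicCube_eq_preimage]
  exact (MeasurableEquiv.measurable _) (MeasurableSet.univ_pi fun i => measurableSet_Ico)

theorem volume_dyadicCube (μ : ℕ) (n : Fin d → ℤ) :
    volume (dyadicCube (μ : ℤ) n) = (ENNReal.ofReal (2 ^ (μ * d)))⁻¹ := by
  rw [dyadicCube_eq_preimage,
    (EuclideanSpace.volume_preserving_symm_measurableEquiv_toLp (Fin d)).measure_preimage
      (MeasurableSet.univ_pi fun i => measurableSet_Ico).nullMeasurableSet, Real.volume_pi_Ico]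
  have : ∀ i, (2 : ℝ) ^ (-(μ : ℤ)) * (n i + 1) - (2 : ℝ) ^ (-(μ : ℤ)) * n i = (2 ^ μ)⁻¹ := by
    intro i
    rw [zpow_neg, zpow_natCast]
    ring
  simp_rw [this]
  rw [Finset.prod_const, Finset.card_univ, Fintype.card_fin, ← ENNReal.ofReal_inv_of_pos
    (by positivity), ← ENNReal.ofReal_pow (by positivity), inv_pow, pow_mul]

theorem iUnion_dyadicCube (μ : ℕ) : ⋃ n : Fin d → ℤ, dyadicCube (μ : ℤ) n = Set.univ := by
  refine Set.eq_univ_of_forall fun x => Set.mem_iUnion.2 ⟨fun i => ⌊(2 : ℝ) ^ μ * x i⌋, fun i => ?_⟩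
  have h2 : (0 : ℝ) < 2 ^ μ := by positivity
  rw [zpow_neg, zpow_natCast, inv_mul_le_iff₀ h2, lt_inv_mul_iff₀ h2]
  exact ⟨Int.floor_le _, Int.lt_floor_add_one _⟩

theorem pairwise_disjoint_dyadicCube (μ : ℕ) :
    Pairwise (Function.onFun Disjoint fun n : Fin d → ℤ => dyadicCube (μ : ℤ) n) := by
  intro n n' hn
  rw [Function.onFun, Set.disjoint_left]
  intro x hx hx'
  refine hn (funext fun i => ?_)
  have h2 : (0 : ℝ) < 2 ^ μ := by positivity
  have key : ∀ m : Fin d → ℤ, x ∈ dyadicCube (μ : ℤ) m → ⌊(2 : ℝ) ^ μ * x i⌋ = m i := by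
    intro m hm
    have := hm i
    rw [zpow_neg, zpow_natCast, inv_mul_le_iff₀ h2, lt_inv_mul_iff₀ h2] at this
    exact Int.floor_eq_iff.2 this
  rw [← key n hx, ← key n' hx']

theorem norm_sub_le_of_mem_dyadicCube {μ : ℕ} {n : Fin d → ℤ} {x y : Rd d}
    (hx : x ∈ dyadicCube (μ : ℤ) n) (hy : y ∈ dyadicCube (μ : ℤ) n) :
    2 ^ μ * ‖x - y‖ ≤ Real.sqrt d := by
  have h2 : (0 : ℝ) < 2 ^ μ := by positivity
  rw [EuclideanSpace.norm_eq]
  rw [← Real.sqrt_sq h2.le, ← Real.sqrt_mul (by positivity)]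
  refine Real.sqrt_le_sqrt ?_
  rw [Finset.mul_sum]
  calc _ ≤ ∑ i : Fin d, (1 : ℝ) := by
        refine Finset.sum_le_sum fun i _ => ?_
        have h1 := hx i
        have h3 := hy i
        rw [zpow_neg, zpow_natCast, inv_mul_le_iff₀ h2, lt_inv_mul_iff₀ h2] at h1 h3
        rw [← mul_pow, Real.norm_eq_abs, ← abs_of_pos h2, ← abs_mul, sq_abs]
        simp only [PiLp.sub_apply]
        rw [sq_le_one_iff_abs_le_one, abs_le]
        constructor <;> nlinarith
    _ = d := by simp

/-- The supremum of the means over the dyadic cubes of side `2^{-μ}`. -/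
def cubeMean (μ : ℕ) (H : Rd d → ℝ≥0∞) : ℝ≥0∞ :=
  ⨆ n : Fin d → ℤ, (volume (dyadicCube (μ : ℤ) n))⁻¹ * ∫⁻ x in dyadicCube (μ : ℤ) n, H x

theorem wt_le_of_mem_dyadicCube {μ : ℕ} {M : ℝ} (hM : 0 ≤ M) {n : Fin d → ℤ} {x y : Rd d}
    (hx : x ∈ dyadicCube (μ : ℤ) n) (hy : y ∈ dyadicCube (μ : ℤ) n) (z : Rd d) :
    wt μ M (z - x) ≤ (1 + Real.sqrt d) ^ M * wt μ M (z - y) := by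
  have h := wt_le_mul μ hM (z - x) (z - y)
  have h1 := norm_sub_le_of_mem_dyadicCube hy hx
  have hp := wt_pos μ M (z - y)
  refine h.trans ?_
  rw [sub_sub_sub_cancel_left, mul_comm]
  gcongr

/-- A weight at scale μ is constant on a cube of side 2^{-μ} up to the factor (1 + √d)^M, so it may
be replaced there by its mean. -/
theorem setLIntegral_wt_mul_le {μ : ℕ} {M : ℝ} (hM : 0 ≤ M) (n : Fin d → ℤ) (x : Rd d)
    (H : Rd d → ℝ≥0∞) :
    ∫⁻ y in dyadicCube (μ : ℤ) n, ENNReal.ofReal (wt μ M (x - y)) * H y ≤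
      ENNReal.ofReal ((1 + Real.sqrt d) ^ M) *
        (∫⁻ y in dyadicCube (μ : ℤ) n, ENNReal.ofReal (wt μ M (x - y))) * cubeMean μ H := by
  set R := dyadicCube (μ : ℤ) n with hR
  have hc : (0 : ℝ) ≤ (1 + Real.sqrt d) ^ M := by positivity
  have hvol : volume R = (ENNReal.ofReal (2 ^ (μ * d)))⁻¹ := volume_dyadicCube μ n
  have hv0 : volume R ≠ 0 := by
    rw [hvol]; simp
  have hvt : volume R ≠ ⊤ := by
    rw [hvol]; simp
  have hmeas : Measurable fun y : Rd d => ENNReal.ofReal (wt μ M (x - y)) := by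
    have := continuous_wt (d := d) μ M
    fun_prop
  have hpt : ∀ y ∈ R, ENNReal.ofReal (wt μ M (x - y)) ≤ (volume R)⁻¹ *
      (ENNReal.ofReal ((1 + Real.sqrt d) ^ M) *
        ∫⁻ z in R, ENNReal.ofReal (wt μ M (x - z))) := by
    intro y hy
    rw [← ENNReal.div_eq_inv_mul, ENNReal.le_div_iff_mul_le (Or.inl hv0) (Or.inl hvt),
      ← setLIntegral_const, ← lintegral_const_mul _ hmeas]
    refine setLIntegral_mono' (measurableSet_dyadicCube _ _) fun z hz => ?_
    rw [← ENNReal.ofReal_mul hc]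
    exact ENNReal.ofReal_le_ofReal (wt_le_of_mem_dyadicCube hM hy hz x)
  calc _ ≤ ∫⁻ y in R, ((volume R)⁻¹ * (ENNReal.ofReal ((1 + Real.sqrt d) ^ M) *
        ∫⁻ z in R, ENNReal.ofReal (wt μ M (x - z)))) * H y := by
        refine setLIntegral_mono' (measurableSet_dyadicCube _ _) fun y hy => ?_
        gcongr
        exact hpt y hy
    _ = (ENNReal.ofReal ((1 + Real.sqrt d) ^ M) * ∫⁻ z in R, ENNReal.ofReal (wt μ M (x - z))) *
        ((volume R)⁻¹ * ∫⁻ y in R, H y) := by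
        rw [lintegral_const_mul' _ _ ?_]
        · ring
        · refine ENNReal.mul_ne_top (ENNReal.inv_ne_top.2 hv0) (ENNReal.mul_ne_top
            ENNReal.ofReal_ne_top (ne_of_lt ?_))
          calc _ ≤ ∫⁻ z in R, ENNReal.ofReal (2 ^ (μ * d)) := by
                refine lintegral_mono fun z => ENNReal.ofReal_le_ofReal ?_
                unfold wt
                refine mul_le_of_le_one_right (by positivity) ?_
                exact Real.rpow_le_one_of_one_le_of_nonpos (one_le_one_add_mul_norm _ _)
                  (by linarith)
            _ < ⊤ := by
                rw [setLIntegral_const]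
                exact ENNReal.mul_lt_top ENNReal.ofReal_lt_top hvt.lt_top
    _ ≤ _ := by
        gcongr
        exact le_iSup (fun n : Fin d → ℤ =>
          (volume (dyadicCube (μ : ℤ) n))⁻¹ * ∫⁻ x in dyadicCube (μ : ℤ) n, H x) n

/-- A weighted integral is dominated by the means over cubes. -/
theorem lintegral_wt_mul_le_cubeMean (μ : ℕ) {M : ℝ} (hM : 0 ≤ M) (x : Rd d) (H : Rd d → ℝ≥0∞) :
    ∫⁻ y, ENNReal.ofReal (wt μ M (x - y)) * H y ≤
      ENNReal.ofReal ((1 + Real.sqrt d) ^ M) * wtMass d M * cubeMean μ H := by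
  have hu := fun G : Rd d → ℝ≥0∞ => lintegral_iUnion (μ := volume)
    (fun n : Fin d → ℤ => measurableSet_dyadicCube (μ : ℤ) n) (pairwise_disjoint_dyadicCube μ) G
  simp only [iUnion_dyadicCube, setLIntegral_univ] at hu
  rw [hu]
  calc _ ≤ ∑' n : Fin d → ℤ, ENNReal.ofReal ((1 + Real.sqrt d) ^ M) *
        (∫⁻ y in dyadicCube (μ : ℤ) n, ENNReal.ofReal (wt μ M (x - y))) * cubeMean μ H :=
        ENNReal.tsum_le_tsum fun n => setLIntegral_wt_mul_le hM n x H
    _ = _ := by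
        rw [ENNReal.tsum_mul_right, ENNReal.tsum_mul_left, ← hu, lintegral_wt_sub_left]

/-- The mean over a cube is dominated by a weighted integral centred in the cube. -/
theorem mean_le_lintegral_wt (μ : ℕ) {M : ℝ} (hM : 0 ≤ M) {n : Fin d → ℤ} {c : Rd d}
    (hc : c ∈ dyadicCube (μ : ℤ) n) (H : Rd d → ℝ≥0∞) :
    (volume (dyadicCube (μ : ℤ) n))⁻¹ * ∫⁻ x in dyadicCube (μ : ℤ) n, H x ≤
      ENNReal.ofReal ((1 + Real.sqrt d) ^ M) * ∫⁻ x, ENNReal.ofReal (wt μ M (c - x)) * H x := by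
  rw [volume_dyadicCube, inv_inv, ← lintegral_const_mul' _ _ ENNReal.ofReal_ne_top,
    ← lintegral_const_mul' _ _ ENNReal.ofReal_ne_top]
  refine le_trans (setLIntegral_mono' (measurableSet_dyadicCube _ _) fun x hx => ?_)
    (setLIntegral_le_lintegral _ _)
  rw [← mul_assoc, ← ENNReal.ofReal_mul (by positivity)]
  gcongr
  have := wt_le_of_mem_dyadicCube hM hc hx c
  refine le_trans (le_of_eq ?_) this
  simp [wt]

theorem dyadicCube_nonempty (μ : ℕ) (n : Fin d → ℤ) : (dyadicCube (μ : ℤ) n).Nonempty := by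
  refine nonempty_of_measure_ne_zero (μ := volume) ?_
  rw [volume_dyadicCube]
  simp

/-! ### Power inequalities for weighted integrals and sums -/

/-- Hölder for the factorization W F = W^{1-1/q} (W F^q)^{1/q}. -/
theorem rpow_lintegral_mul_le {α : Type*} [MeasurableSpace α] {ν : Measure α} {q : ℝ}
    (hq : 1 ≤ q) {W F : α → ℝ≥0∞} (hW : AEMeasurable W ν) (hF : AEMeasurable F ν) :
    (∫⁻ a, W a * F a ∂ν) ^ q ≤ (∫⁻ a, W a ∂ν) ^ (q - 1) * ∫⁻ a, W a * F a ^ q ∂ν := by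
  have hq0 : 0 < q := by linarith
  have hinv : q⁻¹ ≤ 1 := inv_le_one_of_one_le₀ hq
  have h := ENNReal.lintegral_mul_norm_pow_le hW (hW.mul (hF.pow_const q))
    (p := 1 - q⁻¹) (q := q⁻¹) (by linarith) (by positivity) (by ring)
  have e : ∀ a, W a ^ (1 - q⁻¹) * (W a * F a ^ q) ^ q⁻¹ = W a * F a := by
    intro a
    rw [ENNReal.mul_rpow_of_nonneg _ _ (by positivity), ← ENNReal.rpow_mul,
      mul_inv_cancel₀ hq0.ne', ENNReal.rpow_one, ← mul_assoc]
    congr 1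
    rw [← ENNReal.rpow_add_of_nonneg _ _ (by linarith) (by positivity)]
    simp
  simp only [Pi.mul_apply, e] at h
  calc _ ≤ ((∫⁻ a, W a ∂ν) ^ (1 - q⁻¹) * (∫⁻ a, W a * F a ^ q ∂ν) ^ q⁻¹) ^ q := by
        gcongr
    _ = _ := by
        rw [ENNReal.mul_rpow_of_nonneg _ _ hq0.le, ← ENNReal.rpow_mul, ← ENNReal.rpow_mul,
          inv_mul_cancel₀ hq0.ne', ENNReal.rpow_one, sub_mul, inv_mul_cancel₀ hq0.ne', one_mul]

/-- If `G ≤ c ∫ G` pointwise and `G` is bounded, then `(∫ G)^q ≤ c^{1-q} ∫ G^q` for `q ≤ 1`. -/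
theorem rpow_lintegral_le_of_le_lintegral {α : Type*} [MeasurableSpace α] {ν : Measure α} {q : ℝ}
    (hq0 : 0 < q) (hq : q ≤ 1) {G : α → ℝ≥0∞} (c : ℝ≥0∞)
    (hbdd : ⨆ a, G a < ⊤) (hle : ∀ a, G a ≤ c * ∫⁻ a, G a ∂ν) :
    (∫⁻ a, G a ∂ν) ^ q ≤ c ^ (1 - q) * ∫⁻ a, G a ^ q ∂ν := by
  set S := ⨆ a, G a with hS
  set I := ∫⁻ a, G a ^ q ∂ν with hI
  have hq1 : 0 ≤ 1 - q := by linarith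
  have h1 : ∫⁻ a, G a ∂ν ≤ S ^ (1 - q) * I := by
    rw [hI, ← lintegral_const_mul' _ _ (ENNReal.rpow_ne_top_of_nonneg hq1 hbdd.ne)]
    refine lintegral_mono fun a => ?_
    calc G a = G a ^ (1 - q) * G a ^ q := by
          rw [← ENNReal.rpow_add_of_nonneg _ _ hq1 hq0.le]; simp
      _ ≤ _ := by
          gcongr
          exact le_iSup G a
  by_cases hS0 : S = 0
  · have : ∀ a, G a = 0 := fun a => by
      have := le_iSup G a
      rw [← hS, hS0] at this
      simpa using this
    simp [this, ENNReal.zero_rpow_of_pos hq0]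
  -- The hypothesis and `h1` give S ≤ c S^{1-q} I. Dividing by S^{1-q} is what requires G to be
  -- bounded.
  have h2 : S ^ q ≤ c * I := by
    have h3 : S ^ q * S ^ (1 - q) ≤ c * I * S ^ (1 - q) := by
      rw [← ENNReal.rpow_add_of_nonneg _ _ hq0.le hq1]
      simp only [add_sub_cancel, ENNReal.rpow_one]
      calc S ≤ c * ∫⁻ a, G a ∂ν := iSup_le hle
        _ ≤ c * (S ^ (1 - q) * I) := by gcongr
        _ = _ := by ring
    exact (ENNReal.mul_le_mul_iff_left (by
      simp [ENNReal.rpow_eq_zero_iff, hS0, hbdd.ne])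
      (ENNReal.rpow_ne_top_of_nonneg hq1 hbdd.ne)).1 h3
  calc _ ≤ (S ^ (1 - q) * I) ^ q := by gcongr
    _ = (S ^ q) ^ (1 - q) * I ^ q := by
        rw [ENNReal.mul_rpow_of_nonneg _ _ hq0.le, ← ENNReal.rpow_mul, ← ENNReal.rpow_mul,
          mul_comm q]
    _ ≤ (c * I) ^ (1 - q) * I ^ q := by gcongr
    _ = c ^ (1 - q) * I := by
        rw [ENNReal.mul_rpow_of_nonneg _ _ hq1, mul_assoc,
          ← ENNReal.rpow_add_of_nonneg _ _ hq1 hq0.le]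
        simp

theorem rpow_tsum_le_tsum_rpow {ι : Type*} {q : ℝ} (hq0 : 0 < q) (hq : q ≤ 1) (b : ι → ℝ≥0∞) :
    (∑' i, b i) ^ q ≤ ∑' i, b i ^ q := by
  have hfin : ∀ t : Finset ι, (∑ i ∈ t, b i) ^ q ≤ ∑ i ∈ t, b i ^ q := by
    classical
    intro t
    induction t using Finset.induction_on with
    | empty => simp [ENNReal.zero_rpow_of_pos hq0]
    | insert i t hi ih =>
      rw [Finset.sum_insert hi, Finset.sum_insert hi]
      exact (ENNReal.rpow_add_le_add_rpow _ _ hq0.le hq).trans (by gcongr)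
  have hle : ∑' i, b i ≤ (∑' i, b i ^ q) ^ q⁻¹ := by
    rw [ENNReal.tsum_eq_iSup_sum]
    refine iSup_le fun t => ?_
    rw [ENNReal.le_rpow_inv_iff hq0]
    exact (hfin t).trans (ENNReal.sum_le_tsum t)
  rwa [ENNReal.le_rpow_inv_iff hq0] at hle

theorem rpow_tsum_mul_le {ι : Type*} {q : ℝ} (hq : 1 ≤ q) (θ b : ι → ℝ≥0∞) :
    (∑' i, θ i * b i) ^ q ≤ (∑' i, θ i) ^ (q - 1) * ∑' i, θ i * b i ^ q := by
  let _ : MeasurableSpace ι := ⊤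
  have := rpow_lintegral_mul_le (ν := Measure.count) hq (W := θ) (F := b)
    measurable_from_top.aemeasurable measurable_from_top.aemeasurable
  simpa only [lintegral_count] using this

/-! ### Geometric sums -/

/-- `2^{-ε |l - k|}`. -/
def geo (ε : ℝ) (l k : ℕ) : ℝ≥0∞ := (2 : ℝ≥0∞) ^ (-(ε * |(l : ℝ) - k|))

theorem geo_comm (ε : ℝ) (l k : ℕ) : geo ε l k = geo ε k l := by
  rw [geo, geo, abs_sub_comm]

/-- `∑_{j ∈ ℤ} 2^{-ε |j|}`. -/
def geoSum (ε : ℝ) : ℝ≥0∞ := ∑' j : ℤ, (2 : ℝ≥0∞) ^ (-(ε * |(j : ℝ)|))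

theorem two_rpow_eq_ofReal (r : ℝ) : (2 : ℝ≥0∞) ^ r = ENNReal.ofReal (2 ^ r) := by
  rw [← ENNReal.ofReal_rpow_of_pos two_pos]
  simp

theorem geoSum_lt_top {ε : ℝ} (hε : 0 < ε) : geoSum ε < ⊤ := by
  have h : Summable fun n : ℕ => (2 : ℝ) ^ (-(ε * |((n : ℤ) : ℝ)|)) := by
    have e : ∀ n : ℕ, (2 : ℝ) ^ (-(ε * |((n : ℤ) : ℝ)|)) = ((2 : ℝ) ^ (-ε)) ^ n := by
      intro n
      rw [← Real.rpow_natCast, ← Real.rpow_mul two_pos.le]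
      simp
    simp_rw [e]
    exact summable_geometric_of_lt_one (by positivity)
      (Real.rpow_lt_one_of_one_lt_of_neg one_lt_two (by linarith))
  have h' : Summable fun j : ℤ => (2 : ℝ) ^ (-(ε * |(j : ℝ)|)) := by
    refine Summable.of_nat_of_neg h ?_
    simpa using h
  unfold geoSum
  simp_rw [two_rpow_eq_ofReal]
  exact h'.tsum_ofReal_lt_top

theorem tsum_geo_le (ε : ℝ) (l : ℕ) : ∑' k, geo ε l k ≤ geoSum ε := by
  have := ENNReal.tsum_comp_le_tsum_of_injective (f := fun k : ℕ => (l : ℤ) - k)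
    (fun a b h => by simpa using h) (fun j : ℤ => (2 : ℝ≥0∞) ^ (-(ε * |(j : ℝ)|)))
  simpa [geo, geoSum] using this

/-- Since μ lies between k and l the exponent splits. This decouples the sum over l ≥ μ from that
over k < μ, with bounds independent of μ. -/
theorem geo_le_mul_geo {ε : ℝ} {l k μ : ℕ} (hl : μ ≤ l) (hk : k ≤ μ) :
    geo ε l k = geo ε l μ * geo ε μ k := by
  have hl' : (μ : ℝ) ≤ l := by exact_mod_cast hl
  have hk' : (k : ℝ) ≤ μ := by exact_mod_cast hk
  rw [geo, geo, geo, ← ENNReal.rpow_add _ _ two_ne_zero ENNReal.ofNat_ne_top,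
    abs_of_nonneg (by linarith), abs_of_nonneg (by linarith), abs_of_nonneg (by linarith)]
  congr 1
  ring

theorem geo_rpow (ε p : ℝ) (l k : ℕ) : geo ε l k ^ p = geo (ε * p) l k := by
  rw [geo, geo, ← ENNReal.rpow_mul]
  congr 1
  ring

/-- A discrete convolution inequality with power `q`. -/
theorem rpow_tsum_geo_mul_le {ε q : ℝ} (hε : 0 < ε) (hq : 0 < q) :
    ∃ C : ℝ≥0∞, C < ⊤ ∧ ∀ (l : ℕ) (b : ℕ → ℝ≥0∞),
      (∑' k, geo ε l k * b k) ^ q ≤ C * ∑' k, geo (ε * min 1 q) l k * b k ^ q := by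
  rcases le_total 1 q with h | h
  · refine ⟨geoSum ε ^ (q - 1), ENNReal.rpow_lt_top_of_nonneg (by linarith)
      (geoSum_lt_top hε).ne, fun l b => ?_⟩
    rw [min_eq_left h, mul_one]
    refine (rpow_tsum_mul_le h _ b).trans ?_
    gcongr
    exact tsum_geo_le ε l
  · refine ⟨1, ENNReal.one_lt_top, fun l b => ?_⟩
    rw [min_eq_right h, one_mul]
    refine (rpow_tsum_le_tsum_rpow hq h _).trans (le_of_eq (tsum_congr fun k => ?_))
    rw [ENNReal.mul_rpow_of_nonneg _ _ hq.le, geo_rpow]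

/-! ### Band-limited functions -/

theorem wt_rpow (l : ℕ) (M q : ℝ) (y : Rd d) :
    wt l M y ^ q = 2 ^ ((l * d) * (q - 1)) * wt l (M * q) y := by
  have h1 := one_le_one_add_mul_norm l y
  unfold wt
  rw [Real.mul_rpow (by positivity) (by positivity), ← Real.rpow_mul (by positivity), ← mul_assoc,
    ← Real.rpow_natCast 2, ← Real.rpow_mul two_pos.le, ← Real.rpow_add two_pos]
  push_cast
  congr 2
  · ring
  · ring

/-- For a function with `F ≤ C₀ (wt k N ∗ F)`, a weighted mean at a coarser scale `l ≤ k` is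
controlled by a weighted `q`-mean, with a loss `2^{(k-l) τ_q}`. -/
theorem rpow_lintegral_wt_mul_le {q : ℝ} (hq : 0 < q) {M N : ℝ} (hM : d < M)
    (hN : M ≤ N) (C₀ : ℝ≥0∞) (hC₀ : C₀ < ⊤) :
    ∃ C : ℝ≥0∞, C < ⊤ ∧ ∀ (l k : ℕ), l ≤ k → ∀ (F : Rd d → ℝ≥0∞), Measurable F →
      ∀ x : Rd d, (q < 1 → ⨆ y, ENNReal.ofReal (wt l M (x - y)) * F y < ⊤) →
      (∀ y, F y ≤ C₀ * ∫⁻ z, ENNReal.ofReal (wt k N (y - z)) * F z) →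
      (∫⁻ y, ENNReal.ofReal (wt l M (x - y)) * F y) ^ q ≤
        C * 2 ^ (((k : ℝ) - l) * tau d q * q) *
          ∫⁻ y, ENNReal.ofReal (wt l (M * min 1 q) (x - y)) * F y ^ q := by
  have hM0 : 0 ≤ M := (Nat.cast_nonneg d).trans hM.le
  have hmeas : ∀ (l : ℕ) (M : ℝ) (x : Rd d), Measurable fun y : Rd d =>
      ENNReal.ofReal (wt l M (x - y)) := by
    intro l M x
    have := continuous_wt (d := d) l M
    fun_prop
  rcases le_or_gt 1 q with h | h
  · refine ⟨wtMass d M ^ (q - 1), ENNReal.rpow_lt_top_of_nonneg (by linarith)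
      (wtMass_lt_top hM).ne, fun l k _ F hF x _ _ => ?_⟩
    have ht : tau d q = 0 := by simp [tau, min_eq_left h]
    have := rpow_lintegral_mul_le (ν := volume) h (hmeas l M x).aemeasurable hF.aemeasurable
    rw [lintegral_wt_sub_left] at this
    simpa [ht, min_eq_left h] using this
  · refine ⟨C₀ ^ (1 - q), ENNReal.rpow_lt_top_of_nonneg (by linarith) hC₀.ne,
      fun l k hlk F hF x hbdd hrep => ?_⟩
    -- Insert the reproducing inequality and move the coarse weight from y to z. As N ≥ M, what is
    -- left of the fine weight is at most 2^{kd}; this gives the hypothesis of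
    -- `rpow_lintegral_le_of_le_lintegral` with c = C₀ 2^{kd}.
    have hle : ∀ y, ENNReal.ofReal (wt l M (x - y)) * F y ≤ (C₀ * ENNReal.ofReal (2 ^ (k * d))) *
        ∫⁻ z, ENNReal.ofReal (wt l M (x - z)) * F z := by
      intro y
      calc _ ≤ ENNReal.ofReal (wt l M (x - y)) *
            (C₀ * ∫⁻ z, ENNReal.ofReal (wt k N (y - z)) * F z) := by gcongr; exact hrep y
        _ = C₀ * ∫⁻ z, ENNReal.ofReal (wt l M (x - y)) *
            (ENNReal.ofReal (wt k N (y - z)) * F z) := by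
            rw [lintegral_const_mul' _ _ ENNReal.ofReal_ne_top]; ring
        _ ≤ C₀ * ∫⁻ z, ENNReal.ofReal (2 ^ (k * d)) *
            (ENNReal.ofReal (wt l M (x - z)) * F z) := by
            gcongr C₀ * ?_
            refine lintegral_mono fun z => ?_
            rw [← mul_assoc, ← mul_assoc, ← ENNReal.ofReal_mul (wt_pos _ _ _).le,
              ← ENNReal.ofReal_mul (by positivity)]
            gcongr ENNReal.ofReal ?_ * _
            refine (wt_mul_wt_le hlk hM0 x y z N).trans ?_
            rw [mul_comm]
            have := wt_pos l M (x - z)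
            gcongr
            unfold wt
            refine mul_le_of_le_one_right (by positivity) ?_
            exact Real.rpow_le_one_of_one_le_of_nonpos (one_le_one_add_mul_norm _ _)
              (by linarith)
        _ = _ := by
            rw [lintegral_const_mul' _ _ ENNReal.ofReal_ne_top]; ring
    refine (rpow_lintegral_le_of_le_lintegral hq h.le _ (hbdd h) hle).trans (le_of_eq ?_)
    have e : ∀ y, (ENNReal.ofReal (wt l M (x - y)) * F y) ^ q =
        2 ^ ((l * d) * (q - 1)) * (ENNReal.ofReal (wt l (M * min 1 q) (x - y)) * F y ^ q) := by
      intro y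
      rw [ENNReal.mul_rpow_of_nonneg _ _ hq.le, ENNReal.ofReal_rpow_of_pos (wt_pos _ _ _),
        wt_rpow, ENNReal.ofReal_mul (by positivity), min_eq_right h.le, two_rpow_eq_ofReal,
        mul_assoc]
    simp_rw [e]
    rw [lintegral_const_mul' _ _ (ENNReal.rpow_ne_top_of_ne_zero two_ne_zero ENNReal.ofNat_ne_top),
      ENNReal.mul_rpow_of_nonneg _ _ (by linarith), ← mul_assoc, mul_assoc (C₀ ^ (1 - q))]
    congr 2
    -- The factor 2^{kd(1-q)} from c^{1-q} and 2^{ld(q-1)} from `wt_rpow` combine to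
    -- 2^{(k-l)d(1-q)}, which is the loss 2^{(k-l)τ_q q}.
    have ht : tau d q * q = d * (1 - q) := by
      rw [tau, min_eq_right h.le]
      field_simp
    rw [mul_assoc _ (tau d q), ht, ← Real.rpow_natCast, ← two_rpow_eq_ofReal, ← ENNReal.rpow_mul,
      ← ENNReal.rpow_add _ _ two_ne_zero ENNReal.ofNat_ne_top]
    congr 1
    push_cast
    ring

/-! ### The localized inequality for families of band-limited functions -/

theorem measurable_ofReal_wt_sub (l : ℕ) (M : ℝ) :
    Measurable fun p : Rd d × Rd d => ENNReal.ofReal (wt l M (p.1 - p.2)) := by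
  have := continuous_wt (d := d) l M
  exact (this.comp (continuous_fst.sub continuous_snd)).measurable.ennreal_ofReal

theorem measurable_lintegral_wt_mul (l : ℕ) (M : ℝ) {F : Rd d → ℝ≥0∞} (hF : Measurable F) :
    Measurable fun x => ∫⁻ y, ENNReal.ofReal (wt l M (x - y)) * F y :=
  Measurable.lintegral_prod_right ((measurable_ofReal_wt_sub l M).mul (hF.comp measurable_snd))

theorem two_rpow_add (x y : ℝ) : (2 : ℝ≥0∞) ^ (x + y) = 2 ^ x * 2 ^ y :=
  ENNReal.rpow_add _ _ two_ne_zero ENNReal.ofNat_ne_top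

theorem two_rpow_ne_top (x : ℝ) : (2 : ℝ≥0∞) ^ x ≠ ⊤ :=
  ENNReal.rpow_ne_top_of_ne_zero two_ne_zero ENNReal.ofNat_ne_top

theorem two_rpow_mono {x y : ℝ} (h : x ≤ y) : (2 : ℝ≥0∞) ^ x ≤ 2 ^ y :=
  ENNReal.rpow_le_rpow_of_exponent_le one_le_two h

/-- `2^{km - L (l-k)_+} ∫ wt_{min(l,k)}(x - y) F(y) dy`. -/
def offDiag (m L M : ℝ) (l k : ℕ) (F : Rd d → ℝ≥0∞) (x : Rd d) : ℝ≥0∞ :=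
  2 ^ ((k : ℝ) * m - L * max ((l : ℝ) - k) 0) *
    ∫⁻ y, ENNReal.ofReal (wt (min l k) M (x - y)) * F y

/-- The estimate for k below the localization scale, where only a sup bound is known. After
2^{k(s+m)} is given to F, the remaining exponent is (s - L)(l - k) ≤ -ε(l - k). -/
theorem offDiag_le_of_lt {m L M s ε : ℝ} (hL : s + ε ≤ L) {l k : ℕ} (hkl : k ≤ l)
    {F : Rd d → ℝ≥0∞} {A₀ : ℝ≥0∞} (hA : ∀ᵐ x, 2 ^ ((k : ℝ) * (s + m)) * F x ≤ A₀) (x : Rd d) :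
    2 ^ (s * l) * offDiag m L M l k F x ≤ geo ε l k * (wtMass d M * A₀) := by
  have hkl' : (k : ℝ) ≤ l := by exact_mod_cast hkl
  have h1 : 2 ^ ((k : ℝ) * (s + m)) * ∫⁻ y, ENNReal.ofReal (wt k M (x - y)) * F y
      ≤ wtMass d M * A₀ := by
    have hmw : Measurable fun y : Rd d => ENNReal.ofReal (wt k M (x - y)) := by
      have := continuous_wt (d := d) k M
      fun_prop
    rw [← lintegral_const_mul' _ _ (two_rpow_ne_top _), ← lintegral_wt_sub_left k M x,
      ← lintegral_mul_const _ hmw]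
    refine lintegral_mono_ae ?_
    filter_upwards [hA] with y hy
    rw [mul_left_comm]
    gcongr
  rw [offDiag, min_eq_right hkl, max_eq_left (by linarith)]
  calc _ = 2 ^ (s * l + ((k : ℝ) * m - L * ((l : ℝ) - k)) - (k : ℝ) * (s + m)) *
        (2 ^ ((k : ℝ) * (s + m)) * ∫⁻ y, ENNReal.ofReal (wt k M (x - y)) * F y) := by
        rw [← mul_assoc, ← mul_assoc, ← two_rpow_add, ← two_rpow_add]
        congr 2
        ring
    _ ≤ _ := by
        rw [geo, abs_of_nonneg (by linarith)]
        refine mul_le_mul' (two_rpow_mono ?_) h1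
        nlinarith

/-- For l ≤ k the change from 2^{sl} to 2^{sk} gains 2^{-s(k-l)} against the loss 2^{(k-l)τ_q}. For
k ≤ l there is no loss, and L supplies the decay. Both cases leave the rate s - τ_q. -/
theorem offDiag_le {q s m L M N : ℝ} (hq : 0 < q) (hL : s + (s - tau d q) ≤ L) (hM : d < M)
    (hN : M ≤ N) (C₀ : ℝ≥0∞) (hC₀ : C₀ < ⊤) :
    ∃ C : ℝ≥0∞, C < ⊤ ∧ ∀ (l k : ℕ) (F : Rd d → ℝ≥0∞), Measurable F →
      (q < 1 → ∃ B : ℝ≥0∞, B < ⊤ ∧ ∀ y, F y ≤ B) →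
      (∀ y, F y ≤ C₀ * ∫⁻ z, ENNReal.ofReal (wt k N (y - z)) * F z) → ∀ x,
      2 ^ (s * l) * offDiag m L M l k F x ≤ geo (s - tau d q) l k *
        (C * ∫⁻ y, ENNReal.ofReal (wt (min l k) (M * min 1 q) (x - y)) *
          (2 ^ ((s + m) * k * q) * F y ^ q)) ^ q⁻¹ := by
  obtain ⟨C, hC, H⟩ := rpow_lintegral_wt_mul_le (d := d) hq hM hN C₀ hC₀
  refine ⟨C, hC, fun l k F hF hbdd hrep x => ?_⟩
  have hM0 : 0 ≤ M := (Nat.cast_nonneg d).trans hM.le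
  have h := H (min l k) k (min_le_right _ _) F hF x ?_ hrep
  swap
  · intro h1
    obtain ⟨B, hB, hFB⟩ := hbdd h1
    refine lt_of_le_of_lt (b := ENNReal.ofReal (2 ^ (min l k * d)) * B) (iSup_le fun y => ?_)
      (ENNReal.mul_lt_top ENNReal.ofReal_lt_top hB)
    gcongr
    · unfold wt
      refine mul_le_of_le_one_right (by positivity) ?_
      exact Real.rpow_le_one_of_one_le_of_nonpos (one_le_one_add_mul_norm _ _) (by linarith)
    · exact hFB y
  rw [← ENNReal.le_rpow_inv_iff hq] at h
  set Z := ∫⁻ y, ENNReal.ofReal (wt (min l k) (M * min 1 q) (x - y)) * F y ^ q with hZ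
  have e1 : ∫⁻ y, ENNReal.ofReal (wt (min l k) (M * min 1 q) (x - y)) *
      (2 ^ ((s + m) * k * q) * F y ^ q) = 2 ^ ((s + m) * k * q) * Z := by
    rw [hZ, ← lintegral_const_mul' _ _ (two_rpow_ne_top _)]
    exact lintegral_congr fun y => by ring
  have e2 : ∀ r : ℝ, ((2 : ℝ≥0∞) ^ (r * q)) ^ q⁻¹ = 2 ^ r := by
    intro r
    rw [← ENNReal.rpow_mul, mul_assoc, mul_inv_cancel₀ hq.ne', mul_one]
  have hq' : 0 ≤ q⁻¹ := by positivity
  rw [e1, mul_left_comm, ENNReal.mul_rpow_of_nonneg _ _ hq', e2, ← mul_assoc, geo,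
    ← two_rpow_add, offDiag, ← mul_assoc, ← two_rpow_add]
  rw [mul_comm C, mul_assoc, ENNReal.mul_rpow_of_nonneg _ _ hq', e2] at h
  calc _ ≤ 2 ^ (s * l + ((k : ℝ) * m - L * max ((l : ℝ) - k) 0)) *
        (2 ^ (((k : ℝ) - (min l k : ℕ)) * tau d q) * (C * Z) ^ q⁻¹) := by gcongr
    _ ≤ _ := by
        rw [← mul_assoc, ← two_rpow_add]
        gcongr ?_ * _
        refine two_rpow_mono ?_
        rcases le_total l k with hlk | hlk
        · have : (l : ℝ) ≤ k := by exact_mod_cast hlk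
          rw [min_eq_left hlk, max_eq_right (by linarith), abs_of_nonpos (by linarith)]
          nlinarith
        · have : (k : ℝ) ≤ l := by exact_mod_cast hlk
          rw [min_eq_right hlk, max_eq_left (by linarith), abs_of_nonneg (by linarith)]
          nlinarith

theorem tsum_tsum_geo_le {ε : ℝ} (μ : ℕ) :
    ∑' l : Set.Ici μ, ∑' k, geo ε l k * (Set.Iio μ).indicator 1 k ≤ geoSum ε * geoSum ε := by
  calc _ ≤ ∑' l : Set.Ici μ, ∑' k, geo ε μ l * geo ε μ k := by
        refine ENNReal.tsum_le_tsum fun l => ENNReal.tsum_le_tsum fun k => ?_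
        by_cases hk : k ∈ Set.Iio μ
        · rw [Set.indicator_of_mem hk, Pi.one_apply, mul_one,
            geo_le_mul_geo l.2 (le_of_lt hk), geo_comm]
        · simp [Set.indicator_of_notMem hk]
    _ = (∑' l : Set.Ici μ, geo ε μ l) * ∑' k, geo ε μ k := by
        simp_rw [ENNReal.tsum_mul_left]
        rw [ENNReal.tsum_mul_right]
    _ ≤ _ := by
        gcongr
        · exact (ENNReal.tsum_comp_le_tsum_of_injective Subtype.val_injective
            (fun l => geo ε μ l)).trans (tsum_geo_le ε μ)
        · exact tsum_geo_le ε μ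

/-- Double sums of weighted integrals with off-diagonal decay, averaged over a cube. -/
theorem mean_tsum_le {ε M : ℝ} (μ : ℕ) (n : Fin d → ℤ)
    {h : ℕ → Rd d → ℝ≥0∞} (hh : ∀ k, Measurable (h k)) :
    (volume (dyadicCube (μ : ℤ) n))⁻¹ * ∫⁻ x in dyadicCube (μ : ℤ) n,
      ∑' l : Set.Ici μ, ∑' k : Set.Ici μ, geo ε l k *
        ∫⁻ y, ENNReal.ofReal (wt (min (l : ℕ) k) M (x - y)) * h k y ≤
      (ENNReal.ofReal ((1 + Real.sqrt d) ^ ((d : ℝ) + 1)) * wtMass d (M - (d + 1)) * geoSum ε *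
        (ENNReal.ofReal ((1 + Real.sqrt d) ^ ((d : ℝ) + 1)) * wtMass d (d + 1))) *
        cubeMean μ fun y => ∑' k : Set.Ici μ, h k y := by
  obtain ⟨c, hc⟩ := dyadicCube_nonempty μ n
  have hd1 : (0 : ℝ) ≤ (d : ℝ) + 1 := by positivity
  refine (mean_le_lintegral_wt μ hd1 hc _).trans ?_
  have hmw : ∀ l (M : ℝ) (x : Rd d), Measurable fun y : Rd d => ENNReal.ofReal (wt l M (x - y)) :=
    fun l M x => by
      have := continuous_wt (d := d) l M
      fun_prop
  have hwh : ∀ l (M : ℝ) (x : Rd d) k, Measurable fun y =>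
      ENNReal.ofReal (wt l M (x - y)) * h k y :=
    fun l M x k => (hmw l M x).mul (hh k)
  -- Both indices are at least μ, so the inner weight is no coarser than the outer one, and their
  -- convolution is again a weight at scale μ. The exponent d + 1 is just above integrability.
  have hconv : ∀ l k : Set.Ici μ, ∫⁻ x, ENNReal.ofReal (wt μ (d + 1) (c - x)) *
      ∫⁻ y, ENNReal.ofReal (wt (min (l : ℕ) k) M (x - y)) * h k y ≤
      wtMass d (M - (d + 1)) * ∫⁻ y, ENNReal.ofReal (wt μ (d + 1) (c - y)) * h k y := by
    intro l k
    simp_rw [← lintegral_const_mul' _ _ ENNReal.ofReal_ne_top]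
    rw [lintegral_lintegral_swap]
    · rw [← lintegral_const_mul _ (hwh μ (d + 1) c k)]
      refine lintegral_mono fun y => ?_
      simp_rw [← mul_assoc]
      have hm3 : Measurable fun x => ENNReal.ofReal (wt μ (d + 1) (c - x)) *
          ENNReal.ofReal (wt (min (l : ℕ) k) M (x - y)) := by
        have := continuous_wt (d := d) (min (l : ℕ) k) M
        have := continuous_wt (d := d) μ (d + 1)
        fun_prop
      rw [lintegral_mul_const _ hm3]
      gcongr
      exact lintegral_wt_mul_wt_le (le_min l.2 k.2) hd1 c y
    · exact (((hmw _ _ _).comp measurable_fst).mul ((measurable_ofReal_wt_sub _ _).mul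
        ((hh k).comp measurable_snd))).aemeasurable
  have hswap : ∫⁻ x, ENNReal.ofReal (wt μ (d + 1) (c - x)) *
      ∑' l : Set.Ici μ, ∑' k : Set.Ici μ, geo ε l k *
        ∫⁻ y, ENNReal.ofReal (wt (min (l : ℕ) k) M (x - y)) * h k y =
      ∑' l : Set.Ici μ, ∑' k : Set.Ici μ, geo ε l k *
        ∫⁻ x, ENNReal.ofReal (wt μ (d + 1) (c - x)) *
          ∫⁻ y, ENNReal.ofReal (wt (min (l : ℕ) k) M (x - y)) * h k y := by
    have hm : ∀ l k : Set.Ici μ, Measurable fun x =>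
        ∫⁻ y, ENNReal.ofReal (wt (min (l : ℕ) k) M (x - y)) * h k y :=
      fun l k => measurable_lintegral_wt_mul _ _ (hh k)
    have hm1 : ∀ l k : Set.Ici μ, Measurable fun x => ENNReal.ofReal (wt μ (d + 1) (c - x)) *
        ∫⁻ y, ENNReal.ofReal (wt (min (l : ℕ) k) M (x - y)) * h k y :=
      fun l k => (hmw _ _ _).mul (hm l k)
    simp_rw [← ENNReal.tsum_mul_left, mul_left_comm _ (geo _ _ _)]
    rw [lintegral_tsum fun l => (Measurable.tsum fun k => (hm1 l k).const_mul _).aemeasurable]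
    refine tsum_congr fun l => ?_
    rw [lintegral_tsum fun k => ((hm1 l k).const_mul _).aemeasurable]
    exact tsum_congr fun k => lintegral_const_mul _ (hm1 l k)
  rw [hswap]
  calc _ ≤ ENNReal.ofReal ((1 + Real.sqrt d) ^ ((d : ℝ) + 1)) *
        ∑' l : Set.Ici μ, ∑' k : Set.Ici μ, geo ε l k * (wtMass d (M - (d + 1)) *
          ∫⁻ y, ENNReal.ofReal (wt μ (d + 1) (c - y)) * h k y) := by
        gcongr with l k
        exact hconv l k
    _ = ENNReal.ofReal ((1 + Real.sqrt d) ^ ((d : ℝ) + 1)) *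
        ∑' k : Set.Ici μ, (∑' l : Set.Ici μ, geo ε k l) * (wtMass d (M - (d + 1)) *
          ∫⁻ y, ENNReal.ofReal (wt μ (d + 1) (c - y)) * h k y) := by
        rw [ENNReal.tsum_comm]
        simp_rw [ENNReal.tsum_mul_right]
        simp_rw [geo_comm]
    _ ≤ ENNReal.ofReal ((1 + Real.sqrt d) ^ ((d : ℝ) + 1)) *
        ∑' k : Set.Ici μ, geoSum ε * (wtMass d (M - (d + 1)) *
          ∫⁻ y, ENNReal.ofReal (wt μ (d + 1) (c - y)) * h k y) := by
        gcongr with k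
        exact (ENNReal.tsum_comp_le_tsum_of_injective Subtype.val_injective
            (fun l => geo ε k l)).trans (tsum_geo_le ε k)
    _ = ENNReal.ofReal ((1 + Real.sqrt d) ^ ((d : ℝ) + 1)) * wtMass d (M - (d + 1)) * geoSum ε *
        ∫⁻ y, ENNReal.ofReal (wt μ (d + 1) (c - y)) * ∑' k : Set.Ici μ, h k y := by
        simp_rw [ENNReal.tsum_mul_left, ← ENNReal.tsum_mul_left (a := ENNReal.ofReal (wt _ _ _))]
        rw [lintegral_tsum fun k : Set.Ici μ => (hwh μ (d + 1) c k).aemeasurable]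
        ring
    _ ≤ _ := by
        rw [mul_assoc (_ * geoSum ε)]
        gcongr
        exact lintegral_wt_mul_le_cubeMean μ hd1 c _

/-- The localized `ℓ^q(L^q)` inequality for operators with off-diagonal decay. -/
theorem cubeMean_tsum_le {q s m L M N : ℝ} (hq : 0 < q) (hs : tau d q < s)
    (hL : s + (s - tau d q) ≤ L) (hM : 2 * d + 2 ≤ M * min 1 q) (hN : M ≤ N)
    (C₀ : ℝ≥0∞) (hC₀ : C₀ < ⊤) :
    ∃ C : ℝ≥0∞, C < ⊤ ∧ ∀ (μ : ℕ) (F : ℕ → Rd d → ℝ≥0∞) (A₀ : ℝ≥0∞) (V : ℕ → Rd d → ℝ≥0∞),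
      (∀ k, Measurable (F k)) →
      (∀ k < μ, ∀ᵐ x, 2 ^ ((k : ℝ) * (s + m)) * F k x ≤ A₀) →
      (∀ k, μ ≤ k → q < 1 → ∃ B : ℝ≥0∞, B < ⊤ ∧ ∀ y, F k y ≤ B) →
      (∀ k y, F k y ≤ C₀ * ∫⁻ z, ENNReal.ofReal (wt k N (y - z)) * F k z) →
      (∀ l, μ ≤ l → ∀ x, V l x ≤ C₀ * ∑' k, offDiag m L M l k (F k) x) →
      cubeMean μ (fun x => ∑' l : Set.Ici μ, 2 ^ (s * (l : ℕ) * q) * V l x ^ q) ≤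
        C * (A₀ ^ q + cubeMean μ fun x => ∑' k : Set.Ici μ,
          2 ^ ((s + m) * (k : ℕ) * q) * F k x ^ q) := by
  set r := min 1 q with hr
  have hr0 : 0 < r := lt_min one_pos hq
  have hr1 : r ≤ 1 := min_le_left _ _
  have hM' : (d : ℝ) < M := by
    have h0 : 0 < M * r := lt_of_lt_of_le (by positivity) hM
    have h1 : 0 < M := pos_of_mul_pos_left h0 hr0.le
    nlinarith
  set ε := s - tau d q with hε
  have hε0 : 0 < ε := by linarith
  obtain ⟨C₁, hC₁, H₁⟩ := offDiag_le (m := m) hq hL hM' hN C₀ hC₀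
  obtain ⟨C₂, hC₂, H₂⟩ := rpow_tsum_geo_mul_le hε0 hq
  set D : ℝ≥0∞ := ENNReal.ofReal ((1 + Real.sqrt d) ^ ((d : ℝ) + 1)) *
    wtMass d (M * r - (d + 1)) * geoSum (ε * r) *
        (ENNReal.ofReal ((1 + Real.sqrt d) ^ ((d : ℝ) + 1)) * wtMass d (d + 1)) with hD
  set G : ℝ≥0∞ := wtMass d M ^ q * (geoSum (ε * r) * geoSum (ε * r)) with hG
  have hgs : geoSum (ε * r) < ⊤ := geoSum_lt_top (by positivity)
  -- The requirement M r ≥ 2d + 2 is what makes both masses finite: d + 1 powers go to the weight at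
  -- the scale of the cubes, and at least d + 1 remain.
  have hDt : D < ⊤ := by
    refine ENNReal.mul_lt_top (ENNReal.mul_lt_top (ENNReal.mul_lt_top ENNReal.ofReal_lt_top
      (wtMass_lt_top (by linarith))) hgs)
      (ENNReal.mul_lt_top ENNReal.ofReal_lt_top (wtMass_lt_top (by linarith)))
  have hGt : G < ⊤ := ENNReal.mul_lt_top (ENNReal.rpow_lt_top_of_nonneg hq.le
    (wtMass_lt_top hM').ne) (ENNReal.mul_lt_top hgs hgs)
  refine ⟨C₀ ^ q * C₂ * (G + C₁ * D), ?_, fun μ F A₀ V hF hlow hbdd hrep hV => ?_⟩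
  · exact ENNReal.mul_lt_top (ENNReal.mul_lt_top (ENNReal.rpow_lt_top_of_nonneg hq.le hC₀.ne) hC₂)
      (ENNReal.add_lt_top.2 ⟨hGt, ENNReal.mul_lt_top hC₁ hDt⟩)
  set h : ℕ → Rd d → ℝ≥0∞ := fun k y => 2 ^ ((s + m) * k * q) * F k y ^ q with hh
  have hhm : ∀ k, Measurable (h k) := fun k => ((hF k).pow_const q).const_mul _
  set Z : ℕ → ℕ → Rd d → ℝ≥0∞ := fun l k x =>
    ∫⁻ y, ENNReal.ofReal (wt (min l k) (M * r) (x - y)) * h k y with hZ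
  have hpt : ∀ l, μ ≤ l → ∀ x, 2 ^ (s * l * q) * V l x ^ q ≤ C₀ ^ q * C₂ *
      ((wtMass d M * A₀) ^ q * ∑' k, geo (ε * r) l k * (Set.Iio μ).indicator 1 k +
        C₁ * ∑' k : Set.Ici μ, geo (ε * r) l k * Z l k x) := by
    intro l hl x
    -- What is left of each term once the geometric factor is removed. For k ≥ μ it is a q-th root,
    -- so that b_k^q is linear in h_k and can be averaged over cubes.
    set b : ℕ → ℝ≥0∞ := fun k => if k < μ then wtMass d M * A₀ else (C₁ * Z l k x) ^ q⁻¹ with hb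
    have h1 : 2 ^ (s * l) * V l x ≤ C₀ * ∑' k, geo ε l k * b k := by
      calc _ ≤ 2 ^ (s * l) * (C₀ * ∑' k, offDiag m L M l k (F k) x) := by
            gcongr
            exact hV l hl x
        _ = C₀ * ∑' k, 2 ^ (s * l) * offDiag m L M l k (F k) x := by
            rw [ENNReal.tsum_mul_left]; ring
        _ ≤ _ := by
            gcongr C₀ * ?_
            refine ENNReal.tsum_le_tsum fun k => ?_
            by_cases hk : k < μ
            · simp only [hb, if_pos hk]
              exact offDiag_le_of_lt hL (hk.le.trans hl) (hlow k hk) x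
            · simp only [hb, if_neg hk]
              exact H₁ l k (F k) (hF k) (hbdd k (not_lt.1 hk)) (hrep k) x
    calc 2 ^ (s * l * q) * V l x ^ q = (2 ^ (s * l) * V l x) ^ q := by
          rw [ENNReal.mul_rpow_of_nonneg _ _ hq.le, ← ENNReal.rpow_mul]
      _ ≤ (C₀ * ∑' k, geo ε l k * b k) ^ q := by gcongr
      _ ≤ C₀ ^ q * (C₂ * ∑' k, geo (ε * r) l k * b k ^ q) := by
          rw [ENNReal.mul_rpow_of_nonneg _ _ hq.le]
          gcongr
          exact H₂ l b
      _ = _ := by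
          rw [← mul_assoc]
          congr 1
          rw [tsum_subtype (Set.Ici μ) (fun k => geo (ε * r) l k * Z l k x),
            ← ENNReal.tsum_mul_left, ← ENNReal.tsum_mul_left, ← ENNReal.tsum_add]
          refine tsum_congr fun k => ?_
          by_cases hk : k < μ
          · have h1 : k ∈ Set.Iio μ := hk
            have h2 : k ∉ Set.Ici μ := by simpa using hk
            simp only [hb, if_pos hk, Set.indicator_of_mem h1, Set.indicator_of_notMem h2,
              Pi.one_apply]
            ring
          · have h1 : k ∉ Set.Iio μ := hk
            have h2 : k ∈ Set.Ici μ := by simpa using hk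
            simp only [hb, if_neg hk, Set.indicator_of_mem h2, Set.indicator_of_notMem h1,
              ← ENNReal.rpow_mul, inv_mul_cancel₀ hq.ne', ENNReal.rpow_one]
            ring
  refine iSup_le fun n => ?_
  set R := dyadicCube (μ : ℤ) n with hR
  have hv0 : volume R ≠ 0 := by rw [hR, volume_dyadicCube]; simp
  have hvt : volume R ≠ ⊤ := by rw [hR, volume_dyadicCube]; simp
  have hZm : ∀ l k, Measurable (Z l k) := fun l k => measurable_lintegral_wt_mul _ _ (hhm k)
  have hsum : ∀ x, ∑' l : Set.Ici μ, 2 ^ (s * (l : ℕ) * q) * V l x ^ q ≤ C₀ ^ q * C₂ *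
      (G * A₀ ^ q + C₁ * ∑' l : Set.Ici μ, ∑' k : Set.Ici μ, geo (ε * r) l k * Z l k x) := by
    intro x
    calc _ ≤ ∑' l : Set.Ici μ, C₀ ^ q * C₂ *
          ((wtMass d M * A₀) ^ q * ∑' k, geo (ε * r) l k * (Set.Iio μ).indicator 1 k +
            C₁ * ∑' k : Set.Ici μ, geo (ε * r) l k * Z l k x) :=
          ENNReal.tsum_le_tsum fun l => hpt l l.2 x
      _ ≤ _ := by
          rw [ENNReal.tsum_mul_left, ENNReal.tsum_add, ENNReal.tsum_mul_left,
            ENNReal.tsum_mul_left, hG, ENNReal.mul_rpow_of_nonneg _ _ hq.le]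
          gcongr C₀ ^ q * C₂ * (?_ + _)
          calc _ ≤ wtMass d M ^ q * A₀ ^ q * (geoSum (ε * r) * geoSum (ε * r)) := by
                gcongr
                exact tsum_tsum_geo_le μ
            _ = _ := by ring
  calc _ ≤ (volume R)⁻¹ * ∫⁻ x in R, C₀ ^ q * C₂ *
        (G * A₀ ^ q + C₁ * ∑' l : Set.Ici μ, ∑' k : Set.Ici μ, geo (ε * r) l k * Z l k x) := by
        gcongr with x
        exact hsum x
    _ = C₀ ^ q * C₂ * (G * A₀ ^ q + C₁ * ((volume R)⁻¹ * ∫⁻ x in R,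
          ∑' l : Set.Ici μ, ∑' k : Set.Ici μ, geo (ε * r) l k * Z l k x)) := by
        have hm2 : Measurable fun x => ∑' l : Set.Ici μ, ∑' k : Set.Ici μ,
            geo (ε * r) l k * Z l k x :=
          Measurable.tsum fun l => Measurable.tsum fun k => (hZm l k).const_mul _
        rw [lintegral_const_mul _ ((hm2.const_mul _).const_add _),
          lintegral_add_left measurable_const, lintegral_const_mul _ hm2, setLIntegral_const]
        calc _ = C₀ ^ q * C₂ * (G * A₀ ^ q * ((volume R)⁻¹ * volume R) + C₁ * ((volume R)⁻¹ *
              ∫⁻ x in R, ∑' l : Set.Ici μ, ∑' k : Set.Ici μ, geo (ε * r) l k * Z l k x)) := by ring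
          _ = _ := by rw [ENNReal.inv_mul_cancel hv0 hvt, mul_one]
    _ ≤ C₀ ^ q * C₂ * (G * A₀ ^ q + C₁ * (D * cubeMean μ fun y => ∑' k : Set.Ici μ, h k y)) := by
        gcongr C₀ ^ q * C₂ * (_ + C₁ * ?_)
        exact mean_tsum_le μ n hhm
    _ ≤ C₀ ^ q * C₂ * ((G + C₁ * D) * A₀ ^ q +
          (G + C₁ * D) * cubeMean μ fun y => ∑' k : Set.Ici μ, h k y) := by
        rw [← mul_assoc C₁]
        gcongr
        · exact le_self_add
        · exact le_add_self
    _ = _ := by ring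

theorem natCast_le_infty (n : ℕ) : (n : WithTop ℕ∞) ≤ ((⊤ : ℕ∞) : WithTop ℕ∞) := by
  exact_mod_cast le_top

/-! ### Characters -/

/-- The character `e^{2πi⟨x, ξ⟩}`. -/
def chr (x ξ : Rd d) : ℂ := Complex.exp (2 * Real.pi * Complex.I * (inner ℝ x ξ : ℝ))

theorem norm_chr (x ξ : Rd d) : ‖chr x ξ‖ = 1 := by
  have : (2 * Real.pi * Complex.I * (inner ℝ x ξ : ℝ) : ℂ) =
      ((2 * Real.pi * inner ℝ x ξ : ℝ) : ℂ) * Complex.I := by push_cast; ring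
  rw [chr, this, Complex.norm_exp_ofReal_mul_I]

theorem chr_add (x y ξ : Rd d) : chr (x + y) ξ = chr x ξ * chr y ξ := by
  rw [chr, chr, chr, ← Complex.exp_add, inner_add_left]
  push_cast
  ring_nf

theorem contDiff_chr : ContDiff ℝ ∞ fun p : Rd d × Rd d => chr p.1 p.2 :=
  ContDiff.cexp (contDiff_const.mul
      (Complex.ofRealCLM.contDiff.comp (contDiff_fst.inner ℝ contDiff_snd)))

theorem continuous_chr : Continuous fun p : Rd d × Rd d => chr p.1 p.2 := contDiff_chr.continuous

theorem fourierChar_smul_eq (x ξ : Rd d) (z : ℂ) :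
    Real.fourierChar (-(inner ℝ ξ x)) • z = chr (-x) ξ * z := by
  rw [Circle.smul_def, Real.fourierChar_apply, smul_eq_mul, chr, inner_neg_left,
    real_inner_comm x ξ]
  congr 2
  push_cast
  ring

theorem fourier_eq_chr (B : Rd d → ℂ) (w : Rd d) : 𝓕 B w = ∫ ξ, chr (-w) ξ * B ξ := by
  rw [Real.fourier_eq]
  simp_rw [fourierChar_smul_eq]

/-! ### Frequency cutoffs -/

/-- A bump function equal to `1` on the ball of radius `2` and supported in the ball of
radius `4`. -/
def bump (d : ℕ) : ContDiffBump (0 : Rd d) := ⟨2, 4, two_pos, by norm_num⟩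

/-- The profile of the frequency cutoffs. -/
def profile (k : ℕ) (ξ : Rd d) : ℂ :=
  if k = 0 then (bump d ξ : ℝ) else ((bump d ξ - bump d ((8 : ℝ) • ξ) : ℝ) : ℂ)

/-- A smooth cutoff to `|ξ| ~ 2^k`, to `|ξ| ≲ 1` if `k = 0`. -/
def cutoff (k : ℕ) (ξ : Rd d) : ℂ := profile k (((2 : ℝ) ^ k)⁻¹ • ξ)

theorem contDiff_profile (k : ℕ) : ContDiff ℝ ∞ (profile k : Rd d → ℂ) := by
  unfold profile
  by_cases hk : k = 0
  · simp only [hk, if_true]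
    exact Complex.ofRealCLM.contDiff.comp (bump d).contDiff
  · simp only [hk, if_false]
    exact Complex.ofRealCLM.contDiff.comp ((bump d).contDiff.sub
      ((bump d).contDiff.comp (contDiff_const_smul _)))

theorem contDiff_cutoff (k : ℕ) : ContDiff ℝ ∞ (cutoff k : Rd d → ℂ) :=
  (contDiff_profile k).comp (contDiff_const_smul _)

theorem bump_eq_one {ξ : Rd d} (h : ‖ξ‖ ≤ 2) : bump d ξ = 1 :=
  (bump d).one_of_mem_closedBall (by simpa [bump] using h)

theorem bump_eq_zero {ξ : Rd d} (h : 4 ≤ ‖ξ‖) : bump d ξ = 0 :=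
  (bump d).zero_of_le_dist (by simpa [bump] using h)

theorem norm_le_of_mem_tsupport_profile {k : ℕ} {ξ : Rd d} (h : ξ ∈ tsupport (profile k)) :
    ‖ξ‖ ≤ 4 ∧ (k ≠ 0 → 1 / 4 ≤ ‖ξ‖) := by
  have hcl : IsClosed {ξ : Rd d | ‖ξ‖ ≤ 4 ∧ (k ≠ 0 → 1 / 4 ≤ ‖ξ‖)} := by
    refine (isClosed_le continuous_norm continuous_const).inter ?_
    by_cases hk : k = 0
    · simp only [hk, ne_eq, not_true_eq_false, IsEmpty.forall_iff]
      exact isClosed_univ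
    · simp only [ne_eq, hk, not_false_eq_true, forall_const]
      exact isClosed_le continuous_const continuous_norm
  refine closure_minimal (fun ξ hξ => ?_) hcl h
  simp only [Set.mem_ofPred_eq]
  have h8 : ‖(8 : ℝ) • ξ‖ = 8 * ‖ξ‖ := by simp [norm_smul]
  constructor
  · by_contra hcon
    push Not at hcon
    refine hξ ?_
    simp [profile, bump_eq_zero hcon.le, bump_eq_zero (ξ := (8 : ℝ) • ξ) (by linarith)]
  · intro hk
    by_contra hcon
    push Not at hcon
    refine hξ ?_
    simp [profile, hk, bump_eq_one (ξ := ξ) (by linarith),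
      bump_eq_one (ξ := (8 : ℝ) • ξ) (by linarith)]

theorem hasCompactSupport_profile (k : ℕ) : HasCompactSupport (profile k : Rd d → ℂ) := by
  refine HasCompactSupport.of_support_subset_isCompact (isCompact_closedBall (0 : Rd d) 4)
    fun ξ hξ => ?_
  simpa using (norm_le_of_mem_tsupport_profile (subset_tsupport _ hξ)).1

/-- Only two profiles occur, those of k = 0 and k = 1; hence bounds uniform in k. -/
theorem exists_norm_iteratedFDeriv_profile_le (i : ℕ) : ∃ c : ℝ, 0 ≤ c ∧
    ∀ (k : ℕ) (ξ : Rd d), ‖iteratedFDeriv ℝ i (profile k) ξ‖ ≤ c := by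
  have h : ∀ k : ℕ, ∃ c : ℝ, ∀ ξ : Rd d, ‖iteratedFDeriv ℝ i (profile k) ξ‖ ≤ c := fun k =>
    ((hasCompactSupport_profile k).iteratedFDeriv i).exists_bound_of_continuous
      ((contDiff_profile k).continuous_iteratedFDeriv (natCast_le_infty _))
  obtain ⟨c₀, h₀⟩ := h 0
  obtain ⟨c₁, h₁⟩ := h 1
  refine ⟨max c₀ c₁, ((norm_nonneg _).trans (h₀ 0)).trans (le_max_left _ _), fun k ξ => ?_⟩
  by_cases hk : k = 0
  · exact hk ▸ (h₀ ξ).trans (le_max_left _ _)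
  · have : (profile k : Rd d → ℂ) = profile 1 := by
      funext ξ
      simp [profile, hk]
    rw [this]
    exact (h₁ ξ).trans (le_max_right _ _)

theorem norm_le_of_cutoff_ne_zero {k : ℕ} {ξ : Rd d} (h : cutoff k ξ ≠ 0) :
    ‖ξ‖ ≤ 4 * 2 ^ k := by
  have := (norm_le_of_mem_tsupport_profile (subset_tsupport _ h)).1
  rwa [norm_smul, norm_inv, norm_pow, Real.norm_ofNat, inv_mul_le_iff₀ (by positivity),
    mul_comm] at this

theorem hasCompactSupport_cutoff (k : ℕ) : HasCompactSupport (cutoff k : Rd d → ℂ) := by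
  refine HasCompactSupport.of_support_subset_isCompact (isCompact_closedBall (0 : Rd d) (4 * 2 ^ k))
    fun ξ hξ => ?_
  simpa using norm_le_of_cutoff_ne_zero hξ

theorem fourier_lpKernel_ne_zero {φ : 𝓢(Rd d, ℂ)} (hφ : IsLittlewoodPaley φ) {k : ℕ} {ξ : Rd d}
    (h : (𝓕 (lpKernel hφ k) : 𝓢(Rd d, ℂ)) ξ ≠ 0) :
    ‖((2 : ℝ) ^ k)⁻¹ • ξ‖ ≤ 2 ∧ (k ≠ 0 → 1 / 2 ≤ ‖((2 : ℝ) ^ k)⁻¹ • ξ‖) := by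
  by_cases hk : k = 0
  · subst hk
    refine ⟨?_, by simp⟩
    rw [lpKernel, if_pos rfl, lowPass, FourierTransform.fourier_fourierInv_eq] at h
    change lowMultiplier φ ξ ≠ 0 at h
    by_contra hcon
    have hn : 2 < ‖ξ‖ := by simpa using hcon
    refine h ?_
    have h0 : ξ ≠ 0 := by
      rintro rfl
      norm_num at hn
    have hinj : Function.Injective fun k : ℕ => (k : ℤ) + 1 := by
      intro a b hab
      simpa using hab
    have hs := (hinj.hasSum_iff (f := fun k : ℤ => (𝓕 (dilate φ k) : 𝓢(Rd d, ℂ)) ξ)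
      (a := 1) (fun k hk => by
        apply fourier_dilate_eq_zero hφ
        right
        have hk0 : k + 1 ≤ 1 := by
          by_contra hcon
          exact hk ⟨(k - 1).toNat, by simp only; omega⟩
        calc (2 : ℝ) ^ (k + 1) ≤ 2 ^ (1 : ℤ) := zpow_le_zpow_right₀ one_le_two hk0
          _ < ‖ξ‖ := by simpa using hn)).mpr (hφ.hasSum_one ξ h0)
    have := hs.tsum_eq
    simp only [Function.comp_def] at this
    rw [lowMultiplier, this, sub_self]
  · rw [lpKernel, if_neg hk, fourier_dilate, zpow_neg, zpow_natCast] at h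
    have := hφ.support_subset (subset_tsupport _ h)
    exact ⟨this.2, fun _ => this.1⟩

/-- On the support of φ̂_k, rescaled by 2^{-k}, one has |ξ| ≤ 2 and, for k ≥ 1, |8ξ| ≥ 4: the first
bump equals 1 and the second 0. So the cutoff can be inserted wherever φ̂_k or Φ̂ stands. -/
theorem cutoff_mul_fourier_lpKernel {φ : 𝓢(Rd d, ℂ)} (hφ : IsLittlewoodPaley φ) (k : ℕ)
    (ξ : Rd d) : cutoff k ξ * (𝓕 (lpKernel hφ k) : 𝓢(Rd d, ℂ)) ξ =
      (𝓕 (lpKernel hφ k) : 𝓢(Rd d, ℂ)) ξ := by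
  by_cases h : (𝓕 (lpKernel hφ k) : 𝓢(Rd d, ℂ)) ξ = 0
  · simp [h]
  obtain ⟨h1, h2⟩ := fourier_lpKernel_ne_zero hφ h
  have : cutoff k ξ = 1 := by
    rw [cutoff, profile]
    split_ifs with hk
    · rw [bump_eq_one h1, Complex.ofReal_one]
    · rw [bump_eq_one h1, bump_eq_zero]
      · simp
      · rw [norm_smul, Real.norm_ofNat]
        linarith [h2 hk]
  rw [this, one_mul]

/-! ### Kernels of localized symbols -/

/-- Decay of the Fourier transform of a smooth function with support in a fixed ball. -/
theorem exists_one_add_norm_pow_mul_norm_fourier_le (d n : ℕ) : ∃ c : ℝ, 0 ≤ c ∧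
    ∀ (B : Rd d → ℂ) (Λ : ℝ), ContDiff ℝ ∞ B → (∀ ξ, 4 < ‖ξ‖ → B ξ = 0) →
      (∀ i ≤ n, ∀ ξ, ‖iteratedFDeriv ℝ i B ξ‖ ≤ Λ) →
      ∀ w, (1 + ‖w‖) ^ n * ‖𝓕 B w‖ ≤ c * Λ := by
  set v : ℝ := volume.real (Metric.closedBall (0 : Rd d) 4) with hv
  have hv0 : 0 ≤ v := measureReal_nonneg
  -- The factor 2^{n-1} comes from (1 + t)^n ≤ 2^{n-1}(1 + t^n). The summand v bounds the transform
  -- itself, and the other one ‖w‖^n times it, through the n + 1 derivatives of orders 0, …, n.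
  refine ⟨2 ^ (n - 1) * (v + 2 ^ n * ((n + 1) * v)), by positivity, fun B Λ hB hsupp hΛ w => ?_⟩
  have hsub : Function.support B ⊆ Metric.closedBall (0 : Rd d) 4 := by
    intro ξ hξ
    by_contra hcon
    exact hξ (hsupp ξ (by simpa using hcon))
  have hts : tsupport B ⊆ Metric.closedBall (0 : Rd d) 4 :=
    closure_minimal hsub Metric.isClosed_closedBall
  have hcs : HasCompactSupport B :=
    HasCompactSupport.of_support_subset_isCompact (isCompact_closedBall (0 : Rd d) 4) hsub
  have hcont : ∀ i : ℕ, Continuous (iteratedFDeriv ℝ i B) := fun i =>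
    hB.continuous_iteratedFDeriv (natCast_le_infty _)
  have hintg : ∀ i ≤ n, ∫ ξ, ‖iteratedFDeriv ℝ i B ξ‖ ≤ v * Λ := by
    intro i hi
    rw [← setIntegral_eq_integral_of_forall_compl_eq_zero
      (s := Metric.closedBall (0 : Rd d) 4)]
    · calc _ ≤ ∫ ξ in Metric.closedBall (0 : Rd d) 4, Λ := by
            refine setIntegral_mono_on ?_ ?_ measurableSet_closedBall fun ξ _ => hΛ i hi ξ
            · exact (hcont i).norm.continuousOn.integrableOn_compact (isCompact_closedBall _ _)
            · exact continuous_const.continuousOn.integrableOn_compact (isCompact_closedBall _ _)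
        _ = v * Λ := by
            rw [setIntegral_const, smul_eq_mul]
    · intro ξ hξ
      rw [norm_eq_zero]
      by_contra hne
      exact hξ (hts (support_iteratedFDeriv_subset i hne))
  have hΛ0 : 0 ≤ Λ := (norm_nonneg _).trans (hΛ 0 (Nat.zero_le n) 0)
  have h0 : ‖𝓕 B w‖ ≤ v * Λ := by
    refine le_trans ?_ (hintg 0 (Nat.zero_le n))
    rw [fourier_eq_chr]
    refine (norm_integral_le_integral_norm _).trans (le_of_eq ?_)
    refine integral_congr_ae (Eventually.of_forall fun ξ => ?_)
    simp [norm_chr]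
  have hn := Real.pow_mul_norm_iteratedFDeriv_fourier_le (f := B) (K := ⊤) (N := ⊤)
    hB (fun k n _ _ => by
      refine Continuous.integrable_of_hasCompactSupport ?_ ?_
      · exact (continuous_norm.pow k).mul (hcont n).norm
      · exact ((hcs.iteratedFDeriv n).norm).mul_left) (k := 0) (n := n) le_top le_top w
  simp only [norm_iteratedFDeriv_zero, pow_zero, one_mul, CharP.cast_eq_zero, mul_zero,
    zero_add, Finset.range_one] at hn
  have hsum : ∑ p ∈ ({0} : Finset ℕ) ×ˢ Finset.range (n + 1),
      ∫ ξ, ‖ξ‖ ^ p.1 * ‖iteratedFDeriv ℝ p.2 B ξ‖ ≤ (n + 1) * v * Λ := by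
    calc _ ≤ ∑ p ∈ ({0} : Finset ℕ) ×ˢ Finset.range (n + 1), v * Λ := by
          refine Finset.sum_le_sum fun p hp => ?_
          simp only [Finset.singleton_product, Finset.mem_map, Finset.mem_range,
            Function.Embedding.coeFn_mk] at hp
          obtain ⟨i, hi, rfl⟩ := hp
          simpa using hintg i (by omega)
      _ = _ := by simp [mul_assoc]
  calc (1 + ‖w‖) ^ n * ‖𝓕 B w‖ ≤ (2 ^ (n - 1) * (1 ^ n + ‖w‖ ^ n)) * ‖𝓕 B w‖ := by
        gcongr
        exact add_pow_le zero_le_one (norm_nonneg w) n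
    _ = 2 ^ (n - 1) * (‖𝓕 B w‖ + ‖w‖ ^ n * ‖𝓕 B w‖) := by ring
    _ ≤ 2 ^ (n - 1) * (v * Λ + 2 ^ n * ((n + 1) * v * Λ)) := by
        gcongr 2 ^ (n - 1) * (?_ + ?_)
        refine hn.trans ?_
        gcongr
    _ = _ := by ring

/-- The kernel `∫ a(x, ξ) ψ_k(ξ) e^{2πi⟨y, ξ⟩} dξ`. -/
def symbolKernel (a : Rd d → Rd d → ℂ) (k : ℕ) (x y : Rd d) : ℂ :=
  ∫ ξ, chr y ξ * (cutoff k ξ * a x ξ)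

/-- On the support of the profile, 1 + |2^k ζ| lies between 2^k/8 and 8·2^k, so any real power of it
behaves like that of 2^k. -/
theorem rpow_one_add_norm_le {k : ℕ} {ζ : Rd d} (h : ζ ∈ tsupport (profile k)) (p : ℝ) :
    (1 + ‖(2 : ℝ) ^ k • ζ‖) ^ p ≤ 8 ^ |p| * 2 ^ ((k : ℝ) * p) := by
  obtain ⟨h1, h2⟩ := norm_le_of_mem_tsupport_profile h
  have hk1 : (1 : ℝ) ≤ 2 ^ k := one_le_pow₀ one_le_two
  have hn : ‖(2 : ℝ) ^ k • ζ‖ = 2 ^ k * ‖ζ‖ := by simp [norm_smul]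
  have hup : 1 + ‖(2 : ℝ) ^ k • ζ‖ ≤ 8 * 2 ^ k := by rw [hn]; nlinarith
  have hlo : 8⁻¹ * 2 ^ k ≤ 1 + ‖(2 : ℝ) ^ k • ζ‖ := by
    rw [hn]
    by_cases hk : k = 0
    · subst hk
      have := norm_nonneg ζ
      norm_num
      linarith
    · nlinarith [h2 hk]
  rw [Real.rpow_mul two_pos.le, Real.rpow_natCast]
  rcases le_total 0 p with hp | hp
  · rw [abs_of_nonneg hp, ← Real.mul_rpow (by positivity) (by positivity)]
    exact Real.rpow_le_rpow (by positivity) hup hp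
  · rw [abs_of_nonpos hp, Real.rpow_neg (by positivity), ← Real.inv_rpow (by positivity),
      ← Real.mul_rpow (by positivity) (by positivity)]
    exact Real.rpow_le_rpow_of_nonpos (by positivity) hlo hp

theorem IsSymbol.contDiff_right {ρ δ m : ℝ} {a : Rd d → Rd d → ℂ} (ha : IsSymbol ρ δ m a)
    (x : Rd d) : ContDiff ℝ ∞ (a x) := ha.smooth.comp (contDiff_prodMk_right x)

/-- Leibniz after rescaling: every ζ-derivative of a(x, 2^k ζ) produces a factor 2^k, which the drop
of one order in the symbol estimate cancels. Off the support of the profile there is nothing to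
bound. -/
theorem IsSymbol.norm_iteratedFDeriv_profile_mul_le {m : ℝ} {a : Rd d → Rd d → ℂ}
    (ha : IsSymbol 1 1 m a) (n : ℕ) : ∃ c : ℝ, 0 ≤ c ∧ ∀ i ≤ n, ∀ (k : ℕ) (x ζ : Rd d),
      ‖iteratedFDeriv ℝ i (fun ζ => profile k ζ * a x ((2 : ℝ) ^ k • ζ)) ζ‖ ≤
        c * 2 ^ ((k : ℝ) * m) := by
  choose c₁ hc₁0 hc₁ using exists_norm_iteratedFDeriv_profile_le (d := d)
  choose c₂ hc₂ using ha.norm_iteratedFDeriv_le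
  have hc₂0 : ∀ j, 0 ≤ c₂ j := fun j => by
    have := (norm_nonneg _).trans (hc₂ j 0 0)
    simpa using this
  set c : ℕ → ℝ := fun i => ∑ j ∈ Finset.range (i + 1),
    (i.choose j : ℝ) * c₁ j * (c₂ (i - j) * 8 ^ |m - 1 * (i - j : ℕ)|) with hc
  have hcn : ∀ i, 0 ≤ c i := fun i => Finset.sum_nonneg fun j _ => by
    have := hc₁0 j
    have := hc₂0 (i - j)
    positivity
  refine ⟨∑ i ∈ Finset.range (n + 1), c i, Finset.sum_nonneg fun i _ => hcn i,
    fun i hi k x ζ => ?_⟩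
  refine le_trans (b := c i * 2 ^ ((k : ℝ) * m)) ?_ (by
    gcongr
    exact Finset.single_le_sum (f := c) (fun i _ => hcn i) (Finset.mem_range.2 (by omega)))
  have hax : ContDiff ℝ ∞ fun ζ => a x ((2 : ℝ) ^ k • ζ) :=
    (ha.contDiff_right x).comp (contDiff_const_smul _)
  refine (norm_iteratedFDeriv_mul_le (contDiff_profile k) hax ζ
    (natCast_le_infty _)).trans ?_
  rw [hc, Finset.sum_mul]
  refine Finset.sum_le_sum fun j _ => ?_
  have h1 := hc₁0 j
  have h2 := hc₂0 (i - j)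
  by_cases hζ : ζ ∈ tsupport (profile k)
  · have h3 : ‖iteratedFDeriv ℝ (i - j) (fun ζ => a x ((2 : ℝ) ^ k • ζ)) ζ‖ ≤
        c₂ (i - j) * 8 ^ |m - 1 * (i - j : ℕ)| * 2 ^ ((k : ℝ) * m) := by
      rw [iteratedFDeriv_comp_const_smul _ ((ha.contDiff_right x).of_le
        (natCast_le_infty _)), norm_smul, norm_pow, norm_pow, Real.norm_ofNat]
      calc _ ≤ ((2 : ℝ) ^ k) ^ (i - j) * (c₂ (i - j) *
            (8 ^ |m - 1 * (i - j : ℕ)| * 2 ^ ((k : ℝ) * (m - 1 * (i - j : ℕ))))) := by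
            gcongr
            exact (hc₂ (i - j) x _).trans (by gcongr; exact rpow_one_add_norm_le hζ _)
        _ = _ := by
            have : (2 : ℝ) ^ ((k : ℝ) * m) =
                ((2 : ℝ) ^ k) ^ (i - j) * 2 ^ ((k : ℝ) * (m - 1 * (i - j : ℕ))) := by
              rw [← pow_mul, ← Real.rpow_natCast, ← Real.rpow_add two_pos]
              congr 1
              push_cast
              ring
            rw [this]
            ring
    calc _ ≤ (i.choose j : ℝ) * c₁ j *
          (c₂ (i - j) * 8 ^ |m - 1 * (i - j : ℕ)| * 2 ^ ((k : ℝ) * m)) := by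
          gcongr
          exact hc₁ j k ζ
      _ = _ := by ring
  · have : iteratedFDeriv ℝ j (profile k) ζ = 0 := by
      by_contra hne
      exact hζ (support_iteratedFDeriv_subset j hne)
    rw [this, norm_zero, mul_zero, zero_mul]
    positivity

theorem symbolKernel_eq_fourier (a : Rd d → Rd d → ℂ) (k : ℕ) (x y : Rd d) :
    symbolKernel a k x y = 2 ^ (k * d) *
      𝓕 (fun ζ => profile k ζ * a x ((2 : ℝ) ^ k • ζ)) (-((2 : ℝ) ^ k • y)) := by
  have h2 : (2 : ℝ) ^ k ≠ 0 := by positivity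
  have key := Measure.integral_comp_smul (volume : Measure (Rd d))
    (fun ξ : Rd d => chr y ξ * (cutoff k ξ * a x ξ)) ((2 : ℝ) ^ k)
  rw [finrank_euclideanSpace_fin, abs_of_pos (by positivity), Complex.real_smul] at key
  rw [fourier_eq_chr, neg_neg]
  have e : ∀ ζ : Rd d, chr ((2 : ℝ) ^ k • y) ζ * (profile k ζ * a x ((2 : ℝ) ^ k • ζ)) =
      chr y ((2 : ℝ) ^ k • ζ) * (cutoff k ((2 : ℝ) ^ k • ζ) * a x ((2 : ℝ) ^ k • ζ)) := by
    intro ζ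
    rw [cutoff, inv_smul_smul₀ h2, chr, chr, real_inner_smul_left, real_inner_smul_right]
  simp_rw [e]
  rw [key, ← mul_assoc, symbolKernel]
  have : (2 : ℂ) ^ (k * d) * (((((2 : ℝ) ^ k) ^ d)⁻¹ : ℝ) : ℂ) = 1 := by
    push_cast
    rw [pow_mul]
    exact mul_inv_cancel₀ (pow_ne_zero _ (pow_ne_zero _ two_ne_zero))
  rw [this, one_mul]

/-- Kernel estimate for localized symbols. -/
theorem IsSymbol.norm_symbolKernel_le {m : ℝ} {a : Rd d → Rd d → ℂ} (ha : IsSymbol 1 1 m a)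
    (n : ℕ) : ∃ C : ℝ, 0 ≤ C ∧ ∀ (k : ℕ) (x y : Rd d),
      ‖symbolKernel a k x y‖ ≤ C * 2 ^ ((k : ℝ) * m) * wt k n y := by
  obtain ⟨c₁, hc₁, h₁⟩ := exists_one_add_norm_pow_mul_norm_fourier_le d n
  obtain ⟨c₂, hc₂, h₂⟩ := ha.norm_iteratedFDeriv_profile_mul_le n
  refine ⟨c₁ * c₂, by positivity, fun k x y => ?_⟩
  have hax : ContDiff ℝ ∞ fun ζ => a x ((2 : ℝ) ^ k • ζ) :=
    (ha.contDiff_right x).comp (contDiff_const_smul _)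
  have h := h₁ (fun ζ => profile k ζ * a x ((2 : ℝ) ^ k • ζ)) (c₂ * 2 ^ ((k : ℝ) * m))
    ((contDiff_profile k).mul hax) (fun ξ hξ => by
      have : profile k ξ = 0 := by
        by_contra hne
        exact absurd (norm_le_of_mem_tsupport_profile (subset_tsupport _ hne)).1 (not_le.2 hξ)
      simp [this]) (fun i hi ζ => h₂ i hi k x ζ) (-((2 : ℝ) ^ k • y))
  rw [norm_neg, norm_smul, norm_pow, Real.norm_ofNat] at h
  have h1 := one_le_one_add_mul_norm k y
  rw [symbolKernel_eq_fourier, norm_mul, norm_pow, RCLike.norm_ofNat, wt, Real.rpow_neg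
    (by positivity), Real.rpow_natCast]
  rw [← le_div_iff₀' (by positivity)] at h
  calc _ ≤ 2 ^ (k * d) * (c₁ * (c₂ * 2 ^ ((k : ℝ) * m)) / (1 + 2 ^ k * ‖y‖) ^ n) := by gcongr
    _ = _ := by rw [div_eq_mul_inv]; ring

theorem continuous_symbolKernel {a : Rd d → Rd d → ℂ}
    (ha : Continuous fun p : Rd d × Rd d => a p.1 p.2) (k : ℕ) :
    Continuous fun p : Rd d × Rd d => symbolKernel a k p.1 p.2 := by
  have e : (fun p : Rd d × Rd d => symbolKernel a k p.1 p.2) = fun p =>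
      ∫ ξ in Metric.closedBall (0 : Rd d) (4 * 2 ^ k), chr p.2 ξ * (cutoff k ξ * a p.1 ξ) := by
    funext p
    rw [symbolKernel, setIntegral_eq_integral_of_forall_compl_eq_zero]
    intro ξ hξ
    have : cutoff k ξ = 0 := by
      by_contra hne
      exact hξ (by simpa using norm_le_of_cutoff_ne_zero hne)
    simp [this]
  rw [e]
  refine continuous_parametric_integral_of_continuous ?_ (isCompact_closedBall _ _)
  have h1 : Continuous (cutoff k : Rd d → ℂ) := (contDiff_cutoff k).continuous
  exact (continuous_chr.comp ((continuous_snd.comp continuous_fst).prodMk continuous_snd)).mul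
    ((h1.comp continuous_snd).mul
      (ha.comp ((continuous_fst.comp continuous_fst).prodMk continuous_snd)))

/-! ### Differentiation of symbols -/

/-- The symbol `e^{-2πi⟨x,ξ⟩} ∂_{x,v} (a(x, ξ) e^{2πi⟨x,ξ⟩})`. -/
def conjDeriv (v : Rd d) (a : Rd d → Rd d → ℂ) (x ξ : Rd d) : ℂ :=
  fderiv ℝ (fun y => a y ξ) x v + 2 * Real.pi * Complex.I * (inner ℝ v ξ : ℝ) * a x ξ

theorem contDiff_iteratedFDeriv_left {F : Type} [NormedAddCommGroup F] [NormedSpace ℝ F]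
    {a : Rd d → Rd d → F} (ha : ContDiff ℝ ∞ fun p : Rd d × Rd d => a p.1 p.2) (β : ℕ) :
    ContDiff ℝ ∞ fun p : Rd d × Rd d => iteratedFDeriv ℝ β (fun y => a y p.2) p.1 := by
  induction β with
  | zero =>
    have e : (fun p : Rd d × Rd d => iteratedFDeriv ℝ 0 (fun y => a y p.2) p.1) =
        (continuousMultilinearCurryFin0 ℝ (Rd d) F).symm ∘ fun p : Rd d × Rd d => a p.1 p.2 := by
      funext p
      rw [iteratedFDeriv_zero_eq_comp]
      rfl
    rw [e]
    exact (LinearIsometryEquiv.contDiff _).comp ha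
  | succ β ih =>
    have e : (fun p : Rd d × Rd d => iteratedFDeriv ℝ (β + 1) (fun y => a y p.2) p.1) =
        (continuousMultilinearCurryLeftEquiv ℝ (fun _ : Fin (β + 1) => Rd d) F).symm ∘
          fun p : Rd d × Rd d => fderiv ℝ (iteratedFDeriv ℝ β (fun y => a y p.2)) p.1 := by
      funext p
      rw [iteratedFDeriv_succ_eq_comp_left]
      rfl
    have h : ContDiff ℝ ∞ fun p : Rd d × Rd d =>
        fderiv ℝ (iteratedFDeriv ℝ β (fun y => a y p.2)) p.1 :=
      ContDiff.fderiv
        (f := fun (p : Rd d × Rd d) y => iteratedFDeriv ℝ β (fun y => a y p.2) y)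
        (ih.comp (contDiff_snd.prodMk (contDiff_snd.comp contDiff_fst))) contDiff_fst (by simp)
    rw [e]
    exact (LinearIsometryEquiv.contDiff _).comp h

/-- A linear form in ξ is a symbol of order one: its derivatives of order at least two vanish. -/
theorem norm_iteratedFDeriv_clm_le {F : Type} [NormedAddCommGroup F] [NormedSpace ℝ F]
    (ℓ : Rd d →L[ℝ] F) (j : ℕ) (ξ : Rd d) :
    ‖iteratedFDeriv ℝ j ℓ ξ‖ ≤ ‖ℓ‖ * (1 + ‖ξ‖) ^ (1 - j : ℝ) := by
  rcases j with _ | _ | j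
  · rw [norm_iteratedFDeriv_zero]
    simp only [CharP.cast_eq_zero, sub_zero, Real.rpow_one]
    exact (ℓ.le_opNorm ξ).trans (by gcongr; linarith)
  · rw [zero_add, norm_iteratedFDeriv_one, ContinuousLinearMap.fderiv]
    simp
  · have : ‖iteratedFDeriv ℝ (j + 1 + 1) ℓ ξ‖ = 0 := by
      rw [← norm_iteratedFDeriv_fderiv]
      have e : fderiv ℝ ℓ = fun _ => ℓ := by
        funext x
        exact ContinuousLinearMap.fderiv ℓ
      rw [e, iteratedFDeriv_succ_const]
      simp
    rw [this]
    positivity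

/-- Both terms cost exactly one order: an x-derivative because δ = 1, and the linear factor from the
character because it is a symbol of order one. Thus integration by parts stays within the class, and
the worst value δ = 1 does no harm. -/
theorem IsSymbol.isSymbol_conjDeriv {m : ℝ} {a : Rd d → Rd d → ℂ} (ha : IsSymbol 1 1 m a)
    (v : Rd d) : IsSymbol 1 1 (m + 1) (conjDeriv v a) := by
  set ℓ : Rd d →L[ℝ] ℂ := (2 * Real.pi * Complex.I : ℂ) •
    (Complex.ofRealCLM.comp (innerSL ℝ v)) with hℓ
  have hℓ_apply : ∀ ξ, ℓ ξ = 2 * Real.pi * Complex.I * (inner ℝ v ξ : ℝ) := fun ξ => rfl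
  have hsm := ha.smooth
  have hsx : ∀ ξ, ContDiff ℝ ∞ fun y => a y ξ := fun ξ => hsm.comp (contDiff_prodMk_left ξ)
  constructor
  · refine ContDiff.add ?_ ?_
    · have h : ContDiff ℝ ∞ fun p : Rd d × Rd d => fderiv ℝ (fun y => a y p.2) p.1 :=
        ContDiff.fderiv (f := fun (p : Rd d × Rd d) y => a y p.2)
          (hsm.comp (contDiff_snd.prodMk (contDiff_snd.comp contDiff_fst))) contDiff_fst (by simp)
      exact h.clm_apply contDiff_const
    · exact (ℓ.contDiff.comp contDiff_snd).mul hsm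
  · intro α β
    obtain ⟨c₁, hc₁⟩ := ha.bound α (β + 1)
    choose c₂ hc₂ using fun α' => ha.bound α' β
    have hc₂0 : ∀ j, 0 ≤ c₂ j := fun j => by
      have := (norm_nonneg _).trans (hc₂ j 0 0)
      simpa using this
    -- Λ inserts v in the last slot, turning D^{β+1} a into D^β ∂_v a. It does not depend on (x, ξ),
    -- so it commutes with ξ-derivatives.
    set Λ : (ContinuousMultilinearMap ℝ (fun _ : Fin (β + 1) => Rd d) ℂ) →L[ℝ]
        ContinuousMultilinearMap ℝ (fun _ : Fin β => Rd d) ℂ :=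
      (ContinuousLinearMap.compContinuousMultilinearMapL ℝ (fun _ : Fin β => Rd d)
        (Rd d →L[ℝ] ℂ) ℂ (ContinuousLinearMap.apply ℝ ℂ v)).comp
      ((continuousMultilinearCurryRightEquiv' ℝ β (Rd d) ℂ).toContinuousLinearEquiv :
        _ →L[ℝ] _) with hΛ
    have hD : ∀ β, ContDiff ℝ ∞ fun p : Rd d × Rd d => iteratedFDeriv ℝ β (fun y => a y p.2) p.1 :=
      fun β => contDiff_iteratedFDeriv_left hsm β
    have hDx : ∀ β x, ContDiff ℝ ∞ fun η => iteratedFDeriv ℝ β (fun y => a y η) x :=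
      fun β x => (hD β).comp (contDiff_prodMk_right x)
    have e : ∀ x, (fun η => iteratedFDeriv ℝ β (fun y => conjDeriv v a y η) x) =
        (Λ ∘ fun η => iteratedFDeriv ℝ (β + 1) (fun y => a y η) x) +
          fun η => ℓ η • iteratedFDeriv ℝ β (fun y => a y η) x := by
      intro x
      funext η
      have hfd : ContDiff ℝ ∞ (fderiv ℝ fun y => a y η) := (hsx η).fderiv_right (by simp)
      have e0 : (fun y => conjDeriv v a y η) =
          ((ContinuousLinearMap.apply ℝ ℂ v) ∘ fderiv ℝ fun y => a y η) +
            (ℓ η • fun y => a y η) := rfl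
      rw [e0, iteratedFDeriv_add_apply, iteratedFDeriv_const_smul_apply,
        ContinuousLinearMap.iteratedFDeriv_comp_left _ hfd.contDiffAt (natCast_le_infty _)]
      · simp only [Pi.add_apply, Function.comp_apply]
        congr 1
        rw [iteratedFDeriv_succ_eq_comp_right, hΛ]
        simp
      · exact ((hsx η).of_le (natCast_le_infty _)).contDiffAt
      · exact (((ContinuousLinearMap.contDiff _).comp hfd).of_le (natCast_le_infty _)).contDiffAt
      · exact (((hsx η).const_smul (ℓ η)).of_le (natCast_le_infty _)).contDiffAt
    refine ⟨‖Λ‖ * c₁ + ∑ j ∈ Finset.range (α + 1), (α.choose j : ℝ) * ‖ℓ‖ * c₂ (α - j),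
      fun x ξ => ?_⟩
    have hsmul : ContDiff ℝ ∞ fun η => ℓ η • iteratedFDeriv ℝ β (fun y => a y η) x :=
      ContDiff.smul ℓ.contDiff (hDx β x)
    rw [e x, iteratedFDeriv_add_apply
      (((Λ.contDiff.comp (hDx (β + 1) x)).of_le (natCast_le_infty _)).contDiffAt)
      (hsmul.of_le (natCast_le_infty _)).contDiffAt]
    refine (norm_add_le _ _).trans ?_
    rw [add_mul]
    have hp : 0 < 1 + ‖ξ‖ := by positivity
    refine add_le_add ?_ ?_
    · refine (ContinuousLinearMap.norm_iteratedFDeriv_comp_left Λ (hDx (β + 1) x).contDiffAt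
        (natCast_le_infty _)).trans ?_
      rw [mul_assoc]
      gcongr
      refine (hc₁ x ξ).trans (le_of_eq ?_)
      congr 2
      push_cast
      ring
    · refine (norm_iteratedFDeriv_smul_le ℓ.contDiff (hDx β x) ξ (natCast_le_infty _)).trans ?_
      rw [Finset.sum_mul]
      refine Finset.sum_le_sum fun j hj => ?_
      have hj' : j ≤ α := by
        simp only [Finset.mem_range] at hj
        omega
      have := hc₂0 (α - j)
      calc _ ≤ (α.choose j : ℝ) * (‖ℓ‖ * (1 + ‖ξ‖) ^ (1 - j : ℝ)) *
            (c₂ (α - j) * (1 + ‖ξ‖) ^ (m - 1 * (α - j : ℕ) + 1 * β)) := by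
            gcongr
            · exact norm_iteratedFDeriv_clm_le ℓ j ξ
            · exact hc₂ (α - j) x ξ
        _ = _ := by
            have : (1 + ‖ξ‖) ^ (m + 1 - 1 * (α : ℝ) + 1 * β) = (1 + ‖ξ‖) ^ (1 - j : ℝ) *
                (1 + ‖ξ‖) ^ (m - 1 * (α - j : ℕ) + 1 * β) := by
              rw [← Real.rpow_add hp, Nat.cast_sub hj']
              congr 1
              ring
            rw [this]
            ring

/-- With a = 1, the kernel estimate for symbols also covers the reproducing kernels of the
Littlewood–Paley pieces. -/
theorem isSymbol_one : IsSymbol 1 1 0 (fun _ _ : Rd d => (1 : ℂ)) := by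
  refine ⟨contDiff_const, fun α β => ⟨1, fun x ξ => ?_⟩⟩
  rcases β with _ | β
  · have e : (fun η : Rd d => iteratedFDeriv ℝ 0 (fun _ : Rd d => (1 : ℂ)) x) = fun _ =>
        iteratedFDeriv ℝ 0 (fun _ : Rd d => (1 : ℂ)) x := rfl
    rcases α with _ | α
    · simp
    · rw [iteratedFDeriv_succ_const]
      simp only [Pi.zero_apply, norm_zero]
      positivity
  · simp only [iteratedFDeriv_succ_const, Pi.zero_apply, iteratedFDeriv_fun_zero, norm_zero]
    positivity

/-! ### Schwartz functions with Fourier support in an annulus -/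

theorem fourier_injective : Function.Injective fun f : 𝓢(Rd d, ℂ) => (𝓕 f : 𝓢(Rd d, ℂ)) := by
  intro f₁ f₂ h
  have := congrArg (fun f : 𝓢(Rd d, ℂ) => (𝓕⁻ f : 𝓢(Rd d, ℂ))) h
  simpa [FourierTransform.fourierInv_fourier_eq] using this

/-- The Fourier transform is supported in a compact set not containing `0`. -/
structure IsAnnular (ρ : 𝓢(Rd d, ℂ)) : Prop where
  compact : HasCompactSupport (𝓕 ρ : 𝓢(Rd d, ℂ))
  zero_notMem : (0 : Rd d) ∉ tsupport (𝓕 ρ : 𝓢(Rd d, ℂ))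

theorem IsLittlewoodPaley.isAnnular {φ : 𝓢(Rd d, ℂ)} (hφ : IsLittlewoodPaley φ) : IsAnnular φ := by
  constructor
  · refine HasCompactSupport.of_support_subset_isCompact (isCompact_closedBall (0 : Rd d) 2)
      fun ξ hξ => ?_
    simpa using (hφ.support_subset (subset_tsupport _ hξ)).2
  · intro h
    have := (hφ.support_subset h).1
    norm_num at this

/-- The factor is singular at the origin only, and g vanishes near it. -/
theorem contDiff_div_norm_sq_mul {g : Rd d → ℂ} (hg : ContDiff ℝ ∞ g) (h0 : (0 : Rd d) ∉ tsupport g)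
    (v : Rd d) : ContDiff ℝ ∞ fun ξ => (inner ℝ ξ v / ‖ξ‖ ^ 2 : ℝ) * g ξ := by
  rw [contDiff_iff_contDiffAt]
  intro ξ
  by_cases hξ : ξ = 0
  · subst hξ
    have : (fun ξ => ((inner ℝ ξ v / ‖ξ‖ ^ 2 : ℝ) : ℂ) * g ξ) =ᶠ[𝓝 0] fun _ => 0 := by
      filter_upwards [notMem_tsupport_iff_eventuallyEq.1 h0] with ξ hξ
      simp [hξ]
    exact contDiffAt_const.congr_of_eventuallyEq this
  · refine ContDiffAt.mul ?_ hg.contDiffAt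
    refine Complex.ofRealCLM.contDiff.contDiffAt.comp ξ ?_
    refine ContDiffAt.div ?_ ?_ (by simpa using hξ)
    · exact (contDiff_id.inner ℝ contDiff_const).contDiffAt
    · exact (contDiff_norm_sq ℝ).contDiffAt

open LineDeriv in
/-- An annular Schwartz function is a divergence of annular Schwartz functions. -/
theorem IsAnnular.eq_sum_lineDeriv {ρ : 𝓢(Rd d, ℂ)} (hρ : IsAnnular ρ) :
    ∃ σ : Fin d → 𝓢(Rd d, ℂ), (∀ i, IsAnnular (σ i)) ∧
      ρ = ∑ i, ∂_{EuclideanSpace.single i (1 : ℝ)} (σ i) := by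
  set e : Fin d → Rd d := fun i => EuclideanSpace.single i (1 : ℝ) with he
  have hc : (2 * Real.pi * Complex.I : ℂ) ≠ 0 := Complex.two_pi_I_ne_zero
  -- From 1 = ∑_i ξ_i · ξ_i/|ξ|² on the support of ρ̂: the transform of σ_i is ξ_i ρ̂/(2πi|ξ|²), and
  -- ∂_i multiplies it by 2πi ξ_i.
  set g : Fin d → Rd d → ℂ := fun i ξ => (2 * Real.pi * Complex.I : ℂ)⁻¹ *
    ((inner ℝ ξ (e i) / ‖ξ‖ ^ 2 : ℝ) * (𝓕 ρ : 𝓢(Rd d, ℂ)) ξ) with hg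
  have hgs : ∀ i, ContDiff ℝ ∞ (g i) := fun i =>
    contDiff_const.mul (contDiff_div_norm_sq_mul ((𝓕 ρ : 𝓢(Rd d, ℂ)).smooth ⊤) hρ.zero_notMem _)
  have hgc : ∀ i, HasCompactSupport (g i) := fun i => (hρ.compact.mul_left).mul_left
  set σ : Fin d → 𝓢(Rd d, ℂ) := fun i => 𝓕⁻ ((hgc i).toSchwartzMap (hgs i)) with hσ
  have hFσ : ∀ i, (𝓕 (σ i) : 𝓢(Rd d, ℂ)) = (hgc i).toSchwartzMap (hgs i) := fun i =>
    FourierTransform.fourier_fourierInv_eq _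
  have hFσ' : ∀ i ξ, (𝓕 (σ i) : 𝓢(Rd d, ℂ)) ξ = g i ξ := fun i ξ => by rw [hFσ]; rfl
  have hFσc : ∀ i, ⇑(𝓕 (σ i) : 𝓢(Rd d, ℂ)) = g i := fun i => funext (hFσ' i)
  refine ⟨σ, fun i => ⟨?_, ?_⟩, ?_⟩
  · rw [hFσc]
    exact hgc i
  · rw [hFσc]
    refine fun h => hρ.zero_notMem ?_
    exact tsupport_mul_subset_right (tsupport_mul_subset_right h)
  · apply fourier_injective
    simp only
    have hsum : (𝓕 (∑ i, ∂_{e i} (σ i)) : 𝓢(Rd d, ℂ)) = ∑ i, 𝓕 (∂_{e i} (σ i)) :=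
      map_sum (SchwartzMap.fourierTransformCLM ℂ (V := Rd d) (E := ℂ)) _ _
    rw [hsum]
    ext ξ
    have hterm : ∀ i, (𝓕 (∂_{e i} (σ i)) : 𝓢(Rd d, ℂ)) ξ =
        (inner ℝ ξ (e i) * (inner ℝ ξ (e i) / ‖ξ‖ ^ 2) : ℝ) * (𝓕 ρ : 𝓢(Rd d, ℂ)) ξ := by
      intro i
      rw [SchwartzMap.fourier_lineDerivOp_eq]
      have ht : Function.HasTemperateGrowth fun ξ : Rd d => (inner ℝ ξ (e i) : ℝ) := by
        fun_prop
      simp only [smul_apply, SchwartzMap.smulLeftCLM_apply_apply ht, hFσ', hg]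
      simp only [smul_eq_mul, Complex.real_smul]
      field_simp
      push_cast
      ring
    rw [show (∑ i, (𝓕 (∂_{e i} (σ i)) : 𝓢(Rd d, ℂ))) ξ =
      ∑ i, (𝓕 (∂_{e i} (σ i)) : 𝓢(Rd d, ℂ)) ξ by
        simp]
    simp_rw [hterm]
    rw [← Finset.sum_mul, ← Complex.ofReal_sum]
    by_cases hξ : ξ = 0
    · subst hξ
      rw [image_eq_zero_of_notMem_tsupport hρ.zero_notMem, mul_zero]
    · have h1 : ∑ i, inner ℝ ξ (e i) * (inner ℝ ξ (e i) / ‖ξ‖ ^ 2) = 1 := by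
        have hn : ‖ξ‖ ^ 2 ≠ 0 := by simpa using hξ
        simp_rw [mul_div_assoc']
        rw [← Finset.sum_div, div_eq_one_iff_eq hn, EuclideanSpace.norm_sq_eq]
        refine Finset.sum_congr rfl fun i _ => ?_
        simp [he, EuclideanSpace.inner_single_right, sq]
      rw [h1]
      simp

open LineDeriv in
-- The source of the gain 2^{-l} in each integration by parts.
theorem dilate_lineDeriv (σ : 𝓢(Rd d, ℂ)) (v : Rd d) (l : ℤ) (y : Rd d) :
    dilate (∂_{v} σ) l y = ((2 : ℂ) ^ l)⁻¹ * fderiv ℝ (dilate σ l) y v := by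
  have h2 : (2 : ℂ) ^ l ≠ 0 := zpow_ne_zero _ two_ne_zero
  have hfd : fderiv ℝ (dilate σ l) y v =
      (2 : ℂ) ^ (l * d) * ((2 : ℂ) ^ l * fderiv ℝ σ ((2 : ℝ) ^ l • y) v) := by
    have e : (dilate σ l : Rd d → ℂ) = fun y => (2 : ℂ) ^ (l * d) * σ ((2 : ℝ) ^ l • y) := by
      funext y
      exact dilate_apply σ l y
    have hd : DifferentiableAt ℝ (fun y : Rd d => σ ((2 : ℝ) ^ l • y)) y :=
      σ.differentiableAt.comp y (f := fun y : Rd d => (2 : ℝ) ^ l • y) (by fun_prop)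
    rw [e, fderiv_const_mul hd, fderiv_comp_smul]
    simp
  rw [hfd, dilate_apply, SchwartzMap.lineDerivOp_apply_eq_fderiv]
  field_simp

theorem norm_dilate_le (ρ : 𝓢(Rd d, ℂ)) (n : ℕ) : ∃ C : ℝ, 0 ≤ C ∧ ∀ (l : ℕ) (y : Rd d),
    ‖dilate ρ l y‖ ≤ C * wt l n y := by
  have h := fun y => SchwartzMap.one_add_le_sup_seminorm_apply (𝕜 := ℝ) (m := (n, 0)) le_rfl
    le_rfl ρ y
  set C : ℝ := 2 ^ (n, 0).1 * (Finset.Iic (n, 0)).sup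
    (fun m : ℕ × ℕ => SchwartzMap.seminorm ℝ m.1 m.2) ρ with hC
  refine ⟨C, by positivity, fun l y => ?_⟩
  have h1 := one_le_one_add_mul_norm l y
  have h' := h ((2 : ℝ) ^ (l : ℤ) • y)
  rw [norm_iteratedFDeriv_zero, zpow_natCast, norm_smul, norm_pow, Real.norm_ofNat,
    ← le_div_iff₀' (by positivity)] at h'
  rw [dilate_apply, norm_mul, norm_zpow, RCLike.norm_ofNat, zpow_natCast, wt,
    Real.rpow_neg (by positivity), Real.rpow_natCast]
  have e : (2 : ℝ) ^ ((l : ℤ) * d) = 2 ^ (l * d) := by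
    rw [← zpow_natCast]
    push_cast
    rfl
  rw [e]
  calc _ ≤ 2 ^ (l * d) * (C / (1 + 2 ^ l * ‖y‖) ^ n) := by gcongr
    _ = _ := by rw [div_eq_mul_inv]; ring

/-! ### Off-diagonal decay -/

theorem IsSymbol.norm_le {m : ℝ} {a : Rd d → Rd d → ℂ} (ha : IsSymbol 1 1 m a) :
    ∃ c : ℝ, 0 ≤ c ∧ ∀ x ξ, ‖a x ξ‖ ≤ c * (1 + ‖ξ‖) ^ m := by
  obtain ⟨c, hc⟩ := ha.norm_iteratedFDeriv_le 0
  refine ⟨c, ?_, fun x ξ => by simpa using hc x ξ⟩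
  simpa using (norm_nonneg _).trans (hc 0 0)

theorem integrable_comp_sub_left (ρ : 𝓢(Rd d, ℂ)) (x : Rd d) : Integrable fun y => ρ (x - y) :=
  ρ.integrable.comp_sub_left x

theorem integrable_cutoff_mul (k : ℕ) (m c : ℝ) :
    Integrable fun ξ : Rd d => ‖cutoff k ξ‖ * (c * (1 + ‖ξ‖) ^ m) := by
  refine Continuous.integrable_of_hasCompactSupport ?_ ?_
  · have h1 : Continuous (cutoff k : Rd d → ℂ) := (contDiff_cutoff k).continuous
    refine h1.norm.mul (continuous_const.mul (Continuous.rpow_const (by fun_prop) fun ξ => ?_))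
    left
    positivity
  · exact (hasCompactSupport_cutoff k).norm.mul_right

/-- The cutoff confines ξ to a compact set and a is bounded in x there, so g alone must provide
integrability. -/
theorem IsSymbol.integrable_prod {m : ℝ} {a : Rd d → Rd d → ℂ} (ha : IsSymbol 1 1 m a) (k : ℕ)
    {g : Rd d → ℂ} (hgi : Integrable g) (hgc : Continuous g) {u w : Rd d → Rd d}
    (hu : Continuous u) (hw : Continuous w) :
    Integrable (fun p : Rd d × Rd d => g p.1 * (chr (u p.1) p.2 * (cutoff k p.2 * a (w p.1) p.2)))
      (volume.prod volume) := by
  obtain ⟨c, hc0, hc⟩ := ha.norm_le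
  have h1 : Continuous (cutoff k : Rd d → ℂ) := (contDiff_cutoff k).continuous
  have ha' : Continuous fun p : Rd d × Rd d => a p.1 p.2 := ha.smooth.continuous
  refine (hgi.norm.mul_prod (integrable_cutoff_mul k m c)).mono' ?_ ?_
  · refine Continuous.aestronglyMeasurable ?_
    exact (hgc.comp continuous_fst).mul ((continuous_chr.comp
      ((hu.comp continuous_fst).prodMk continuous_snd)).mul ((h1.comp continuous_snd).mul
      (ha'.comp ((hw.comp continuous_fst).prodMk continuous_snd))))
  · refine Eventually.of_forall fun p => ?_
    rw [norm_mul, norm_mul, norm_mul, norm_chr, one_mul]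
    gcongr
    exact hc _ _

/-- Fubini puts the y-integral inside, so that one can work at a frozen frequency ξ. The maps u, w
cover two uses: integration by parts (y - z and y) and smoothing of the symbol in x (constant and x
- v). -/
theorem IsSymbol.integral_mul_symbolKernel {m : ℝ} {a : Rd d → Rd d → ℂ} (ha : IsSymbol 1 1 m a)
    (k : ℕ) {g : Rd d → ℂ} (hgi : Integrable g) (hgc : Continuous g) {u w : Rd d → Rd d}
    (hu : Continuous u) (hw : Continuous w) :
    ∫ y, g y * symbolKernel a k (w y) (u y) =
      ∫ ξ, cutoff k ξ * ∫ y, g y * (a (w y) ξ * chr (u y) ξ) := by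
  calc _ = ∫ y, ∫ ξ, g y * (chr (u y) ξ * (cutoff k ξ * a (w y) ξ)) := by
        simp_rw [symbolKernel, integral_const_mul]
    _ = ∫ ξ, ∫ y, g y * (chr (u y) ξ * (cutoff k ξ * a (w y) ξ)) :=
        integral_integral_swap (ha.integrable_prod k hgi hgc hu hw)
    _ = _ := by
        refine integral_congr_ae (Eventually.of_forall fun ξ => ?_)
        simp only
        rw [← integral_const_mul]
        refine integral_congr_ae (Eventually.of_forall fun y => ?_)
        simp only
        ring

theorem fderiv_mul_chr {a : Rd d → Rd d → ℂ}
    (ha : ContDiff ℝ ∞ fun p : Rd d × Rd d => a p.1 p.2) (z ξ y v : Rd d) :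
    fderiv ℝ (fun y => a y ξ * chr (y - z) ξ) y v = conjDeriv v a y ξ * chr (y - z) ξ := by
  have h1 : DifferentiableAt ℝ (fun y => a y ξ) y :=
    (ha.comp (contDiff_prodMk_left ξ)).differentiable (by simp) y
  have h2 : HasFDerivAt (fun y => chr (y - z) ξ) (chr (y - z) ξ • ((2 * Real.pi * Complex.I : ℂ) •
      (Complex.ofRealCLM.comp (innerSL ℝ ξ)))) y := by
    have h3 : HasFDerivAt (fun y : Rd d => (2 * Real.pi * Complex.I * (inner ℝ (y - z) ξ : ℝ) : ℂ))
        ((2 * Real.pi * Complex.I : ℂ) • (Complex.ofRealCLM.comp (innerSL ℝ ξ))) y := by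
      refine HasFDerivAt.const_mul ?_ _
      have h4 : HasFDerivAt (fun y : Rd d => innerSL ℝ ξ (y - z)) (innerSL ℝ ξ) y := by
        have := (innerSL ℝ ξ).hasFDerivAt.comp y ((hasFDerivAt_id y).sub_const z)
        exact this
      have h5 := Complex.ofRealCLM.hasFDerivAt.comp y h4
      refine h5.congr_of_eventuallyEq (Eventually.of_forall fun y => ?_)
      simp [real_inner_comm]
    exact h3.cexp
  rw [HasFDerivAt.fderiv (f := fun y => a y ξ * chr (y - z) ξ) (h1.hasFDerivAt.mul h2), conjDeriv]
  simp only [add_apply, smul_apply, smul_eq_mul,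
    ContinuousLinearMap.comp_apply, innerSL_apply_apply, Complex.ofRealCLM_apply]
  rw [real_inner_comm ξ v]
  ring

theorem fderiv_comp_const_sub_apply (S : 𝓢(Rd d, ℂ)) (x y v : Rd d) :
    fderiv ℝ (fun y => S (x - y)) y v = -fderiv ℝ S (x - y) v := by
  have h1 : HasFDerivAt (fun y : Rd d => x - y) (-ContinuousLinearMap.id ℝ (Rd d)) y :=
    (hasFDerivAt_id y).const_sub x
  have h2 : HasFDerivAt S (fderiv ℝ S (x - y)) (x - y) := S.differentiableAt.hasFDerivAt
  have h3 : HasFDerivAt (fun y => S (x - y))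
      ((fderiv ℝ S (x - y)).comp (-ContinuousLinearMap.id ℝ (Rd d))) y := h2.comp y h1
  rw [h3.fderiv]
  simp

theorem IsSymbol.integrable_mul_chr {m : ℝ} {a : Rd d → Rd d → ℂ} (ha : IsSymbol 1 1 m a)
    (z ξ : Rd d) {g : Rd d → ℂ} (hg : Integrable g) :
    Integrable fun y => g y * (a y ξ * chr (y - z) ξ) := by
  have hu : Continuous fun y : Rd d => y - z := continuous_id.sub continuous_const
  obtain ⟨c, hc0, hc⟩ := ha.norm_le
  refine Integrable.mul_bdd (c := c * (1 + ‖ξ‖) ^ m) hg ?_ (Eventually.of_forall fun y => ?_)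
  · exact ((ha.smooth.continuous.comp (Continuous.prodMk_left ξ)).mul
      (continuous_chr.comp (hu.prodMk continuous_const))).aestronglyMeasurable
  · rw [norm_mul, norm_chr, mul_one]
    exact hc y ξ

open LineDeriv in
-- Integration by parts at fixed ξ. The sign it produces cancels the one from the reflection y ↦ x -
-- y, and the boundary terms vanish because S and its derivatives are integrable while a and its
-- conjugated derivative are bounded in y.
theorem IsSymbol.integral_fderiv_mul_chr {m : ℝ} {a : Rd d → Rd d → ℂ}
    (ha : IsSymbol 1 1 m a) (S : 𝓢(Rd d, ℂ)) (v x z ξ : Rd d) :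
    ∫ y, fderiv ℝ S (x - y) v * (a y ξ * chr (y - z) ξ) =
      ∫ y, S (x - y) * (conjDeriv v a y ξ * chr (y - z) ξ) := by
  have hES : Differentiable ℝ fun y => a y ξ * chr (y - z) ξ :=
    ((ha.smooth.comp (contDiff_prodMk_left ξ)).mul (contDiff_chr.comp
      ((contDiff_id.sub contDiff_const).prodMk contDiff_const))).differentiable (by simp)
  have hSd : Differentiable ℝ fun y => S (x - y) := by
    have h1 : Differentiable ℝ fun y : Rd d => x - y := differentiable_id.const_sub x
    have h2 : Differentiable ℝ (S : Rd d → ℂ) := (S.smooth 1).differentiable (by simp)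
    exact h2.comp h1
  have hSi : Integrable fun y => fderiv ℝ S (x - y) v := by
    have := integrable_comp_sub_left (∂_{v} S) x
    simpa [SchwartzMap.lineDerivOp_apply_eq_fderiv] using this
  have key := integral_mul_fderiv_eq_neg_fderiv_mul_of_integrable (μ := (volume : Measure (Rd d)))
    (f := fun y => S (x - y)) (g := fun y => a y ξ * chr (y - z) ξ) (v := v)
    (by
      simp_rw [fderiv_comp_const_sub_apply, neg_mul]
      exact (ha.integrable_mul_chr z ξ hSi).neg)
    (by
      simp_rw [fderiv_mul_chr ha.smooth]
      exact (ha.isSymbol_conjDeriv v).integrable_mul_chr z ξ (integrable_comp_sub_left S x))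
    (ha.integrable_mul_chr z ξ (integrable_comp_sub_left S x)) (fun y _ => hSd y)
    (fun y _ => hES y)
  simp_rw [fderiv_mul_chr ha.smooth, fderiv_comp_const_sub_apply] at key
  rw [key, ← integral_neg]
  simp_rw [neg_mul, neg_neg]

open LineDeriv in
theorem IsSymbol.integral_dilate_lineDeriv_mul {m : ℝ} {a : Rd d → Rd d → ℂ}
    (ha : IsSymbol 1 1 m a) (σ : 𝓢(Rd d, ℂ)) (v : Rd d) (l : ℤ) (k : ℕ) (x z : Rd d) :
    ∫ y, dilate (∂_{v} σ) l (x - y) * symbolKernel a k y (y - z) =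
      ((2 : ℂ) ^ l)⁻¹ * ∫ y, dilate σ l (x - y) * symbolKernel (conjDeriv v a) k y (y - z) := by
  have hu : Continuous fun y : Rd d => y - z := continuous_id.sub continuous_const
  have hid : Continuous fun y : Rd d => y := continuous_id
  have hcs : Continuous fun y : Rd d => x - y := continuous_const.sub continuous_id
  have h1 : Continuous fun y => dilate (∂_{v} σ) l (x - y) :=
    (SchwartzMap.continuous _).comp hcs
  have h2 : Continuous fun y => dilate σ l (x - y) := (SchwartzMap.continuous _).comp hcs
  rw [ha.integral_mul_symbolKernel k (integrable_comp_sub_left _ x) h1 hu hid,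
    (ha.isSymbol_conjDeriv v).integral_mul_symbolKernel k (integrable_comp_sub_left _ x)
    h2 hu hid, ← integral_const_mul]
  refine integral_congr_ae (Eventually.of_forall fun ξ => ?_)
  simp only
  rw [mul_left_comm, ← ha.integral_fderiv_mul_chr]
  simp_rw [dilate_lineDeriv, mul_assoc, integral_const_mul]

theorem IsSymbol.enorm_symbolKernel_le {m : ℝ} {a : Rd d → Rd d → ℂ} (ha : IsSymbol 1 1 m a)
    (n : ℕ) : ∃ C : ℝ≥0∞, C < ⊤ ∧ ∀ (k : ℕ) (x y : Rd d),
      ‖symbolKernel a k x y‖ₑ ≤ C * 2 ^ ((k : ℝ) * m) * ENNReal.ofReal (wt k n y) := by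
  obtain ⟨C, hC0, hC⟩ := ha.norm_symbolKernel_le n
  refine ⟨ENNReal.ofReal C, ENNReal.ofReal_lt_top, fun k x y => ?_⟩
  rw [two_rpow_eq_ofReal, ← ENNReal.ofReal_mul hC0, ← ENNReal.ofReal_mul (by positivity),
    ← ofReal_norm]
  exact ENNReal.ofReal_le_ofReal (hC k x y)

theorem enorm_dilate_le (ρ : 𝓢(Rd d, ℂ)) (n : ℕ) : ∃ C : ℝ≥0∞, C < ⊤ ∧ ∀ (l : ℕ) (y : Rd d),
    ‖dilate ρ l y‖ₑ ≤ C * ENNReal.ofReal (wt l n y) := by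
  obtain ⟨C, hC0, hC⟩ := norm_dilate_le ρ n
  refine ⟨ENNReal.ofReal C, ENNReal.ofReal_lt_top, fun l y => ?_⟩
  rw [← ENNReal.ofReal_mul hC0, ← ofReal_norm]
  exact ENNReal.ofReal_le_ofReal (hC l y)

/-- The estimate without cancellation, from the two decay bounds alone. Decay of order n + (d + 1)
is spent so that order n survives the convolution of the weights. -/
theorem IsSymbol.lintegral_dilate_mul_symbolKernel_le {m : ℝ} {a : Rd d → Rd d → ℂ}
    (ha : IsSymbol 1 1 m a) (ρ : 𝓢(Rd d, ℂ)) (n : ℕ) : ∃ C : ℝ≥0∞, C < ⊤ ∧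
      ∀ (l k : ℕ) (x z : Rd d), ∫⁻ y, ‖dilate ρ l (x - y)‖ₑ * ‖symbolKernel a k y (y - z)‖ₑ ≤
        C * 2 ^ ((k : ℝ) * m) * ENNReal.ofReal (wt (min l k) n (x - z)) := by
  obtain ⟨C₁, hC₁, h₁⟩ := enorm_dilate_le ρ (n + (d + 1))
  obtain ⟨C₂, hC₂, h₂⟩ := ha.enorm_symbolKernel_le (n + (d + 1))
  refine ⟨C₁ * C₂ * wtMass d (d + 1), ENNReal.mul_lt_top (ENNReal.mul_lt_top hC₁ hC₂)
    (wtMass_lt_top (by linarith)), fun l k x z => ?_⟩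
  calc _ ≤ ∫⁻ y, (C₁ * C₂ * 2 ^ ((k : ℝ) * m)) *
        (ENNReal.ofReal (wt l (n + (d + 1) : ℕ) (x - y)) *
          ENNReal.ofReal (wt k (n + (d + 1) : ℕ) (y - z))) := by
        refine lintegral_mono fun y => ?_
        refine (mul_le_mul' (h₁ l (x - y)) (h₂ k y (y - z))).trans (le_of_eq ?_)
        ring
    _ = (C₁ * C₂ * 2 ^ ((k : ℝ) * m)) * ∫⁻ y, (ENNReal.ofReal (wt l (n + (d + 1) : ℕ) (x - y)) *
          ENNReal.ofReal (wt k (n + (d + 1) : ℕ) (y - z))) := by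
        refine lintegral_const_mul' _ _ ?_
        exact ENNReal.mul_ne_top (ENNReal.mul_ne_top hC₁.ne hC₂.ne) (two_rpow_ne_top _)
    _ ≤ (C₁ * C₂ * 2 ^ ((k : ℝ) * m)) * (wtMass d ((n + (d + 1) : ℕ) - n) *
          ENNReal.ofReal (wt (min l k) n (x - z))) := by
        gcongr
        exact lintegral_wt_mul_wt_le_min l k (Nat.cast_nonneg n) (by push_cast; linarith) x z
    _ = _ := by
        have : ((n + (d + 1) : ℕ) : ℝ) - n = d + 1 := by push_cast; ring
        rw [this]
        ring

open LineDeriv in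
-- Induction over all symbols and all annular functions at once, since one integration by parts
-- replaces (a, ρ) by the pairs (`conjDeriv (e i) a`, σ_i). The increased order contributes 2^k and
-- the dilation 2^{-l}.
theorem IsSymbol.enorm_integral_dilate_mul_le (n L : ℕ) : ∀ {m : ℝ} {a : Rd d → Rd d → ℂ},
    IsSymbol 1 1 m a → ∀ {ρ : 𝓢(Rd d, ℂ)}, IsAnnular ρ → ∃ C : ℝ≥0∞, C < ⊤ ∧
      ∀ (l k : ℕ) (x z : Rd d),
        ‖∫ y, dilate ρ l (x - y) * symbolKernel a k y (y - z)‖ₑ ≤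
        C * 2 ^ ((k : ℝ) * m + ((k : ℝ) - l) * L) * ENNReal.ofReal (wt (min l k) n (x - z)) := by
  induction L with
  | zero =>
    intro m a ha ρ _
    obtain ⟨C, hC, h⟩ := ha.lintegral_dilate_mul_symbolKernel_le ρ n
    refine ⟨C, hC, fun l k x z => ?_⟩
    refine (enorm_integral_le_lintegral_enorm _).trans ?_
    simp only [enorm_mul, CharP.cast_eq_zero, mul_zero, add_zero]
    exact h l k x z
  | succ L ih =>
    intro m a ha ρ hρ
    obtain ⟨σ, hσ, hρσ⟩ := hρ.eq_sum_lineDeriv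
    set e : Fin d → Rd d := fun i => EuclideanSpace.single i (1 : ℝ) with he
    choose C hC h using fun i => ih (ha.isSymbol_conjDeriv (e i)) (hσ i)
    refine ⟨∑ i, C i, ENNReal.sum_lt_top.2 fun i _ => hC i, fun l k x z => ?_⟩
    have hK := continuous_symbolKernel ha.smooth.continuous k
    have hsum : ∫ y, dilate ρ l (x - y) * symbolKernel a k y (y - z) =
        ∑ i, ∫ y, dilate (∂_{e i} (σ i)) l (x - y) * symbolKernel a k y (y - z) := by
      rw [← integral_finsetSum]
      · refine integral_congr_ae (Eventually.of_forall fun y => ?_)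
        simp only
        rw [← Finset.sum_mul]
        congr 1
        simp only [dilate_apply]
        rw [← Finset.mul_sum, hρσ]
        congr 1
        simp [he]
      · intro i _
        obtain ⟨c, hc0, hc⟩ := ha.norm_symbolKernel_le 0
        refine Integrable.mul_bdd (c := c * 2 ^ ((k : ℝ) * m) * 2 ^ (k * d))
          (integrable_comp_sub_left _ x) ?_ (Eventually.of_forall fun y => ?_)
        · exact (hK.comp (continuous_id.prodMk (continuous_id.sub
            continuous_const))).aestronglyMeasurable
        · refine (hc k y (y - z)).trans (le_of_eq ?_)
          simp [wt]
    rw [hsum, Finset.sum_mul, Finset.sum_mul]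
    refine (enorm_sum_le _ _).trans (Finset.sum_le_sum fun i _ => ?_)
    rw [ha.integral_dilate_lineDeriv_mul, enorm_mul]
    have h2 : ‖((2 : ℂ) ^ (l : ℤ))⁻¹‖ₑ = 2 ^ (-(l : ℝ)) := by
      rw [← ofReal_norm, norm_inv, norm_zpow, RCLike.norm_ofNat, zpow_natCast,
        two_rpow_eq_ofReal, Real.rpow_neg two_pos.le, Real.rpow_natCast]
    rw [h2]
    calc _ ≤ 2 ^ (-(l : ℝ)) * (C i * 2 ^ ((k : ℝ) * (m + 1) + ((k : ℝ) - l) * L) *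
          ENNReal.ofReal (wt (min l k) n (x - z))) := by
          gcongr
          exact h i l k x z
      _ = C i * (2 ^ (-(l : ℝ)) * 2 ^ ((k : ℝ) * (m + 1) + ((k : ℝ) - l) * L)) *
          ENNReal.ofReal (wt (min l k) n (x - z)) := by ring
      _ = _ := by
          rw [← two_rpow_add]
          congr 3
          push_cast
          ring

/-- Off-diagonal decay of the kernel of `Π_l T_k`. -/
theorem IsSymbol.enorm_integral_dilate_mul_le_max {m : ℝ} {a : Rd d → Rd d → ℂ}
    (ha : IsSymbol 1 1 m a) {ρ : 𝓢(Rd d, ℂ)} (hρ : IsAnnular ρ) (n L : ℕ) :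
    ∃ C : ℝ≥0∞, C < ⊤ ∧ ∀ (l k : ℕ) (x z : Rd d),
      ‖∫ y, dilate ρ l (x - y) * symbolKernel a k y (y - z)‖ₑ ≤
        C * 2 ^ ((k : ℝ) * m - L * max ((l : ℝ) - k) 0) *
          ENNReal.ofReal (wt (min l k) n (x - z)) := by
  obtain ⟨C₀, hC₀, h₀⟩ := IsSymbol.enorm_integral_dilate_mul_le n 0 ha hρ
  obtain ⟨C₁, hC₁, h₁⟩ := IsSymbol.enorm_integral_dilate_mul_le n L ha hρ
  refine ⟨C₀ + C₁, ENNReal.add_lt_top.2 ⟨hC₀, hC₁⟩, fun l k x z => ?_⟩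
  rcases le_total (l : ℝ) k with hlk | hlk
  · refine (h₀ l k x z).trans ?_
    rw [max_eq_right (sub_nonpos.2 hlk)]
    simp only [CharP.cast_eq_zero, mul_zero, add_zero, sub_zero]
    gcongr
    exact le_self_add
  · refine (h₁ l k x z).trans ?_
    rw [max_eq_left (sub_nonneg.2 hlk), show (k : ℝ) * m + ((k : ℝ) - l) * L =
      (k : ℝ) * m - L * ((l : ℝ) - k) by ring]
    gcongr
    exact le_add_self

/-! ### Convolution of a tempered distribution with a Schwartz function -/

theorem hasFDerivAt_integral_of_contDiff {V : Type} [NormedAddCommGroup V] [NormedSpace ℝ V]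
    {H : Rd d → Rd d → V} (hH : ContDiff ℝ ∞ fun p : Rd d × Rd d => H p.2 p.1)
    {b₀ b : Rd d → ℝ} (hb₀i : Integrable b₀) (hb₀ : ∀ z ξ, ‖H z ξ‖ ≤ b₀ z) (hbi : Integrable b)
    (hb : ∀ z ξ, ‖fderiv ℝ (H z) ξ‖ ≤ b z) (ξ : Rd d) :
    HasFDerivAt (fun ξ => ∫ z, H z ξ) (∫ z, fderiv ℝ (H z) ξ) ξ := by
  have hmeas : ∀ ξ, AEStronglyMeasurable (fun z => H z ξ) volume := fun ξ =>
    (hH.continuous.comp (Continuous.prodMk_right ξ)).aestronglyMeasurable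
  have hfd : ContDiff ℝ ∞ fun p : Rd d × Rd d => fderiv ℝ (H p.2) p.1 :=
    ContDiff.fderiv (f := fun (p : Rd d × Rd d) y => H p.2 y)
      (hH.comp (contDiff_snd.prodMk (contDiff_snd.comp contDiff_fst))) contDiff_fst (by simp)
  refine hasFDerivAt_integral_of_dominated_of_fderiv_le (𝕜 := ℝ) (bound := b)
    (F := fun ξ z => H z ξ) (F' := fun ξ z => fderiv ℝ (H z) ξ) univ_mem
    (Eventually.of_forall hmeas) ?_ ?_ ?_ hbi ?_
  · exact hb₀i.mono' (hmeas ξ) (Eventually.of_forall fun z => hb₀ z ξ)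
  · exact (hfd.continuous.comp (Continuous.prodMk_right ξ)).aestronglyMeasurable
  · exact Eventually.of_forall fun z ξ _ => hb z ξ
  · refine Eventually.of_forall fun z ξ _ => ?_
    have : ContDiff ℝ ∞ (H z) := hH.comp (contDiff_prodMk_left z)
    exact (this.differentiable (by simp) ξ).hasFDerivAt

theorem iteratedFDeriv_integral {V : Type} [NormedAddCommGroup V] [NormedSpace ℝ V]
    [CompleteSpace V] {G : Rd d → Rd d → V}
    (hG : ContDiff ℝ ∞ fun p : Rd d × Rd d => G p.1 p.2)
    (hb : ∀ i : ℕ, ∃ b : Rd d → ℝ, Integrable b ∧ ∀ z ξ, ‖iteratedFDeriv ℝ i (G z) ξ‖ ≤ b z)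
    (n : ℕ) : (iteratedFDeriv ℝ n fun ξ => ∫ z, G z ξ) =
      fun ξ => ∫ z, iteratedFDeriv ℝ n (G z) ξ := by
  have hsm : ∀ n : ℕ, ContDiff ℝ ∞ fun p : Rd d × Rd d => iteratedFDeriv ℝ n (G p.2) p.1 :=
    fun n => contDiff_iteratedFDeriv_left (a := fun ξ z => G z ξ)
      (hG.comp (contDiff_snd.prodMk contDiff_fst)) n
  induction n with
  | zero =>
    funext ξ
    rw [iteratedFDeriv_zero_eq_comp]
    simp only [Function.comp_apply]
    exact ((continuousMultilinearCurryFin0 ℝ (Rd d)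
      V).symm.toContinuousLinearEquiv.integral_comp_comm fun z => G z ξ).symm
  | succ n ih =>
    funext ξ
    obtain ⟨b₀, hb₀i, hb₀⟩ := hb n
    obtain ⟨b, hbi, hbd⟩ := hb (n + 1)
    have key := hasFDerivAt_integral_of_contDiff (hsm n) hb₀i hb₀ hbi
      (fun z ξ => by rw [norm_fderiv_iteratedFDeriv]; exact hbd z ξ) ξ
    rw [iteratedFDeriv_succ_eq_comp_left, Function.comp_apply, ih, key.fderiv]
    exact (ContinuousLinearEquiv.integral_comp_comm (𝕜 := ℝ)
      (E := Rd d →L[ℝ] ContinuousMultilinearMap ℝ (fun _ : Fin n => Rd d) V)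
      (F := ContinuousMultilinearMap ℝ (fun _ : Fin (n + 1) => Rd d) V)
      ((continuousMultilinearCurryLeftEquiv ℝ (fun _ : Fin (n + 1) => Rd d)
      V).symm.toContinuousLinearEquiv) fun z => fderiv ℝ (iteratedFDeriv ℝ n (G z)) ξ).symm

/-- Bounded continuous functions with values in the `n`-linear forms. -/
def DerivSpace (d n : ℕ) : Type :=
  BoundedContinuousFunction (Rd d) (ContinuousMultilinearMap ℝ (fun _ : Fin n => Rd d) ℂ)

namespace DerivSpace

instance (n : ℕ) : NormedAddCommGroup (DerivSpace d n) :=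
  inferInstanceAs (NormedAddCommGroup (BoundedContinuousFunction (Rd d)
    (ContinuousMultilinearMap ℝ (fun _ : Fin n => Rd d) ℂ)))

instance (n : ℕ) : NormedSpace ℂ (DerivSpace d n) :=
  inferInstanceAs (NormedSpace ℂ (BoundedContinuousFunction (Rd d)
    (ContinuousMultilinearMap ℝ (fun _ : Fin n => Rd d) ℂ)))

instance (n : ℕ) : CompleteSpace (DerivSpace d n) :=
  inferInstanceAs (CompleteSpace (BoundedContinuousFunction (Rd d)
    (ContinuousMultilinearMap ℝ (fun _ : Fin n => Rd d) ℂ)))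

/-- Evaluation at a point. -/
def eval {n : ℕ} (x : Rd d) :
    DerivSpace d n →L[ℂ] ContinuousMultilinearMap ℝ (fun _ : Fin n => Rd d) ℂ :=
  BoundedContinuousFunction.evalCLM ℂ x

theorem ext_eval {n : ℕ} {u v : DerivSpace d n} (h : ∀ x, eval x u = eval x v) : u = v :=
  BoundedContinuousFunction.ext h

theorem norm_le {n : ℕ} {u : DerivSpace d n} {C : ℝ} (hC : 0 ≤ C) :
    ‖u‖ ≤ C ↔ ∀ x, ‖eval x u‖ ≤ C :=
  BoundedContinuousFunction.norm_le hC

end DerivSpace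

/-- The weighted derivative `x ↦ ‖x‖^k D^n ψ(x)` of a Schwartz function. -/
def weightedDeriv (p : ℕ × ℕ) : 𝓢(Rd d, ℂ) →ₗ[ℂ] DerivSpace d p.2 where
  toFun ψ := BoundedContinuousFunction.ofNormedAddCommGroup
    (fun x => ‖x‖ ^ p.1 • iteratedFDeriv ℝ p.2 ψ x)
    ((continuous_norm.pow _).smul ((ψ.smooth ⊤).continuous_iteratedFDeriv (natCast_le_infty _)))
    (SchwartzMap.seminorm ℂ p.1 p.2 ψ) (fun x => by
      rw [norm_smul, norm_pow, norm_norm]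
      exact SchwartzMap.le_seminorm ℂ p.1 p.2 ψ x)
  map_add' ψ₁ ψ₂ := by
    refine DerivSpace.ext_eval fun x => ?_
    have h1 : ContDiffAt ℝ p.2 ψ₁ x := (ψ₁.smooth p.2).contDiffAt
    have h2 : ContDiffAt ℝ p.2 ψ₂ x := (ψ₂.smooth p.2).contDiffAt
    change ‖x‖ ^ p.1 • iteratedFDeriv ℝ p.2 (⇑ψ₁ + ⇑ψ₂) x = ‖x‖ ^ p.1 • iteratedFDeriv ℝ p.2 ψ₁ x +
      ‖x‖ ^ p.1 • iteratedFDeriv ℝ p.2 ψ₂ x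
    rw [← smul_add, ← iteratedFDeriv_add_apply h1 h2]
  map_smul' c ψ := by
    refine DerivSpace.ext_eval fun x => ?_
    have h1 : ContDiffAt ℝ p.2 ψ x := (ψ.smooth p.2).contDiffAt
    change ‖x‖ ^ p.1 • iteratedFDeriv ℝ p.2 (c • ⇑ψ) x =
      c • (‖x‖ ^ p.1 • iteratedFDeriv ℝ p.2 ψ x)
    rw [smul_comm, ← iteratedFDeriv_const_smul_apply h1]

theorem eval_weightedDeriv (p : ℕ × ℕ) (ψ : 𝓢(Rd d, ℂ)) (x : Rd d) :
    DerivSpace.eval x (weightedDeriv p ψ) = ‖x‖ ^ p.1 • iteratedFDeriv ℝ p.2 ψ x := rfl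

theorem seminorm_le_norm_weightedDeriv (p : ℕ × ℕ) (ψ : 𝓢(Rd d, ℂ)) :
    SchwartzMap.seminorm ℂ p.1 p.2 ψ ≤ ‖weightedDeriv p ψ‖ := by
  refine SchwartzMap.seminorm_le_bound ℂ p.1 p.2 ψ (norm_nonneg _) fun x => ?_
  have := (DerivSpace.norm_le (norm_nonneg (weightedDeriv p ψ))).1 le_rfl x
  rwa [eval_weightedDeriv, norm_smul, norm_pow, norm_norm] at this

/-- The translate `y ↦ h(y - z)`. -/
abbrev translate (h : 𝓢(Rd d, ℂ)) (z : Rd d) : 𝓢(Rd d, ℂ) := SchwartzMap.compSubConstCLM ℂ z h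

theorem iteratedFDeriv_translate (h : 𝓢(Rd d, ℂ)) (z y : Rd d) (n : ℕ) :
    iteratedFDeriv ℝ n (translate h z) y = iteratedFDeriv ℝ n h (y - z) := by
  rw [← iteratedFDeriv_comp_sub]
  rfl

theorem norm_pow_mul_iteratedFDeriv_sub_le (h : 𝓢(Rd d, ℂ)) (k n : ℕ) : ∃ C : ℝ, 0 ≤ C ∧
    ∀ y z, ‖y‖ ^ k * ‖iteratedFDeriv ℝ n h (y - z)‖ ≤ C * (1 + ‖z‖) ^ k := by
  have hb := fun w => SchwartzMap.one_add_le_sup_seminorm_apply (𝕜 := ℝ) (m := (k, n)) le_rfl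
    le_rfl h w
  set C : ℝ := 2 ^ (k, n).1 * (Finset.Iic (k, n)).sup
    (fun m : ℕ × ℕ => SchwartzMap.seminorm ℝ m.1 m.2) h with hC
  refine ⟨C, by positivity, fun y z => ?_⟩
  have h1 : ‖y‖ ≤ (1 + ‖z‖) * (1 + ‖y - z‖) := by
    have := norm_le_norm_add_norm_sub' y z
    nlinarith [norm_nonneg z, norm_nonneg (y - z)]
  calc _ ≤ ((1 + ‖z‖) * (1 + ‖y - z‖)) ^ k * ‖iteratedFDeriv ℝ n h (y - z)‖ := by gcongr
    _ = (1 + ‖y - z‖) ^ k * ‖iteratedFDeriv ℝ n h (y - z)‖ * (1 + ‖z‖) ^ k := by rw [mul_pow]; ring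
    _ ≤ _ := by gcongr; exact hb (y - z)

theorem norm_weightedDeriv_translate_le (h : 𝓢(Rd d, ℂ)) (p : ℕ × ℕ) : ∃ C : ℝ, 0 ≤ C ∧
    ∀ z, ‖weightedDeriv p (translate h z)‖ ≤ C * (1 + ‖z‖) ^ p.1 := by
  obtain ⟨C, hC0, hC⟩ := norm_pow_mul_iteratedFDeriv_sub_le h p.1 p.2
  refine ⟨C, hC0, fun z => ?_⟩
  refine (DerivSpace.norm_le (by positivity)).2 fun y => ?_
  rw [eval_weightedDeriv, norm_smul, norm_pow, norm_norm, iteratedFDeriv_translate]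
  exact hC y z

/-- Mean value inequality on the unit ball around z₀: the derivative in z costs one more derivative
of h, and its weighted norm grows only polynomially in z. -/
theorem continuous_weightedDeriv_translate (h : 𝓢(Rd d, ℂ)) (p : ℕ × ℕ) :
    Continuous fun z => weightedDeriv p (translate h z) := by
  obtain ⟨C, hC0, hC⟩ := norm_pow_mul_iteratedFDeriv_sub_le h p.1 (p.2 + 1)
  rw [continuous_iff_continuousAt]
  intro z₀
  set K : ℝ := C * (1 + (‖z₀‖ + 1)) ^ p.1 with hK
  have hK0 : 0 ≤ K := by positivity
  have hbd : ∀ z ∈ Metric.ball z₀ 1, ‖weightedDeriv p (translate h z) -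
      weightedDeriv p (translate h z₀)‖ ≤ K * ‖z - z₀‖ := by
    intro z hz
    refine (DerivSpace.norm_le (by positivity)).2 fun y => ?_
    rw [map_sub, eval_weightedDeriv, eval_weightedDeriv,
      iteratedFDeriv_translate, iteratedFDeriv_translate]
    have hd : ∀ w, HasFDerivAt (fun w => ‖y‖ ^ p.1 • iteratedFDeriv ℝ p.2 h (y - w))
        (‖y‖ ^ p.1 • (fderiv ℝ (iteratedFDeriv ℝ p.2 h) (y - w)).comp
          (-ContinuousLinearMap.id ℝ (Rd d))) w := by
      intro w
      have h1 : HasFDerivAt (fun w : Rd d => y - w) (-ContinuousLinearMap.id ℝ (Rd d)) w :=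
        (hasFDerivAt_id w).const_sub y
      have h2 : HasFDerivAt (iteratedFDeriv ℝ p.2 h) (fderiv ℝ (iteratedFDeriv ℝ p.2 h) (y - w))
          (y - w) := ((h.smooth ⊤).differentiable_iteratedFDeriv
            (by exact_mod_cast WithTop.coe_lt_coe.2 (ENat.natCast_lt_top p.2)) (y - w)).hasFDerivAt
      exact (h2.comp w h1).const_smul (‖y‖ ^ p.1)
    refine (convex_ball z₀ 1).norm_image_sub_le_of_norm_hasFDerivWithin_le
      (fun w _ => (hd w).hasFDerivWithinAt) (fun w hw => ?_) (Metric.mem_ball_self one_pos) hz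
    have hw' : ‖w‖ ≤ ‖z₀‖ + 1 := by
      rw [Metric.mem_ball, dist_eq_norm] at hw
      have := norm_sub_norm_le w z₀
      linarith
    calc _ ≤ ‖y‖ ^ p.1 * ‖iteratedFDeriv ℝ (p.2 + 1) h (y - w)‖ := by
          rw [norm_smul, norm_pow, norm_norm, ContinuousLinearMap.comp_neg,
            ContinuousLinearMap.comp_id, norm_neg, norm_fderiv_iteratedFDeriv]
      _ ≤ C * (1 + ‖w‖) ^ p.1 := hC y w
      _ ≤ K := by rw [hK]; gcongr
  have hlim : Tendsto (fun z => K * ‖z - z₀‖) (𝓝 z₀) (𝓝 0) := by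
    have : Continuous fun z => K * ‖z - z₀‖ := by fun_prop
    simpa using this.tendsto z₀
  rw [ContinuousAt, tendsto_iff_norm_sub_tendsto_zero]
  refine squeeze_zero' (Eventually.of_forall fun _ => norm_nonneg _) ?_ hlim
  filter_upwards [Metric.ball_mem_nhds z₀ one_pos] with z hz using hbd z hz

/-- A tempered distribution is a continuous functional of finitely many weighted derivatives. -/
theorem exists_clm_weightedDeriv (f : 𝓢'(Rd d, ℂ)) : ∃ (s : Finset (ℕ × ℕ))
    (Λ : (∀ p : s, DerivSpace d p.1.2) →L[ℂ] ℂ), ∀ ψ, f ψ = Λ fun p => weightedDeriv p.1 ψ := by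
  have hcont : Continuous fun ψ => f ψ := f.continuous
  set q : Seminorm ℂ 𝓢(Rd d, ℂ) := (normSeminorm ℂ ℂ).comp f.toLinearMap with hq
  have hqc : Continuous q := hcont.norm
  obtain ⟨s₀, C, -, hC⟩ := Seminorm.bound_of_continuous
    (schwartz_withSeminorms ℂ (Rd d) ℂ) q hqc
  -- Including the sup norm makes J injective, so that f defines a functional on the range of J.
  set s := insert (0, 0) s₀ with hs
  set J : 𝓢(Rd d, ℂ) →ₗ[ℂ] (∀ p : s, DerivSpace d p.1.2) :=
    LinearMap.pi fun p : s => weightedDeriv p.1 with hJ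
  have hJle : ∀ p ∈ s, ∀ ψ, SchwartzMap.seminorm ℂ p.1 p.2 ψ ≤ ‖J ψ‖ := fun p hp ψ =>
    (seminorm_le_norm_weightedDeriv p ψ).trans (norm_le_pi_norm (J ψ) ⟨p, hp⟩)
  have hinj : Function.Injective J := by
    rw [injective_iff_map_eq_zero]
    intro ψ hψ
    ext x
    have h1 := SchwartzMap.norm_le_seminorm ℂ ψ x
    have h2 := hJle (0, 0) (Finset.mem_insert_self _ _) ψ
    rw [hψ, norm_zero] at h2
    simpa using h1.trans h2
  have hbound : ∀ ψ, ‖f ψ‖ ≤ C * ‖J ψ‖ := by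
    intro ψ
    refine (hC ψ).trans ?_
    rw [smul_apply, NNReal.smul_def, smul_eq_mul]
    gcongr
    refine Seminorm.finset_sup_apply_le (norm_nonneg _) fun p hp => ?_
    exact hJle p (Finset.mem_insert_of_mem hp) ψ
  set e := LinearEquiv.ofInjective J hinj with he
  set Λ₀ : StrongDual ℂ J.range := LinearMap.mkContinuous
    (f.toLinearMap ∘ₗ (e.symm : J.range →ₗ[ℂ] 𝓢(Rd d, ℂ))) C (fun y => by
      obtain ⟨ψ, rfl⟩ := e.surjective y
      rw [LinearMap.comp_apply, LinearEquiv.coe_coe, LinearEquiv.symm_apply_apply]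
      exact hbound ψ) with hΛ₀
  -- Hahn–Banach: on the range f ∘ J⁻¹ is bounded, as f is dominated by finitely many seminorms. The
  -- extension lives on a Banach space and thus commutes with Bochner integrals.
  obtain ⟨Λ, hΛ, -⟩ := exists_extension_norm_eq J.range Λ₀
  refine ⟨s, Λ, fun ψ => ?_⟩
  have := hΛ (e ψ)
  rw [hΛ₀, LinearMap.mkContinuous_apply] at this
  simp only [LinearMap.comp_apply, LinearEquiv.coe_coe, LinearEquiv.symm_apply_apply] at this
  exact this.symm

theorem integrable_mul_one_add_norm_pow (G : 𝓢(Rd d, ℂ)) (C : ℝ) (k : ℕ) :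
    Integrable fun z => ‖G z‖ * (C * (1 + ‖z‖) ^ k) := by
  obtain ⟨c, hc0, hc⟩ := norm_dilate_le G (k + (d + 1))
  have hi : Integrable fun z : Rd d => (1 + ‖z‖) ^ (-((d : ℝ) + 1)) := by
    refine integrable_one_add_norm ?_
    simp
  have hcont : Continuous fun z => ‖G z‖ * (C * (1 + ‖z‖) ^ k) :=
    G.continuous.norm.mul (by fun_prop)
  refine (hi.const_mul (c * |C|)).mono' hcont.aestronglyMeasurable
    (Eventually.of_forall fun z => ?_)
  have h := hc 0 z
  have h1 : 0 < 1 + ‖z‖ := by positivity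
  simp only [dilate_apply, wt, Nat.cast_zero, zero_mul, zpow_zero, one_mul, one_smul,
    pow_zero] at h
  rw [norm_mul, norm_norm, norm_mul, norm_pow, Real.norm_of_nonneg h1.le, Real.norm_eq_abs]
  calc _ ≤ (c * (1 + ‖z‖) ^ (-((k + (d + 1) : ℕ) : ℝ))) * (|C| * (1 + ‖z‖) ^ k) := by gcongr
    _ = c * |C| * ((1 + ‖z‖) ^ (-((k + (d + 1) : ℕ) : ℝ)) * (1 + ‖z‖) ^ (k : ℝ)) := by
        rw [Real.rpow_natCast]; ring
    _ = _ := by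
        rw [← Real.rpow_add h1]
        congr 2
        push_cast
        ring

theorem eval_integral_smul_weightedDeriv {G h ψ : 𝓢(Rd d, ℂ)}
    (hψ : ∀ y, ψ y = ∫ z, G z * h (y - z)) (p : ℕ × ℕ) (y : Rd d) :
    ∫ z, G z • DerivSpace.eval y (weightedDeriv p (translate h z)) =
      DerivSpace.eval y (weightedDeriv p ψ) := by
  have e : (ψ : Rd d → ℂ) = fun y => ∫ z, G z * h (y - z) := funext hψ
  have hsm : ∀ z, ContDiff ℝ ∞ fun y => h (y - z) := fun z =>
    (h.smooth ⊤).comp (contDiff_id.sub contDiff_const)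
  have hD : ∀ (n : ℕ) z y, iteratedFDeriv ℝ n (fun y => G z * h (y - z)) y =
      G z • iteratedFDeriv ℝ n h (y - z) := by
    intro n z y
    rw [← iteratedFDeriv_comp_sub, ← iteratedFDeriv_const_smul_apply]
    · rfl
    · exact ((hsm z).of_le (natCast_le_infty _)).contDiffAt
  have hcl := iteratedFDeriv_integral (G := fun z y => G z * h (y - z))
    (((G.smooth ⊤).comp contDiff_fst).mul ((h.smooth ⊤).comp (contDiff_snd.sub contDiff_fst)))
    (fun i => ⟨fun z => ‖G z‖ * SchwartzMap.seminorm ℝ 0 i h, G.integrable.norm.mul_const _,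
      fun z y => by
        rw [hD, norm_smul]
        exact mul_le_mul_of_nonneg_left (SchwartzMap.norm_iteratedFDeriv_le_seminorm ℝ h i _)
          (norm_nonneg _)⟩) p.2
  simp_rw [eval_weightedDeriv, iteratedFDeriv_translate]
  rw [e, hcl]
  simp_rw [hD]
  rw [← integral_smul]
  refine integral_congr_ae (Eventually.of_forall fun z => ?_)
  exact smul_comm _ _ _

theorem continuous_apply_translate (f : 𝓢'(Rd d, ℂ)) (h : 𝓢(Rd d, ℂ)) :
    Continuous fun z => f (translate h z) := by
  obtain ⟨s, Λ, hΛ⟩ := exists_clm_weightedDeriv f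
  simp_rw [hΛ]
  exact Λ.continuous.comp (continuous_pi fun p => continuous_weightedDeriv_translate h p.1)

theorem norm_weightedDeriv_pi_translate_le (h : 𝓢(Rd d, ℂ)) (s : Finset (ℕ × ℕ)) :
    ∃ (C : ℝ) (K : ℕ), 0 ≤ C ∧ ∀ z, ‖fun p : s => weightedDeriv p.1 (translate h z)‖ ≤
      C * (1 + ‖z‖) ^ K := by
  choose C hC0 hC using norm_weightedDeriv_translate_le h
  refine ⟨∑ p ∈ s, C p, s.sup Prod.fst, Finset.sum_nonneg fun p _ => hC0 p, fun z => ?_⟩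
  have hsum : 0 ≤ ∑ p ∈ s, C p := Finset.sum_nonneg fun p _ => hC0 p
  refine (pi_norm_le_iff_of_nonneg (by positivity)).2 fun p => (hC p.1 z).trans ?_
  gcongr
  · exact Finset.single_le_sum (fun p _ => hC0 p) p.2
  · linarith [norm_nonneg z]
  · exact Finset.le_sup (f := Prod.fst) p.2

theorem norm_apply_translate_le (f : 𝓢'(Rd d, ℂ)) (h : 𝓢(Rd d, ℂ)) :
    ∃ (C : ℝ) (K : ℕ), 0 ≤ C ∧ ∀ z, ‖f (translate h z)‖ ≤ C * (1 + ‖z‖) ^ K := by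
  obtain ⟨s, Λ, hΛ⟩ := exists_clm_weightedDeriv f
  obtain ⟨C, K, hC0, hC⟩ := norm_weightedDeriv_pi_translate_le h s
  refine ⟨‖Λ‖ * C, K, by positivity, fun z => ?_⟩
  rw [hΛ, mul_assoc]
  exact (Λ.le_opNorm _).trans (by gcongr; exact hC z)

/-- A tempered distribution applied to a convolution. -/
theorem apply_eq_integral_mul_apply_translate (f : 𝓢'(Rd d, ℂ)) {G h ψ : 𝓢(Rd d, ℂ)}
    (hψ : ∀ y, ψ y = ∫ z, G z * h (y - z)) : f ψ = ∫ z, G z * f (translate h z) := by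
  obtain ⟨s, Λ, hΛ⟩ := exists_clm_weightedDeriv f
  obtain ⟨C, K, hC0, hC⟩ := norm_weightedDeriv_pi_translate_le h s
  have hcont : Continuous fun z => fun p : s => weightedDeriv p.1 (translate h z) :=
    continuous_pi fun p => continuous_weightedDeriv_translate h p.1
  have hintg : Integrable fun z => G z • fun p : s => weightedDeriv p.1 (translate h z) := by
    refine (integrable_mul_one_add_norm_pow G C K).mono'
      (G.continuous.smul hcont).aestronglyMeasurable (Eventually.of_forall fun z => ?_)
    rw [norm_smul]
    gcongr
    exact hC z
  -- This vector-valued integral is identified by evaluating it at each point y, where it reduces to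
  -- differentiating the convolution under the integral sign.
  have hval : ∫ z, G z • (fun p : s => weightedDeriv p.1 (translate h z)) =
      fun p : s => weightedDeriv p.1 ψ := by
    funext p
    refine DerivSpace.ext_eval fun y => ?_
    have := ContinuousLinearMap.integral_comp_comm (𝕜 := ℂ)
      ((DerivSpace.eval y).comp (ContinuousLinearMap.proj (R := ℂ) p)) hintg
    rw [← eval_integral_smul_weightedDeriv hψ p.1 y]
    refine this.symm.trans (integral_congr_ae (Eventually.of_forall fun z => ?_))
    simp
  rw [hΛ, ← hval, ← ContinuousLinearMap.integral_comp_comm Λ hintg]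
  refine integral_congr_ae (Eventually.of_forall fun z => ?_)
  simp [hΛ]

section

/-! ### Reproducing formulas for the Littlewood–Paley pieces -/

theorem chr_comm (x ξ : Rd d) : chr x ξ = chr ξ x := by
  rw [chr, chr, real_inner_comm]

theorem fourier_translate (g : 𝓢(Rd d, ℂ)) (y ξ : Rd d) :
    (𝓕 (translate g y) : 𝓢(Rd d, ℂ)) ξ = chr (-y) ξ * (𝓕 g : 𝓢(Rd d, ℂ)) ξ := by
  rw [SchwartzMap.fourier_coe, SchwartzMap.fourier_coe, fourier_eq_chr, fourier_eq_chr,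
    ← integral_const_mul, ← integral_sub_right_eq_self
      (fun z => chr (-y) ξ * (chr (-ξ) z * g z)) y]
  refine integral_congr_ae (Eventually.of_forall fun z => ?_)
  have h : chr (-y) ξ * chr (-ξ) (z - y) = chr (-ξ) z := by
    rw [chr_comm (-y) ξ, chr_comm (-ξ) z, chr_comm (-ξ), chr, chr, chr, ← Complex.exp_add]
    congr 1
    simp only [inner_neg_right, inner_sub_left, real_inner_comm ξ y]
    push_cast
    ring
  simp only [SchwartzMap.compSubConstCLM_apply]
  rw [← mul_assoc, h]

theorem fourierInv_reflectAt (g : 𝓢(Rd d, ℂ)) (x ξ : Rd d) :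
    (𝓕⁻ (reflectAt g x) : 𝓢(Rd d, ℂ)) ξ = chr x ξ * (𝓕 g : 𝓢(Rd d, ℂ)) ξ := by
  rw [SchwartzMap.fourierInv_coe, SchwartzMap.fourier_coe, fourier_eq_chr, Real.fourierInv_eq,
    ← integral_const_mul, ← integral_sub_left_eq_self
      (fun z => chr x ξ * (chr (-ξ) z * g z)) volume x]
  refine integral_congr_ae (Eventually.of_forall fun z => ?_)
  have h0 := fourierChar_smul_eq (-ξ) z (g (x - z))
  rw [inner_neg_right, neg_neg, neg_neg] at h0
  simp only [reflectAt_apply]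
  rw [h0, ← mul_assoc, chr_comm x ξ, chr_comm (-ξ) (x - z), chr_comm ξ z]
  congr 1
  rw [chr, chr, chr, ← Complex.exp_add]
  congr 1
  simp only [inner_neg_right, inner_sub_left, real_inner_comm ξ x]
  push_cast
  ring

/-- The transform of B ĝ is the convolution of B̂ with the reflection of g, and f may be applied
under the convolution integral. -/
theorem fourier_apply_mul (f : 𝓢'(Rd d, ℂ)) {B g ψ : 𝓢(Rd d, ℂ)}
    (hψ : ∀ ξ, ψ ξ = B ξ * (𝓕 g : 𝓢(Rd d, ℂ)) ξ) :
    (𝓕 f) ψ = ∫ z, (𝓕 B : 𝓢(Rd d, ℂ)) z * f (reflectAt g z) := by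
  rw [TemperedDistribution.fourier_apply]
  refine apply_eq_integral_mul_apply_translate f
    (h := SchwartzMap.compCLMOfContinuousLinearEquiv ℂ (ContinuousLinearEquiv.neg ℝ) g) fun y => ?_
  have h1 := SchwartzMap.integral_fourier_mul_eq B (translate g y)
  have h2 : ∀ z, SchwartzMap.compCLMOfContinuousLinearEquiv ℂ (ContinuousLinearEquiv.neg ℝ) g
      (y - z) = translate g y z := fun z => by simp
  simp_rw [h2]
  rw [h1, SchwartzMap.fourier_coe, fourier_eq_chr]
  refine integral_congr_ae (Eventually.of_forall fun ξ => ?_)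
  simp only [fourier_translate, hψ]
  ring

variable {φ : 𝓢(Rd d, ℂ)} (hφ : IsLittlewoodPaley φ)

theorem continuous_lpProj (k : ℕ) (f : 𝓢'(Rd d, ℂ)) : Continuous (lpProj hφ k f) :=
  continuous_apply_translate f _

theorem norm_lpProj_le (k : ℕ) (f : 𝓢'(Rd d, ℂ)) :
    ∃ (C : ℝ) (K : ℕ), 0 ≤ C ∧ ∀ z, ‖lpProj hφ k f z‖ ≤ C * (1 + ‖z‖) ^ K :=
  norm_apply_translate_le f _

/-- Inserting the cutoff changes nothing next to φ̂_k but makes A compactly supported. The pairing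
with a distribution thereby becomes an integral operator acting on the function Π_k f. -/
theorem fourier_apply_eq_integral_lpProj (f : 𝓢'(Rd d, ℂ)) (k : ℕ) {A : Rd d → ℂ}
    (hA : ContDiff ℝ ∞ A) (x : Rd d) {ψ : 𝓢(Rd d, ℂ)}
    (hψ : ∀ ξ, ψ ξ = A ξ * (𝓕 (lpKernel hφ k) : 𝓢(Rd d, ℂ)) ξ * chr x ξ) :
    (𝓕 f) ψ = ∫ z, symbolKernel (fun _ => A) k x (x - z) * lpProj hφ k f z := by
  have hcs : HasCompactSupport fun ξ => chr x ξ * (cutoff k ξ * A ξ) :=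
    (hasCompactSupport_cutoff k).mul_right.mul_left
  have hsm : ContDiff ℝ ∞ fun ξ => chr x ξ * (cutoff k ξ * A ξ) :=
    (contDiff_chr.comp (contDiff_prodMk_right x)).mul ((contDiff_cutoff k).mul hA)
  have hB : ∀ ξ, ψ ξ = hcs.toSchwartzMap hsm ξ * (𝓕 (lpKernel hφ k) : 𝓢(Rd d, ℂ)) ξ := by
    intro ξ
    change ψ ξ = chr x ξ * (cutoff k ξ * A ξ) * (𝓕 (lpKernel hφ k) : 𝓢(Rd d, ℂ)) ξ
    rw [hψ]
    linear_combination (-(A ξ * chr x ξ)) * cutoff_mul_fourier_lpKernel hφ k ξ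
  rw [fourier_apply_mul f hB]
  refine integral_congr_ae (Eventually.of_forall fun z => ?_)
  simp only [lpProj]
  congr 1
  rw [SchwartzMap.fourier_coe, fourier_eq_chr, symbolKernel]
  refine integral_congr_ae (Eventually.of_forall fun ξ => ?_)
  change chr (-z) ξ * (chr x ξ * (cutoff k ξ * A ξ)) = _
  simp only
  rw [← mul_assoc, ← chr_add, neg_add_eq_sub]

/-- The case A = 1: a band-limited function reproduces itself. This is what makes exponents q < 1
accessible. -/
theorem lpProj_eq_integral (f : 𝓢'(Rd d, ℂ)) (k : ℕ) (x : Rd d) :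
    lpProj hφ k f x =
      ∫ z, symbolKernel (fun _ _ => (1 : ℂ)) k x (x - z) * lpProj hφ k f z := by
  have h := fourier_apply_eq_integral_lpProj hφ f k (A := fun _ => 1) contDiff_const x
    (ψ := 𝓕⁻ (reflectAt (lpKernel hφ k) x)) (fun ξ => by
      rw [fourierInv_reflectAt]
      ring)
  rw [← h, TemperedDistribution.fourier_apply, FourierTransform.fourier_fourierInv_eq]
  rfl

theorem exists_enorm_lpProj_le (d n : ℕ) : ∃ C : ℝ≥0∞, C < ⊤ ∧ ∀ {φ : 𝓢(Rd d, ℂ)}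
    (hφ : IsLittlewoodPaley φ) (f : 𝓢'(Rd d, ℂ)) (k : ℕ) (x : Rd d),
      ‖lpProj hφ k f x‖ₑ ≤ C * ∫⁻ z, ENNReal.ofReal (wt k n (x - z)) * ‖lpProj hφ k f z‖ₑ := by
  obtain ⟨C, hC, h⟩ := isSymbol_one (d := d).enorm_symbolKernel_le n
  refine ⟨C, hC, fun hφ f k x => ?_⟩
  rw [lpProj_eq_integral, ← lintegral_const_mul' _ _ hC.ne]
  refine (enorm_integral_le_lintegral_enorm _).trans (lintegral_mono fun z => ?_)
  rw [enorm_mul, ← mul_assoc]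
  gcongr
  simpa using h k x (x - z)

theorem measurable_enorm_lpProj (k : ℕ) (f : 𝓢'(Rd d, ℂ)) :
    Measurable fun x => ‖lpProj hφ k f x‖ₑ := (continuous_lpProj hφ k f).enorm.measurable

theorem wt_le_of_le {l k : ℕ} (hlk : l ≤ k) {M : ℝ} (hM : 0 ≤ M) (y : Rd d) :
    wt k M y ≤ 2 ^ (k * d) * wt l M y := by
  have h1 := one_le_one_add_mul_norm l y
  have h2 := one_add_mul_norm_mono hlk y
  have h3 : (1 : ℝ) ≤ 2 ^ (l * d) := one_le_pow₀ one_le_two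
  unfold wt
  gcongr 2 ^ (k * d) * ?_
  calc (1 + 2 ^ k * ‖y‖) ^ (-M) ≤ (1 + 2 ^ l * ‖y‖) ^ (-M) :=
        Real.rpow_le_rpow_of_nonpos (by positivity) h2 (by linarith)
    _ ≤ _ := le_mul_of_one_le_left (by positivity) h3

/-- A distribution gives only polynomial growth of Π_k f. A weight decaying faster makes the
supremum required by `rpow_lintegral_wt_mul_le` finite; the resulting bound by cube means is uniform
in x, and the reproducing inequality turns it into a sup bound. -/
theorem enorm_lpProj_le_of_cubeMean_lt_top {q : ℝ} (hq : 0 < q) {μ k : ℕ} (hk : μ ≤ k)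
    (f : 𝓢'(Rd d, ℂ)) (h : cubeMean μ (fun x => ‖lpProj hφ k f x‖ₑ ^ q) < ⊤) :
    ∃ B : ℝ≥0∞, B < ⊤ ∧ ∀ y, ‖lpProj hφ k f y‖ₑ ≤ B := by
  obtain ⟨c, K, hc0, hc⟩ := norm_lpProj_le hφ k f
  obtain ⟨n₀, hn₀⟩ := exists_nat_gt (((d : ℝ) + 1) / min 1 q)
  have hr0 : 0 < min 1 q := lt_min one_pos hq
  rw [div_lt_iff₀ hr0] at hn₀
  -- K absorbs the growth of Π_k f, n₀ ensures n min(1, q) > d, and d + 1 ensures n > d. The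
  -- dependence on f is harmless, as only finiteness of the bound matters.
  set n : ℕ := n₀ + K + d + 1 with hn
  have hM : (d : ℝ) < n := by
    rw [hn]
    push_cast
    linarith [(Nat.cast_nonneg n₀ : (0 : ℝ) ≤ n₀), (Nat.cast_nonneg K : (0 : ℝ) ≤ K)]
  have hMr : (d : ℝ) < n * min 1 q := by
    have : (n₀ : ℝ) ≤ n := by
      rw [hn]
      push_cast
      linarith [(Nat.cast_nonneg d : (0 : ℝ) ≤ d), (Nat.cast_nonneg K : (0 : ℝ) ≤ K)]
    nlinarith
  obtain ⟨C₀, hC₀, hrep⟩ := exists_enorm_lpProj_le d n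
  obtain ⟨C, hC, H⟩ := rpow_lintegral_wt_mul_le (d := d) hq hM le_rfl C₀ hC₀
  set F : Rd d → ℝ≥0∞ := fun x => ‖lpProj hφ k f x‖ₑ with hF
  set B₁ : ℝ≥0∞ := C * 2 ^ (((k : ℝ) - μ) * tau d q * q) *
    (ENNReal.ofReal ((1 + Real.sqrt d) ^ (n * min 1 q)) * wtMass d (n * min 1 q) *
      cubeMean μ (fun x => F x ^ q)) with hB₁
  have hB₁t : B₁ < ⊤ := by
    refine ENNReal.mul_lt_top (ENNReal.mul_lt_top hC (two_rpow_ne_top _).lt_top)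
      (ENNReal.mul_lt_top (ENNReal.mul_lt_top ENNReal.ofReal_lt_top (wtMass_lt_top hMr)) h)
  have hbd : ∀ x, (∫⁻ y, ENNReal.ofReal (wt μ n (x - y)) * F y) ≤ B₁ ^ q⁻¹ := by
    intro x
    rw [ENNReal.le_rpow_inv_iff hq]
    refine (H μ k hk F (measurable_enorm_lpProj hφ k f) x (fun _ => ?_)
      (fun y => hrep hφ f k y)).trans ?_
    · refine lt_of_le_of_lt (iSup_le fun y => ?_)
        (ENNReal.ofReal_lt_top (r := 2 ^ (μ * d) * (1 + ‖x‖) ^ (n : ℝ) * c))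
      rw [hF]
      simp only
      rw [← ofReal_norm, ← ENNReal.ofReal_mul (wt_pos _ _ _).le]
      refine ENNReal.ofReal_le_ofReal ?_
      have h1 : 0 < 1 + ‖y‖ := by positivity
      calc _ ≤ (2 ^ (μ * d) * (1 + ‖x‖) ^ (n : ℝ) * wt 0 n y) * (c * (1 + ‖y‖) ^ K) := by
            gcongr
            · exact (mul_pos (by positivity) (wt_pos _ _ _)).le
            · exact wt_le_const_mul_wt_zero μ (Nat.cast_nonneg n) x y
            · exact hc y
        _ = 2 ^ (μ * d) * (1 + ‖x‖) ^ (n : ℝ) * c * (wt 0 n y * (1 + ‖y‖) ^ K) := by ring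
        _ ≤ 2 ^ (μ * d) * (1 + ‖x‖) ^ (n : ℝ) * c * 1 := by
            gcongr
            have h2 := wt_mul_rpow 0 K n y
            simp only [pow_zero, one_mul] at h2
            rw [← Real.rpow_natCast, h2]
            simp only [wt, zero_mul, pow_zero, one_mul]
            refine Real.rpow_le_one_of_one_le_of_nonpos (by linarith [norm_nonneg y]) ?_
            rw [hn]
            push_cast
            linarith [(Nat.cast_nonneg d : (0 : ℝ) ≤ d), (Nat.cast_nonneg n₀ : (0 : ℝ) ≤ n₀)]
        _ = _ := mul_one _
    · rw [hB₁]
      gcongr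
      exact lintegral_wt_mul_le_cubeMean μ (by positivity) x _
  refine ⟨C₀ * (ENNReal.ofReal (2 ^ (k * d)) * B₁ ^ q⁻¹), ENNReal.mul_lt_top hC₀
    (ENNReal.mul_lt_top ENNReal.ofReal_lt_top
      (ENNReal.rpow_lt_top_of_nonneg (by positivity) hB₁t.ne)), fun y => ?_⟩
  refine (hrep hφ f k y).trans ?_
  gcongr
  refine le_trans ?_ (mul_le_mul_right (hbd y) _)
  rw [← lintegral_const_mul' _ _ ENNReal.ofReal_ne_top]
  refine lintegral_mono fun z => ?_
  rw [← mul_assoc, ← ENNReal.ofReal_mul (by positivity)]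
  gcongr
  exact wt_le_of_le hk (Nat.cast_nonneg n) _

end

section

/-! ### Summation of the pieces over `j` -/

variable {φ : 𝓢(Rd d, ℂ)} (hφ : IsLittlewoodPaley φ)

theorem fourier_lowPass (ξ : Rd d) : (𝓕 (lowPass hφ) : 𝓢(Rd d, ℂ)) ξ = lowMultiplier φ ξ := by
  rw [lowPass, FourierTransform.fourier_fourierInv_eq]
  rfl

theorem summable_fourier_dilate {φ : 𝓢(Rd d, ℂ)} (hφ : IsLittlewoodPaley φ) (ξ : Rd d) :
    Summable fun k : ℕ => (𝓕 (dilate φ ((k : ℤ) + 1)) : 𝓢(Rd d, ℂ)) ξ := by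
  obtain ⟨K, hK⟩ := pow_unbounded_of_one_lt ‖ξ‖ (one_lt_two : (1 : ℝ) < 2)
  refine summable_of_ne_finset_zero (s := Finset.range K) fun k hk => ?_
  refine fourier_dilate_eq_zero hφ (Or.inl ?_)
  rw [add_sub_cancel_right, zpow_natCast]
  exact hK.trans_le (pow_le_pow_right₀ one_le_two (by simpa using hk))

/-- On the Fourier side both sides equal 1 - ∑_{k > N} φ̂_k(ξ), because dilation by 2^N shifts the
series by N. -/
theorem sum_lpKernel (N : ℕ) :
    ∑ j ∈ Finset.range (N + 1), lpKernel hφ j = dilate (lowPass hφ) N := by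
  apply fourier_injective
  simp only
  have hsum : (𝓕 (∑ j ∈ Finset.range (N + 1), lpKernel hφ j) : 𝓢(Rd d, ℂ)) =
      ∑ j ∈ Finset.range (N + 1), 𝓕 (lpKernel hφ j) :=
    map_sum (SchwartzMap.fourierTransformCLM ℂ (V := Rd d) (E := ℂ)) _ _
  rw [hsum]
  ext ξ
  have h1 := (summable_fourier_dilate hφ ξ).sum_add_tsum_nat_add N
  have h2 : ∀ k : ℕ, (𝓕 (dilate φ ((k : ℤ) + 1)) : 𝓢(Rd d, ℂ)) ((2 : ℝ) ^ (-(N : ℤ)) • ξ) =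
      (𝓕 (dilate φ (((k + N : ℕ) : ℤ) + 1)) : 𝓢(Rd d, ℂ)) ξ := by
    intro k
    rw [fourier_dilate, fourier_dilate, smul_smul, ← zpow_add₀ two_ne_zero]
    congr 3
    push_cast
    ring
  rw [fourier_dilate, fourier_lowPass, lowMultiplier]
  simp_rw [h2]
  rw [Finset.sum_range_succ']
  have h3 : ∀ j, lpKernel hφ (j + 1) = dilate φ ((j : ℤ) + 1) := fun j => by
    simp [lpKernel]
  have h4 : lpKernel hφ 0 = lowPass hφ := by simp [lpKernel]
  simp_rw [h3, h4]
  rw [add_apply, fourier_lowPass, lowMultiplier, ← h1, sum_apply]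
  ring

/-- The integral is the multiplier at ξ = 0, where all the φ̂_k vanish. -/
theorem integral_lowPass : ∫ x, lowPass hφ x = 1 := by
  have h := fourier_lowPass hφ 0
  rw [SchwartzMap.fourier_coe, fourier_eq_chr] at h
  have h0 : lowMultiplier φ 0 = 1 := by
    have : ∀ k : ℕ, (𝓕 (dilate φ ((k : ℤ) + 1)) : 𝓢(Rd d, ℂ)) 0 = 0 := fun k =>
      fourier_dilate_eq_zero hφ (Or.inl (by rw [norm_zero]; positivity))
    simp [lowMultiplier, this]
  rw [h0] at h
  simpa [chr] using h

theorem IsSymbol.contDiff_integral_mul {m : ℝ} {a : Rd d → Rd d → ℂ} (ha : IsSymbol 1 1 m a)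
    (G : 𝓢(Rd d, ℂ)) (x : Rd d) : ContDiff ℝ ∞ fun ξ => ∫ v, G v * a (x - v) ξ := by
  rw [contDiff_infty]
  intro n
  refine contDiff_integral_of_dominated n (fun v ξ => G v * a (x - v) ξ) ?_ ?_
  · refine ContDiff.mul ((G.smooth ⊤).comp contDiff_fst) ?_
    exact ha.smooth.comp ((contDiff_const.sub contDiff_fst).prodMk contDiff_snd)
  · intro i ξ₀
    obtain ⟨c, hc⟩ := ha.norm_iteratedFDeriv_le i
    have hcont : Continuous fun ξ : Rd d => c * (1 + ‖ξ‖) ^ (m - 1 * i) := by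
      refine continuous_const.mul (Continuous.rpow_const (by fun_prop) fun ξ => Or.inl ?_)
      positivity
    refine ⟨{ξ | c * (1 + ‖ξ‖) ^ (m - 1 * i) < c * (1 + ‖ξ₀‖) ^ (m - 1 * i) + 1},
      (hcont.tendsto ξ₀).eventually_lt_const (lt_add_one _),
      fun v => ‖G v‖ * (c * (1 + ‖ξ₀‖) ^ (m - 1 * i) + 1),
      G.integrable.norm.mul_const _, fun v ξ hξ => ?_⟩
    have e : (fun ξ => G v * a (x - v) ξ) = G v • a (x - v) := rfl
    rw [e, iteratedFDeriv_const_smul_apply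
      (((ha.contDiff_right (x - v)).of_le (natCast_le_infty _)).contDiffAt), norm_smul]
    exact mul_le_mul_of_nonneg_left ((hc _ _).trans (le_of_lt hξ)) (norm_nonneg _)

/-- The kernel of the symbol `∫ G(v) a(x - v, ξ) dv` localized to `|ξ| ~ 2^k`. -/
def smoothedKernel (a : Rd d → Rd d → ℂ) (G : 𝓢(Rd d, ℂ)) (k : ℕ) (x y : Rd d) : ℂ :=
  ∫ v, G v * symbolKernel a k (x - v) y

theorem IsSymbol.symbolKernel_integral_mul {m : ℝ} {a : Rd d → Rd d → ℂ} (ha : IsSymbol 1 1 m a)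
    (G : 𝓢(Rd d, ℂ)) (k : ℕ) (x y : Rd d) :
    symbolKernel (fun _ ξ => ∫ v, G v * a (x - v) ξ) k x y = smoothedKernel a G k x y := by
  rw [smoothedKernel, ha.integral_mul_symbolKernel k G.integrable G.continuous
    (u := fun _ => y) (w := fun v => x - v) continuous_const (continuous_const.sub continuous_id),
    symbolKernel]
  refine integral_congr_ae (Eventually.of_forall fun ξ => ?_)
  simp only
  simp_rw [← mul_assoc, integral_mul_const]
  ring

theorem IsSymbol.integrable_mul_comp_sub {m : ℝ} {a : Rd d → Rd d → ℂ} (ha : IsSymbol 1 1 m a)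
    (G : 𝓢(Rd d, ℂ)) (x ξ : Rd d) : Integrable fun v => G v * a (x - v) ξ := by
  obtain ⟨c, hc0, hc⟩ := ha.norm_le
  refine Integrable.mul_bdd (c := c * (1 + ‖ξ‖) ^ m) G.integrable ?_
    (Eventually.of_forall fun v => hc _ _)
  exact (ha.smooth.continuous.comp ((continuous_const.sub continuous_id).prodMk
    continuous_const)).aestronglyMeasurable

/-- Summed over j, the pieces form the symbol smoothed in x at scale 2^{-N}, whose localization to
|ξ| ~ 2^k acts on Π_k f through its kernel. -/
theorem sum_pieceOp {m : ℝ} {a : Rd d → Rd d → ℂ} (ha : IsSymbol 1 1 m a) (N k : ℕ)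
    (f : 𝓢'(Rd d, ℂ)) (x : Rd d) : ∑ j ∈ Finset.range (N + 1), pieceOp hφ ha j k f x =
      ∫ z, smoothedKernel a (dilate (lowPass hφ) N) k x (x - z) * lpProj hφ k f z := by
  have h := fourier_apply_eq_integral_lpProj hφ f k
    (ha.contDiff_integral_mul (dilate (lowPass hφ) N) x) x
    (ψ := ∑ j ∈ Finset.range (N + 1), pieceTest hφ ha j k x) (fun ξ => ?_)
  · rw [map_sum] at h
    simp_rw [ha.symbolKernel_integral_mul] at h
    exact h
  · rw [sum_apply]
    have e : ∀ j, pieceTest hφ ha j k x ξ = (∫ v, lpKernel hφ j v * a (x - v) ξ) *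
        (𝓕 (lpKernel hφ k) : 𝓢(Rd d, ℂ)) ξ * chr x ξ := fun j => rfl
    simp_rw [e]
    rw [← Finset.sum_mul, ← Finset.sum_mul, ← integral_finsetSum _ fun j _ =>
      ha.integrable_mul_comp_sub (lpKernel hφ j) x ξ, ← sum_lpKernel]
    simp_rw [sum_apply, Finset.sum_mul]

theorem integral_dilate_mul (ρ : 𝓢(Rd d, ℂ)) (N : ℕ) (h : Rd d → ℂ) :
    ∫ v, dilate ρ N v * h v = ∫ w, ρ w * h (((2 : ℝ) ^ N)⁻¹ • w) := by
  have h2 : (2 : ℝ) ^ N ≠ 0 := by positivity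
  have key := Measure.integral_comp_smul (volume : Measure (Rd d))
    (fun w : Rd d => ρ w * h (((2 : ℝ) ^ N)⁻¹ • w)) ((2 : ℝ) ^ N)
  rw [finrank_euclideanSpace_fin, abs_of_pos (by positivity), Complex.real_smul] at key
  simp_rw [inv_smul_smul₀ h2] at key
  simp_rw [dilate_apply, zpow_natCast, mul_assoc]
  rw [integral_const_mul, key, ← mul_assoc]
  have : (2 : ℂ) ^ ((N : ℤ) * d) * (((((2 : ℝ) ^ N) ^ d)⁻¹ : ℝ) : ℂ) = 1 := by
    push_cast
    rw [zpow_mul, zpow_natCast, zpow_natCast]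
    exact mul_inv_cancel₀ (pow_ne_zero _ (pow_ne_zero _ two_ne_zero))
  rw [this, one_mul]

/-- Dilates of a Schwartz function of integral one form an approximate identity. -/
theorem tendsto_integral_dilate_mul {ρ : 𝓢(Rd d, ℂ)} (hρ : ∫ x, ρ x = 1) {h : Rd d → ℂ}
    (hc : Continuous h) {B : ℝ} (hB : ∀ x, ‖h x‖ ≤ B) :
    Tendsto (fun N : ℕ => ∫ v, dilate ρ N v * h v) atTop (𝓝 (h 0)) := by
  simp_rw [integral_dilate_mul]
  have e : h 0 = ∫ w, ρ w * h 0 := by rw [integral_mul_const, hρ, one_mul]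
  rw [e]
  refine tendsto_integral_of_dominated_convergence (fun w => ‖ρ w‖ * B) (fun N => ?_)
    (ρ.integrable.norm.mul_const B) (fun N => Eventually.of_forall fun w => ?_)
    (Eventually.of_forall fun w => ?_)
  · exact (ρ.continuous.mul (hc.comp (continuous_const_smul _))).aestronglyMeasurable
  · rw [norm_mul]
    gcongr
    exact hB _
  · refine Tendsto.const_mul _ ?_
    have h1 : Tendsto (fun N : ℕ => ((2 : ℝ) ^ N)⁻¹ • w) atTop (𝓝 ((0 : ℝ) • w)) := by
      refine Tendsto.smul_const ?_ w
      exact tendsto_inv_atTop_zero.comp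
        (tendsto_pow_atTop_atTop_of_one_lt (one_lt_two : (1 : ℝ) < 2))
    rw [zero_smul] at h1
    exact (hc.tendsto 0).comp h1

end

/-! ### Functions as tempered distributions -/

theorem norm_le_const_mul_wt (ψ : 𝓢(Rd d, ℂ)) (M : ℕ) (x : Rd d) :
    ‖ψ x‖ ≤ 2 ^ M * (Finset.Iic (M, 0)).sup (schwartzSeminormFamily ℂ (Rd d) ℂ) ψ * wt 0 M x := by
  have h := SchwartzMap.one_add_le_sup_seminorm_apply (𝕜 := ℂ) (m := (M, 0)) le_rfl le_rfl ψ x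
  have h1 : 0 < 1 + ‖x‖ := by positivity
  rw [norm_iteratedFDeriv_zero, ← le_div_iff₀' (by positivity)] at h
  change ‖ψ x‖ ≤ 2 ^ M * (Finset.Iic (M, 0)).sup
    (fun m : ℕ × ℕ => SchwartzMap.seminorm ℂ m.1 m.2) ψ * wt 0 M x
  simpa [wt, Real.rpow_neg h1.le, div_eq_mul_inv] using h

theorem integrable_mul_of_lintegral_wt_lt_top {h : Rd d → ℂ} (hm : AEStronglyMeasurable h)
    {M : ℕ} (hfin : ∫⁻ x, ENNReal.ofReal (wt 0 M x) * ‖h x‖ₑ < ⊤) (ψ : 𝓢(Rd d, ℂ)) :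
    Integrable fun x => h x * ψ x := by
  refine ⟨hm.mul ψ.continuous.aestronglyMeasurable, ?_⟩
  have hb := norm_le_const_mul_wt ψ M
  set c : ℝ := 2 ^ M * (Finset.Iic (M, 0)).sup (schwartzSeminormFamily ℂ (Rd d) ℂ) ψ with hc
  have hc0 : 0 ≤ c := by positivity
  refine lt_of_le_of_lt (b := ENNReal.ofReal c * ∫⁻ x, ENNReal.ofReal (wt 0 M x) * ‖h x‖ₑ) ?_
    (ENNReal.mul_lt_top ENNReal.ofReal_lt_top hfin)
  rw [← lintegral_const_mul' _ _ ENNReal.ofReal_ne_top]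
  refine lintegral_mono fun x => ?_
  rw [enorm_mul, mul_comm, ← mul_assoc, ← ENNReal.ofReal_mul hc0, ← ofReal_norm (ψ x)]
  gcongr
  exact hb x

theorem exists_isGivenBy {h : Rd d → ℂ} (hm : AEStronglyMeasurable h) {M : ℕ}
    (hfin : ∫⁻ x, ENNReal.ofReal (wt 0 M x) * ‖h x‖ₑ < ⊤) :
    ∃ u : 𝓢'(Rd d, ℂ), IsGivenBy u h := by
  have hintg := integrable_mul_of_lintegral_wt_lt_top hm hfin
  have hi : Integrable fun x => wt 0 M x * ‖h x‖ := by
    refine ⟨(continuous_wt 0 M).aestronglyMeasurable.mul hm.norm, ?_⟩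
    refine lt_of_le_of_lt (lintegral_mono fun x => ?_) hfin
    rw [enorm_mul, enorm_norm, ← ofReal_norm (wt 0 (M : ℝ) x),
      Real.norm_of_nonneg (wt_pos _ _ _).le]
  refine ⟨ContinuousLinearMap.toPointwiseConvergenceCLM _ _ _ _
    (SchwartzMap.mkCLMtoNormedSpace (𝕜 := ℂ) (fun ψ => ∫ x, h x * ψ x) (fun ψ₁ ψ₂ => ?_)
      (fun c ψ => ?_) ⟨Finset.Iic (M, 0), 2 ^ M * ∫ x, wt 0 M x * ‖h x‖, ?_, fun ψ => ?_⟩),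
    fun ψ => ⟨hintg ψ, rfl⟩⟩
  · rw [← integral_add (hintg ψ₁) (hintg ψ₂)]
    simp [mul_add]
  · rw [RingHom.id_apply, smul_eq_mul, ← integral_const_mul]
    refine integral_congr_ae (Eventually.of_forall fun x => ?_)
    simp only [smul_apply, smul_eq_mul]
    ring
  · have : 0 ≤ ∫ x, wt 0 M x * ‖h x‖ := integral_nonneg fun x =>
      mul_nonneg (wt_pos _ _ _).le (norm_nonneg _)
    positivity
  · set S := (Finset.Iic (M, 0)).sup (schwartzSeminormFamily ℂ (Rd d) ℂ) ψ with hS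
    calc _ ≤ ∫ x, 2 ^ M * S * (wt 0 M x * ‖h x‖) := by
          refine norm_integral_le_of_norm_le (hi.const_mul _) (Eventually.of_forall fun x => ?_)
          rw [norm_mul, ← mul_assoc, mul_comm]
          gcongr
          exact norm_le_const_mul_wt ψ M x
      _ = _ := by
          rw [integral_const_mul]
          ring

/-! ### Kernel operators -/

/-- The operator with kernel `K(x, x - z)`. -/
def kernelOp (K : Rd d → Rd d → ℂ) (F : Rd d → ℂ) (x : Rd d) : ℂ := ∫ z, K x (x - z) * F z

theorem stronglyMeasurable_kernelOp {K : Rd d → Rd d → ℂ}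
    (hK : Continuous fun p : Rd d × Rd d => K p.1 p.2) {F : Rd d → ℂ} (hF : Continuous F) :
    StronglyMeasurable (kernelOp K F) := by
  have h : Continuous fun p : Rd d × Rd d => K p.1 (p.1 - p.2) * F p.2 :=
    (hK.comp (continuous_fst.prodMk (continuous_fst.sub continuous_snd))).mul
      (hF.comp continuous_snd)
  exact h.stronglyMeasurable.integral_prod_right

theorem enorm_kernelOp_le {K : Rd d → Rd d → ℂ} {c : ℝ≥0∞} (hc : c ≠ ⊤) {k : ℕ} {n : ℝ}
    (hK : ∀ x y, ‖K x y‖ₑ ≤ c * ENNReal.ofReal (wt k n y)) (F : Rd d → ℂ) (x : Rd d) :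
    ‖kernelOp K F x‖ₑ ≤ c * ∫⁻ z, ENNReal.ofReal (wt k n (x - z)) * ‖F z‖ₑ := by
  rw [← lintegral_const_mul' _ _ hc]
  refine (enorm_integral_le_lintegral_enorm _).trans (lintegral_mono fun z => ?_)
  rw [enorm_mul, ← mul_assoc]
  gcongr
  exact hK _ _

/-- Tonelli, and scale 0 is coarser than scale k: the convolution of the two weights is again a
weight at scale 0. -/
theorem lintegral_wt_mul_lintegral_wt_le {M n : ℝ} (hM : 0 ≤ M) (k : ℕ) {G : Rd d → ℝ≥0∞}
    (hG : Measurable G) :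
    ∫⁻ x, ENNReal.ofReal (wt 0 M x) * ∫⁻ z, ENNReal.ofReal (wt k n (x - z)) * G z ≤
      wtMass d (n - M) * ∫⁻ z, ENNReal.ofReal (wt 0 M z) * G z := by
  have hw : ∀ z : Rd d, wt 0 M z = wt 0 M (0 - z) := fun z => by rw [zero_sub, wt_neg]
  have hm : Measurable fun p : Rd d × Rd d =>
      ENNReal.ofReal (wt 0 M p.1) * (ENNReal.ofReal (wt k n (p.1 - p.2)) * G p.2) := by
    have h1 : Measurable fun p : Rd d × Rd d => ENNReal.ofReal (wt 0 M p.1) :=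
      ((continuous_wt 0 M).comp continuous_fst).measurable.ennreal_ofReal
    have h2 := measurable_ofReal_wt_sub (d := d) k n
    exact h1.mul (h2.mul (hG.comp measurable_snd))
  calc _ = ∫⁻ x, ∫⁻ z, ENNReal.ofReal (wt 0 M x) * (ENNReal.ofReal (wt k n (x - z)) * G z) := by
        refine lintegral_congr fun x => ?_
        rw [lintegral_const_mul' _ _ ENNReal.ofReal_ne_top]
    _ = ∫⁻ z, ∫⁻ x, ENNReal.ofReal (wt 0 M x) * (ENNReal.ofReal (wt k n (x - z)) * G z) :=
        lintegral_lintegral_swap hm.aemeasurable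
    _ = ∫⁻ z, (∫⁻ x, ENNReal.ofReal (wt 0 M (0 - x)) * ENNReal.ofReal (wt k n (x - z))) * G z := by
        refine lintegral_congr fun z => ?_
        rw [← lintegral_mul_const]
        · simp_rw [← hw, mul_assoc]
        · have h1 := continuous_wt (d := d) 0 M
          have h2 := continuous_wt (d := d) k n
          fun_prop
    _ ≤ ∫⁻ z, wtMass d (n - M) * (ENNReal.ofReal (wt 0 M z) * G z) := by
        refine lintegral_mono fun z => ?_
        rw [hw z, ← mul_assoc]
        gcongr
        exact lintegral_wt_mul_wt_le (Nat.zero_le k) hM 0 z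
    _ = _ := by
        rw [lintegral_const_mul]
        exact (continuous_wt 0 M).measurable.ennreal_ofReal.mul hG

/-- The function `∑_k 2^{km} (wt_k ∗ |F_k|)`. -/
def majorant (m n : ℝ) (F : ℕ → Rd d → ℂ) (x : Rd d) : ℝ≥0∞ :=
  ∑' k : ℕ, 2 ^ ((k : ℝ) * m) * ∫⁻ z, ENNReal.ofReal (wt k n (x - z)) * ‖F k z‖ₑ

theorem measurable_majorant_term (m n : ℝ) {F : ℕ → Rd d → ℂ} (hF : ∀ k, Continuous (F k))
    (k : ℕ) : Measurable fun x => (2 : ℝ≥0∞) ^ ((k : ℝ) * m) *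
      ∫⁻ z, ENNReal.ofReal (wt k n (x - z)) * ‖F k z‖ₑ :=
  (measurable_lintegral_wt_mul k n (hF k).enorm.measurable).const_mul _

theorem lintegral_wt_mul_majorant_le {m n M : ℝ} (hM : 0 ≤ M) {F : ℕ → Rd d → ℂ}
    (hF : ∀ k, Continuous (F k)) :
    ∫⁻ x, ENNReal.ofReal (wt 0 M x) * majorant m n F x ≤ wtMass d (n - M) *
      ∑' k : ℕ, 2 ^ ((k : ℝ) * m) * ∫⁻ z, ENNReal.ofReal (wt 0 M z) * ‖F k z‖ₑ := by
  have hm := measurable_majorant_term m n hF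
  have hw : Measurable fun x : Rd d => ENNReal.ofReal (wt 0 M x) :=
    (continuous_wt 0 M).measurable.ennreal_ofReal
  simp_rw [majorant, ← ENNReal.tsum_mul_left]
  have hwm : ∀ k : ℕ, Measurable fun x : Rd d => ENNReal.ofReal (wt 0 M x) *
      ((2 : ℝ≥0∞) ^ ((k : ℝ) * m) * ∫⁻ z, ENNReal.ofReal (wt k n (x - z)) * ‖F k z‖ₑ) :=
    fun k => hw.mul (hm k)
  rw [lintegral_tsum fun k => (hwm k).aemeasurable]
  refine ENNReal.tsum_le_tsum fun k => ?_
  simp_rw [mul_left_comm _ ((2 : ℝ≥0∞) ^ ((k : ℝ) * m))]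
  rw [lintegral_const_mul' _ _ (two_rpow_ne_top _)]
  gcongr
  exact lintegral_wt_mul_lintegral_wt_le hM k (hF k).enorm.measurable

theorem ae_majorant_lt_top {m n M : ℝ} {F : ℕ → Rd d → ℂ} (hF : ∀ k, Continuous (F k))
    (hfin : ∫⁻ x, ENNReal.ofReal (wt 0 M x) * majorant m n F x < ⊤) :
    ∀ᵐ x, majorant m n F x < ⊤ := by
  have hm : Measurable (majorant m n F) := Measurable.tsum (measurable_majorant_term m n hF)
  have hw : Measurable fun x : Rd d => ENNReal.ofReal (wt 0 M x) :=
    (continuous_wt 0 M).measurable.ennreal_ofReal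
  filter_upwards [ae_lt_top (hw.mul hm) hfin.ne] with x hx
  by_contra hcon
  rw [not_lt, top_le_iff] at hcon
  rw [Pi.mul_apply, hcon, ENNReal.mul_top (by simpa using wt_pos 0 M x)] at hx
  exact lt_irrefl _ hx

section

/-! ### Convergence of the truncated operators -/

theorem lintegral_enorm_dilate_le (ρ : 𝓢(Rd d, ℂ)) : ∃ C : ℝ≥0∞, C < ⊤ ∧
    ∀ N : ℕ, ∫⁻ v, ‖dilate ρ N v‖ₑ ≤ C := by
  obtain ⟨C, hC, h⟩ := enorm_dilate_le ρ (d + 1)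
  refine ⟨C * wtMass d (d + 1 : ℕ), ENNReal.mul_lt_top hC (wtMass_lt_top (by push_cast; linarith)),
    fun N => ?_⟩
  rw [← lintegral_wt N, ← lintegral_const_mul' _ _ hC.ne]
  exact lintegral_mono fun v => h N v

variable {m : ℝ} {a : Rd d → Rd d → ℂ}

theorem IsSymbol.continuous_smoothedKernel (ha : IsSymbol 1 1 m a) (G : 𝓢(Rd d, ℂ)) (k : ℕ) :
    Continuous fun p : Rd d × Rd d => smoothedKernel a G k p.1 p.2 := by
  obtain ⟨c, hc0, hc⟩ := ha.norm_symbolKernel_le 0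
  have hK := continuous_symbolKernel ha.smooth.continuous k
  refine continuous_of_dominated (bound := fun v => ‖G v‖ * (c * 2 ^ ((k : ℝ) * m) * 2 ^ (k * d)))
    (fun p => ?_) (fun p => Eventually.of_forall fun v => ?_) (G.integrable.norm.mul_const _)
    (Eventually.of_forall fun v => ?_)
  · exact (G.continuous.mul (hK.comp ((continuous_const.sub continuous_id).prodMk
      continuous_const))).aestronglyMeasurable
  · rw [norm_mul]
    gcongr
    refine (hc k _ _).trans (le_of_eq ?_)
    simp [wt]
  · exact continuous_const.mul (hK.comp ((continuous_fst.sub continuous_const).prodMk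
      continuous_snd))

/-- Dilates have uniformly bounded L¹ norms, so smoothing in x preserves the kernel estimate
uniformly in N. This supplies the dominating functions for N → ∞. -/
theorem IsSymbol.enorm_smoothedKernel_le (ha : IsSymbol 1 1 m a) (ρ : 𝓢(Rd d, ℂ)) (n : ℕ) :
    ∃ C : ℝ≥0∞, C < ⊤ ∧ ∀ (N k : ℕ) (x y : Rd d), ‖smoothedKernel a (dilate ρ N) k x y‖ₑ ≤
      C * 2 ^ ((k : ℝ) * m) * ENNReal.ofReal (wt k n y) := by
  obtain ⟨C₁, hC₁, h₁⟩ := lintegral_enorm_dilate_le ρ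
  obtain ⟨C₂, hC₂, h₂⟩ := ha.enorm_symbolKernel_le n
  refine ⟨C₁ * C₂, ENNReal.mul_lt_top hC₁ hC₂, fun N k x y => ?_⟩
  calc _ ≤ ∫⁻ v, ‖dilate ρ N v‖ₑ * (C₂ * 2 ^ ((k : ℝ) * m) * ENNReal.ofReal (wt k n y)) := by
        refine (enorm_integral_le_lintegral_enorm _).trans (lintegral_mono fun v => ?_)
        rw [enorm_mul]
        gcongr
        exact h₂ k _ y
    _ = (∫⁻ v, ‖dilate ρ N v‖ₑ) * (C₂ * 2 ^ ((k : ℝ) * m) * ENNReal.ofReal (wt k n y)) :=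
        lintegral_mul_const _ (dilate ρ N).continuous.enorm.measurable
    _ ≤ C₁ * (C₂ * 2 ^ ((k : ℝ) * m) * ENNReal.ofReal (wt k n y)) := by
        gcongr
        exact h₁ N
    _ = _ := by ring

theorem IsSymbol.tendsto_smoothedKernel (ha : IsSymbol 1 1 m a) {ρ : 𝓢(Rd d, ℂ)}
    (hρ : ∫ x, ρ x = 1) (k : ℕ) (x y : Rd d) :
    Tendsto (fun N : ℕ => smoothedKernel a (dilate ρ N) k x y) atTop
      (𝓝 (symbolKernel a k x y)) := by
  obtain ⟨c, hc0, hc⟩ := ha.norm_symbolKernel_le 0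
  have hK := continuous_symbolKernel ha.smooth.continuous k
  have h1 : Continuous fun v : Rd d => (x - v, y) :=
    (continuous_const.sub continuous_id).prodMk continuous_const
  have h2 := hK.comp h1
  simp only [Function.comp_def] at h2
  have h := tendsto_integral_dilate_mul hρ h2 (fun v => hc k (x - v) y)
  rw [sub_zero] at h
  exact h

theorem IsSymbol.tendsto_kernelOp (ha : IsSymbol 1 1 m a) {ρ : 𝓢(Rd d, ℂ)}
    (hρ : ∫ x, ρ x = 1) (k : ℕ) {F : Rd d → ℂ} (hF : Continuous F) {n : ℕ} {x : Rd d}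
    (hfin : ∫⁻ z, ENNReal.ofReal (wt k n (x - z)) * ‖F z‖ₑ < ⊤) :
    Tendsto (fun N : ℕ => kernelOp (smoothedKernel a (dilate ρ N) k) F x) atTop
      (𝓝 (kernelOp (symbolKernel a k) F x)) := by
  obtain ⟨C, hC, h⟩ := ha.enorm_smoothedKernel_le ρ n
  have hcs : Continuous fun z : Rd d => x - z := continuous_const.sub continuous_id
  have hw : Continuous fun z => wt k n (x - z) * ‖F z‖ :=
    ((continuous_wt k n).comp hcs).mul hF.norm
  have hi : Integrable fun z => wt k n (x - z) * ‖F z‖ := by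
    refine ⟨hw.aestronglyMeasurable, lt_of_le_of_lt (lintegral_mono fun z => ?_) hfin⟩
    rw [enorm_mul, enorm_norm, ← ofReal_norm (wt k (n : ℝ) (x - z)),
      Real.norm_of_nonneg (wt_pos _ _ _).le]
  refine tendsto_integral_of_dominated_convergence
    (fun z => (C * 2 ^ ((k : ℝ) * m)).toReal * (wt k n (x - z) * ‖F z‖)) (fun N => ?_)
    (hi.const_mul _) (fun N => Eventually.of_forall fun z => ?_) (Eventually.of_forall fun z => ?_)
  · exact (((ha.continuous_smoothedKernel _ k).comp (continuous_const.prodMk hcs)).mul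
      hF).aestronglyMeasurable
  · rw [norm_mul, ← mul_assoc]
    gcongr
    have h1 := ENNReal.toReal_mono (ENNReal.mul_ne_top (ENNReal.mul_ne_top hC.ne
      (two_rpow_ne_top _)) ENNReal.ofReal_ne_top) (h N k x (x - z))
    rwa [toReal_enorm, ENNReal.toReal_mul, ENNReal.toReal_ofReal (wt_pos _ _ _).le] at h1
  · exact (ha.tendsto_smoothedKernel hρ k x (x - z)).mul_const _

/-- The function `∑_{k ≤ N} ∑_{j ≤ N} T_{[a_{j,k}]} f`, in terms of the pieces `F_k` of `f`. -/
def truncatedOp (a : Rd d → Rd d → ℂ) (ρ : 𝓢(Rd d, ℂ)) (F : ℕ → Rd d → ℂ) (N : ℕ) (x : Rd d) : ℂ :=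
  ∑ k ∈ Finset.range (N + 1), kernelOp (smoothedKernel a (dilate ρ N) k) (F k) x

/-- The function `∑_k T_{[a]} Π_k f`, in terms of the pieces `F_k` of `f`. -/
def limitOp (a : Rd d → Rd d → ℂ) (F : ℕ → Rd d → ℂ) (x : Rd d) : ℂ :=
  ∑' k, kernelOp (symbolKernel a k) (F k) x

variable {F : ℕ → Rd d → ℂ}

theorem IsSymbol.stronglyMeasurable_truncatedOp (ha : IsSymbol 1 1 m a) (ρ : 𝓢(Rd d, ℂ))
    (hF : ∀ k, Continuous (F k)) (N : ℕ) : StronglyMeasurable (truncatedOp a ρ F N) := by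
  have h : truncatedOp a ρ F N = ∑ k ∈ Finset.range (N + 1),
      kernelOp (smoothedKernel a (dilate ρ N) k) (F k) := by
    funext x
    simp [truncatedOp]
  rw [h]
  exact Finset.stronglyMeasurable_sum _ fun k _ =>
    stronglyMeasurable_kernelOp (ha.continuous_smoothedKernel _ k) (hF k)

theorem IsSymbol.enorm_truncatedOp_le (ha : IsSymbol 1 1 m a) (ρ : 𝓢(Rd d, ℂ)) (n : ℕ) :
    ∃ C : ℝ≥0∞, C < ⊤ ∧ ∀ (F : ℕ → Rd d → ℂ) (N : ℕ) (x : Rd d),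
      ‖truncatedOp a ρ F N x‖ₑ ≤ C * majorant m n F x := by
  obtain ⟨C, hC, h⟩ := ha.enorm_smoothedKernel_le ρ n
  refine ⟨C, hC, fun F N x => ?_⟩
  rw [majorant, ← ENNReal.tsum_mul_left]
  refine (enorm_sum_le _ _).trans (le_trans (Finset.sum_le_sum fun k _ => ?_)
    (ENNReal.sum_le_tsum (Finset.range (N + 1))))
  rw [← mul_assoc]
  exact enorm_kernelOp_le (ENNReal.mul_ne_top hC.ne (two_rpow_ne_top _)) (h N k) (F k) x

/-- N enters both in the smoothing and in the range of k. Dominated convergence for series treats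
both, the terms being bounded uniformly in N by those of the majorant. -/
theorem IsSymbol.tendsto_truncatedOp (ha : IsSymbol 1 1 m a) {ρ : 𝓢(Rd d, ℂ)}
    (hρ : ∫ x, ρ x = 1) (hF : ∀ k, Continuous (F k)) {n : ℕ} {x : Rd d}
    (hfin : majorant m n F x < ⊤) :
    Tendsto (fun N => truncatedOp a ρ F N x) atTop (𝓝 (limitOp a F x)) := by
  obtain ⟨C, hC, h⟩ := ha.enorm_smoothedKernel_le ρ n
  set t : ℕ → ℝ≥0∞ := fun k => C * 2 ^ ((k : ℝ) * m) *
    ∫⁻ z, ENNReal.ofReal (wt k n (x - z)) * ‖F k z‖ₑ with ht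
  have hterm : ∀ N k : ℕ, ‖kernelOp (smoothedKernel a (dilate ρ N) k) (F k) x‖ₑ ≤ t k := fun N k =>
    enorm_kernelOp_le (ENNReal.mul_ne_top hC.ne (two_rpow_ne_top _)) (h N k) (F k) x
  have htop : ∑' k, t k ≠ ⊤ := by
    have : ∑' k, t k = C * majorant m n F x := by
      rw [majorant, ← ENNReal.tsum_mul_left]
      simp_rw [ht, mul_assoc]
    rw [this]
    exact (ENNReal.mul_lt_top hC hfin).ne
  have hfink : ∀ k, ∫⁻ z, ENNReal.ofReal (wt k n (x - z)) * ‖F k z‖ₑ < ⊤ := by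
    intro k
    have h1 := (ENNReal.le_tsum (f := fun k : ℕ => (2 : ℝ≥0∞) ^ ((k : ℝ) * m) *
      ∫⁻ z, ENNReal.ofReal (wt k n (x - z)) * ‖F k z‖ₑ) k).trans_lt hfin
    refine ENNReal.lt_top_of_mul_ne_top_right h1.ne ?_
    simp
  have e : ∀ N, truncatedOp a ρ F N x = ∑' k, if k < N + 1 then
      kernelOp (smoothedKernel a (dilate ρ N) k) (F k) x else 0 := by
    intro N
    rw [tsum_eq_sum (s := Finset.range (N + 1))]
    · refine Finset.sum_congr rfl fun k hk => ?_
      rw [if_pos (Finset.mem_range.1 hk)]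
    · intro k hk
      rw [if_neg (by simpa using hk)]
  simp_rw [e]
  refine tendsto_tsum_of_dominated_convergence (bound := fun k => (t k).toReal)
    (ENNReal.summable_toReal htop) (fun k => ?_) (Eventually.of_forall fun N k => ?_)
  · refine (ha.tendsto_kernelOp hρ k (hF k) (hfink k)).congr' ?_
    filter_upwards [eventually_ge_atTop k] with N hN
    rw [if_pos (by omega)]
  · split_ifs
    · rw [← toReal_enorm]
      exact ENNReal.toReal_mono (ENNReal.ne_top_of_tsum_ne_top htop k) (hterm N k)
    · simp

theorem IsSymbol.enorm_limitOp_le (ha : IsSymbol 1 1 m a) (n : ℕ) :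
    ∃ C : ℝ≥0∞, C < ⊤ ∧ ∀ (F : ℕ → Rd d → ℂ) (x : Rd d),
      ‖limitOp a F x‖ₑ ≤ C * majorant m n F x := by
  obtain ⟨C, hC, h⟩ := ha.enorm_symbolKernel_le n
  refine ⟨C, hC, fun F x => ?_⟩
  rw [majorant, ← ENNReal.tsum_mul_left]
  refine enorm_tsum_le_tsum_enorm.trans (ENNReal.tsum_le_tsum fun k => ?_)
  rw [← mul_assoc]
  exact enorm_kernelOp_le (ENNReal.mul_ne_top hC.ne (two_rpow_ne_top _)) (h k) (F k) x

theorem lintegral_wt_mul_enorm_lt_top {h : Rd d → ℂ} {M n : ℝ} {C : ℝ≥0∞} (hC : C < ⊤)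
    (hh : ∀ x, ‖h x‖ₑ ≤ C * majorant m n F x)
    (hfin : ∫⁻ x, ENNReal.ofReal (wt 0 M x) * majorant m n F x < ⊤) :
    ∫⁻ x, ENNReal.ofReal (wt 0 M x) * ‖h x‖ₑ < ⊤ := by
  refine lt_of_le_of_lt (b := C * ∫⁻ x, ENNReal.ofReal (wt 0 M x) * majorant m n F x) ?_
    (ENNReal.mul_lt_top hC hfin)
  rw [← lintegral_const_mul' _ _ hC.ne]
  refine lintegral_mono fun x => ?_
  rw [mul_left_comm]
  gcongr
  exact hh x

theorem IsSymbol.aestronglyMeasurable_limitOp (ha : IsSymbol 1 1 m a) {ρ : 𝓢(Rd d, ℂ)}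
    (hρ : ∫ x, ρ x = 1) (hF : ∀ k, Continuous (F k)) {n M : ℕ}
    (hfin : ∫⁻ x, ENNReal.ofReal (wt 0 M x) * majorant m n F x < ⊤) :
    AEStronglyMeasurable (limitOp a F) :=
  aestronglyMeasurable_of_tendsto_ae atTop
    (fun N => (ha.stronglyMeasurable_truncatedOp ρ hF N).aestronglyMeasurable) (by
      filter_upwards [ae_majorant_lt_top hF hfin] with x hx using ha.tendsto_truncatedOp hρ hF hx)

theorem IsSymbol.tendsto_integral_truncatedOp_mul (ha : IsSymbol 1 1 m a) {ρ : 𝓢(Rd d, ℂ)}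
    (hρ : ∫ x, ρ x = 1) (hF : ∀ k, Continuous (F k)) {n M : ℕ}
    (hfin : ∫⁻ x, ENNReal.ofReal (wt 0 M x) * majorant m n F x < ⊤) (ψ : 𝓢(Rd d, ℂ)) :
    Tendsto (fun N => ∫ x, truncatedOp a ρ F N x * ψ x) atTop
      (𝓝 (∫ x, limitOp a F x * ψ x)) := by
  obtain ⟨C, hC, h⟩ := ha.enorm_truncatedOp_le ρ n
  have hae := ae_majorant_lt_top hF hfin
  have hmaj : Measurable (majorant m n F) := Measurable.tsum (measurable_majorant_term m n hF)
  have hi : Integrable fun x => ((C * majorant m n F x).toReal : ℂ) * ψ x := by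
    refine integrable_mul_of_lintegral_wt_lt_top (M := M) ?_ ?_ ψ
    · exact (Complex.measurable_ofReal.comp (hmaj.const_mul C).ennreal_toReal).aestronglyMeasurable
    · refine lintegral_wt_mul_enorm_lt_top (m := m) (n := n) (F := F) hC (fun x => ?_) hfin
      rw [← ofReal_norm, Complex.norm_real, Real.norm_of_nonneg ENNReal.toReal_nonneg]
      exact ENNReal.ofReal_toReal_le
  refine tendsto_integral_of_dominated_convergence _ (fun N => ?_) hi.norm (fun N => ?_) ?_
  · exact ((ha.stronglyMeasurable_truncatedOp ρ hF N).mul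
      ψ.continuous.stronglyMeasurable).aestronglyMeasurable
  · filter_upwards [hae] with x hx
    rw [norm_mul, norm_mul, Complex.norm_real, Real.norm_of_nonneg ENNReal.toReal_nonneg]
    gcongr
    rw [← toReal_enorm]
    exact ENNReal.toReal_mono (ENNReal.mul_lt_top hC hx).ne (h F N x)
  · filter_upwards [hae] with x hx using (ha.tendsto_truncatedOp hρ hF hx).mul_const _

end

section

/-! ### Littlewood–Paley pieces of the limit -/

variable {m : ℝ} {a : Rd d → Rd d → ℂ}

theorem IsSymbol.integrable_kernel_mul (ha : IsSymbol 1 1 m a) (k : ℕ) {F : Rd d → ℂ}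
    (hF : Continuous F) {B : ℝ≥0∞} (hB : B < ⊤) (hFB : ∀ y, ‖F y‖ₑ ≤ B) (G : 𝓢(Rd d, ℂ))
    (x : Rd d) : Integrable (fun p : Rd d × Rd d =>
      symbolKernel a k p.1 (p.1 - p.2) * F p.2 * G (x - p.1)) (volume.prod volume) := by
  obtain ⟨C, hC, h⟩ := ha.enorm_symbolKernel_le (d + 1)
  have hK := continuous_symbolKernel ha.smooth.continuous k
  have h1 : Continuous fun p : Rd d × Rd d => (p.1, p.1 - p.2) :=
    continuous_fst.prodMk (continuous_fst.sub continuous_snd)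
  have h2 := hK.comp h1
  simp only [Function.comp_def] at h2
  have hcont : Continuous fun p : Rd d × Rd d =>
      symbolKernel a k p.1 (p.1 - p.2) * F p.2 * G (x - p.1) :=
    (h2.mul (hF.comp continuous_snd)).mul
      (G.continuous.comp (continuous_const.sub continuous_fst))
  refine ⟨hcont.aestronglyMeasurable, ?_⟩
  rw [HasFiniteIntegral, lintegral_prod _ hcont.enorm.aemeasurable]
  set c : ℝ≥0∞ := C * 2 ^ ((k : ℝ) * m) * B with hc
  have hct : c < ⊤ := ENNReal.mul_lt_top (ENNReal.mul_lt_top hC (two_rpow_ne_top _).lt_top) hB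
  have hGi : ∫⁻ y, ‖G (x - y)‖ₑ < ⊤ := (integrable_comp_sub_left G x).2
  calc _ ≤ ∫⁻ y, c * wtMass d (d + 1 : ℕ) * ‖G (x - y)‖ₑ := by
        refine lintegral_mono fun y => ?_
        calc _ ≤ ∫⁻ z, c * ‖G (x - y)‖ₑ * ENNReal.ofReal (wt k (d + 1 : ℕ) (y - z)) := by
              refine lintegral_mono fun z => ?_
              rw [enorm_mul, enorm_mul]
              refine (mul_le_mul' (mul_le_mul' (h k y (y - z)) (hFB z)) le_rfl).trans
                (le_of_eq ?_)
              rw [hc]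
              ring
          _ = _ := by
              rw [lintegral_const_mul' _ _ (ENNReal.mul_ne_top hct.ne enorm_ne_top),
                lintegral_wt_sub_left]
              ring
    _ = c * wtMass d (d + 1 : ℕ) * ∫⁻ y, ‖G (x - y)‖ₑ := by
        rw [lintegral_const_mul']
        exact (ENNReal.mul_lt_top hct (wtMass_lt_top (by push_cast; linarith))).ne
    _ < ⊤ := ENNReal.mul_lt_top (ENNReal.mul_lt_top hct
        (wtMass_lt_top (by push_cast; linarith))) hGi

/-- Fubini brings the y-integral inside, so that the cancellation between φ_l and the kernel of T_k
is used before absolute values are taken. -/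
theorem IsSymbol.enorm_integral_kernelOp_mul_le (ha : IsSymbol 1 1 m a) {ρ : 𝓢(Rd d, ℂ)}
    (hρ : IsAnnular ρ) (n L : ℕ) : ∃ C : ℝ≥0∞, C < ⊤ ∧ ∀ (l k : ℕ) {F : Rd d → ℂ},
      Continuous F → (∃ B : ℝ≥0∞, B < ⊤ ∧ ∀ y, ‖F y‖ₑ ≤ B) → ∀ x,
      ‖∫ y, kernelOp (symbolKernel a k) F y * dilate ρ l (x - y)‖ₑ ≤
        C * offDiag m L n l k (fun y => ‖F y‖ₑ) x := by
  obtain ⟨C, hC, h⟩ := ha.enorm_integral_dilate_mul_le_max hρ n L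
  refine ⟨C, hC, fun l k F hF ⟨B, hB, hFB⟩ x => ?_⟩
  have e : ∫ y, kernelOp (symbolKernel a k) F y * dilate ρ l (x - y) =
      ∫ z, F z * ∫ y, dilate ρ l (x - y) * symbolKernel a k y (y - z) := by
    calc _ = ∫ y, ∫ z, symbolKernel a k y (y - z) * F z * dilate ρ l (x - y) := by
          simp_rw [kernelOp, integral_mul_const]
      _ = ∫ z, ∫ y, symbolKernel a k y (y - z) * F z * dilate ρ l (x - y) :=
          integral_integral_swap (ha.integrable_kernel_mul k hF hB hFB (dilate ρ l) x)
      _ = _ := by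
          refine integral_congr_ae (Eventually.of_forall fun z => ?_)
          simp only
          rw [← integral_const_mul]
          refine integral_congr_ae (Eventually.of_forall fun y => ?_)
          simp only
          ring
  rw [e, offDiag, ← mul_assoc, ← lintegral_const_mul' _ _ (ENNReal.mul_ne_top hC.ne
    (two_rpow_ne_top _))]
  refine (enorm_integral_le_lintegral_enorm _).trans (lintegral_mono fun z => ?_)
  rw [enorm_mul, mul_comm, ← mul_assoc]
  gcongr
  exact h l k x z

/-- The series over k may be integrated term by term. The parameters M and n' only certify absolute
convergence and do not enter the constant. -/
theorem IsSymbol.enorm_integral_limitOp_mul_le (ha : IsSymbol 1 1 m a) {ρ : 𝓢(Rd d, ℂ)}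
    (hρ : IsAnnular ρ) (n L : ℕ) : ∃ C : ℝ≥0∞, C < ⊤ ∧ ∀ {F : ℕ → Rd d → ℂ},
      (∀ k, Continuous (F k)) → (∀ k, ∃ B : ℝ≥0∞, B < ⊤ ∧ ∀ y, ‖F k y‖ₑ ≤ B) →
      ∀ {M n' : ℕ}, ∫⁻ x, ENNReal.ofReal (wt 0 M x) * majorant m n' F x < ⊤ →
      ∀ (l : ℕ) (x : Rd d), ‖∫ y, limitOp a F y * dilate ρ l (x - y)‖ₑ ≤
        C * ∑' k, offDiag m L n l k (fun y => ‖F k y‖ₑ) x := by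
  obtain ⟨C, hC, h⟩ := ha.enorm_integral_kernelOp_mul_le hρ n L
  refine ⟨C, hC, fun {F} hF hFB {M n'} hfin l x => ?_⟩
  obtain ⟨C₁, hC₁, h₁⟩ := ha.enorm_symbolKernel_le n'
  obtain ⟨C₂, hC₂, h₂⟩ := enorm_dilate_le ρ M
  set c : ℝ≥0∞ := ENNReal.ofReal (2 ^ (l * d) * (1 + ‖x‖) ^ (M : ℝ)) with hc
  have hdil : ∀ y, ‖dilate ρ l (x - y)‖ₑ ≤ C₂ * c * ENNReal.ofReal (wt 0 M y) := by
    intro y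
    refine (h₂ l (x - y)).trans ?_
    rw [mul_assoc, hc, ← ENNReal.ofReal_mul (by positivity)]
    gcongr
    exact wt_le_const_mul_wt_zero l (Nat.cast_nonneg M) x y
  have hsm : ∀ k, StronglyMeasurable fun y =>
      kernelOp (symbolKernel a k) (F k) y * dilate ρ l (x - y) := fun k =>
    (stronglyMeasurable_kernelOp (continuous_symbolKernel ha.smooth.continuous k) (hF k)).mul
      ((dilate ρ l).continuous.comp (continuous_const.sub continuous_id)).stronglyMeasurable
  have htop : ∑' k, ∫⁻ y, ‖kernelOp (symbolKernel a k) (F k) y * dilate ρ l (x - y)‖ₑ ≠ ⊤ := by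
    rw [← lintegral_tsum fun k => (hsm k).enorm.aemeasurable]
    refine (lt_of_le_of_lt (b := C₁ * (C₂ * c) *
      ∫⁻ x, ENNReal.ofReal (wt 0 M x) * majorant m n' F x) ?_ ?_).ne
    · rw [← lintegral_const_mul' _ _ (ENNReal.mul_ne_top hC₁.ne
        (ENNReal.mul_ne_top hC₂.ne ENNReal.ofReal_ne_top))]
      refine lintegral_mono fun y => ?_
      simp_rw [enorm_mul]
      rw [ENNReal.tsum_mul_right, majorant]
      calc _ ≤ (∑' k : ℕ, C₁ * (2 ^ ((k : ℝ) * m) *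
            ∫⁻ z, ENNReal.ofReal (wt k n' (y - z)) * ‖F k z‖ₑ)) *
            (C₂ * c * ENNReal.ofReal (wt 0 M y)) := by
            gcongr with k
            · rw [← mul_assoc]
              exact enorm_kernelOp_le (ENNReal.mul_ne_top hC₁.ne (two_rpow_ne_top _)) (h₁ k)
                (F k) y
            · exact hdil y
        _ = _ := by
            rw [ENNReal.tsum_mul_left]
            ring
    · exact ENNReal.mul_lt_top (ENNReal.mul_lt_top hC₁
        (ENNReal.mul_lt_top hC₂ ENNReal.ofReal_lt_top)) hfin
  have e : ∫ y, limitOp a F y * dilate ρ l (x - y) =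
      ∑' k, ∫ y, kernelOp (symbolKernel a k) (F k) y * dilate ρ l (x - y) := by
    rw [← integral_tsum (fun k => (hsm k).aestronglyMeasurable) htop]
    simp_rw [limitOp, tsum_mul_right]
  rw [e, ← ENNReal.tsum_mul_left]
  exact enorm_tsum_le_tsum_enorm.trans (ENNReal.tsum_le_tsum fun k => h l k (hF k) (hFB k) x)

/-! ### Consequences of finiteness of the localized quantities -/

theorem cubeMean_mono {μ : ℕ} {G H : Rd d → ℝ≥0∞} (h : ∀ x, G x ≤ H x) :
    cubeMean μ G ≤ cubeMean μ H :=
  iSup_mono fun _ => mul_le_mul_right (lintegral_mono h) _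

theorem cubeMean_const_mul (μ : ℕ) {c : ℝ≥0∞} (hc : c ≠ ⊤) (H : Rd d → ℝ≥0∞) :
    cubeMean μ (fun x => c * H x) = c * cubeMean μ H := by
  rw [cubeMean, cubeMean, ENNReal.mul_iSup]
  refine iSup_congr fun n => ?_
  rw [lintegral_const_mul' _ _ hc, mul_left_comm]

theorem ofReal_two_rpow_mul_norm_rpow {q : ℝ} (hq : 0 < q) (r : ℝ) (z : ℂ) :
    ENNReal.ofReal ((2 : ℝ) ^ r * ‖z‖ ^ q) = 2 ^ r * ‖z‖ₑ ^ q := by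
  rw [ENNReal.ofReal_mul (by positivity), two_rpow_eq_ofReal,
    ← ENNReal.ofReal_rpow_of_nonneg (norm_nonneg z) hq.le, ofReal_norm]

variable {φ : 𝓢(Rd d, ℂ)} (hφ : IsLittlewoodPaley φ)

/-- The power 1/q is an order isomorphism of [0, ∞] and passes through the supremum. -/
theorem localSup_eq {q : ℝ} (hq : 0 < q) (s : ℝ) (μ : ℕ) (f : 𝓢'(Rd d, ℂ)) :
    localSup hφ s q μ f = (cubeMean μ fun x => ∑' k : Set.Ici μ,
      2 ^ (s * (k : ℕ) * q) * ‖lpProj hφ k f x‖ₑ ^ q) ^ (1 / q) := by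
  have h := (ENNReal.orderIsoRpow (1 / q) (by positivity)).map_iSup
    fun n : Fin d → ℤ => (volume (dyadicCube (μ : ℤ) n))⁻¹ * ∫⁻ x in dyadicCube (μ : ℤ) n,
      ∑' k : Set.Ici μ, 2 ^ (s * (k : ℕ) * q) * ‖lpProj hφ k f x‖ₑ ^ q
  simp only [ENNReal.orderIsoRpow_apply] at h
  rw [cubeMean, h, localSup]
  simp_rw [ofReal_two_rpow_mul_norm_rpow hq]

theorem ae_two_rpow_mul_le_lowSup (s : ℝ) {μ k : ℕ} (hk : k < μ) (f : 𝓢'(Rd d, ℂ)) :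
    ∀ᵐ x, 2 ^ ((k : ℝ) * s) * ‖lpProj hφ k f x‖ₑ ≤ lowSup hφ s μ f := by
  have h1 : eLpNorm (fun x => (((2 : ℝ) ^ ((k : ℝ) * s) : ℝ) : ℂ) * lpProj hφ k f x) ⊤ volume ≤
      lowSup hφ s μ f :=
    le_iSup₂ (f := fun k (_ : k ∈ Finset.range μ) =>
      eLpNorm (fun x => (((2 : ℝ) ^ ((k : ℝ) * s) : ℝ) : ℂ) * lpProj hφ k f x) ⊤ volume) k
      (Finset.mem_range.2 hk)
  rw [eLpNorm_exponent_top] at h1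
  filter_upwards [ae_le_eLpNormEssSup (μ := volume)
    (f := fun x => (((2 : ℝ) ^ ((k : ℝ) * s) : ℝ) : ℂ) * lpProj hφ k f x)] with x hx
  refine le_trans (le_of_eq ?_) (hx.trans h1)
  rw [enorm_mul, two_rpow_eq_ofReal, ← ofReal_norm (((2 : ℝ) ^ ((k : ℝ) * s) : ℝ) : ℂ),
    Complex.norm_real, Real.norm_of_nonneg (by positivity)]

theorem exists_enorm_lpProj_le_of_lt_top {q : ℝ} (hq : 0 < q) {s : ℝ} {μ : ℕ} {f : 𝓢'(Rd d, ℂ)}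
    (h₀ : lowSup hφ s μ f < ⊤)
    (h₁ : cubeMean μ (fun x => ∑' k : Set.Ici μ,
      2 ^ (s * (k : ℕ) * q) * ‖lpProj hφ k f x‖ₑ ^ q) < ⊤) (k : ℕ) :
    ∃ B : ℝ≥0∞, B < ⊤ ∧ ∀ y, ‖lpProj hφ k f y‖ₑ ≤ B := by
  rcases lt_or_ge k μ with hk | hk
  · refine ⟨2 ^ (-((k : ℝ) * s)) * lowSup hφ s μ f,
      ENNReal.mul_lt_top (two_rpow_ne_top _).lt_top h₀, ?_⟩
    have hae : ∀ᵐ x, ‖lpProj hφ k f x‖ₑ ≤ 2 ^ (-((k : ℝ) * s)) * lowSup hφ s μ f := by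
      filter_upwards [ae_two_rpow_mul_le_lowSup hφ s hk f] with x hx
      calc _ = 2 ^ (-((k : ℝ) * s)) * (2 ^ ((k : ℝ) * s) * ‖lpProj hφ k f x‖ₑ) := by
            rw [← mul_assoc, ← two_rpow_add, neg_add_cancel, ENNReal.rpow_zero, one_mul]
        _ ≤ _ := by gcongr
    -- Continuity of Π_k f upgrades the almost everywhere bound: the exceptional set is open and
    -- null, hence empty.
    have hcl : IsClosed {x | ‖lpProj hφ k f x‖ₑ ≤ 2 ^ (-((k : ℝ) * s)) * lowSup hφ s μ f} :=
      isClosed_le (continuous_lpProj hφ k f).enorm continuous_const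
    have hem := hcl.isOpen_compl.eq_empty_of_measure_zero (μ := volume) hae
    intro y
    by_contra hy
    exact (Set.eq_empty_iff_forall_notMem.1 hem y) hy
  · refine enorm_lpProj_le_of_cubeMean_lt_top hφ hq hk f ?_
    have hle : ∀ x, ‖lpProj hφ k f x‖ₑ ^ q ≤ 2 ^ (-(s * k * q)) * ∑' k : Set.Ici μ,
        2 ^ (s * (k : ℕ) * q) * ‖lpProj hφ k f x‖ₑ ^ q := by
      intro x
      calc _ = 2 ^ (-(s * k * q)) * (2 ^ (s * k * q) * ‖lpProj hφ k f x‖ₑ ^ q) := by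
            rw [← mul_assoc, ← two_rpow_add, neg_add_cancel, ENNReal.rpow_zero, one_mul]
        _ ≤ _ := by
            gcongr
            exact ENNReal.le_tsum (f := fun k : Set.Ici μ =>
              (2 : ℝ≥0∞) ^ (s * (k : ℕ) * q) * ‖lpProj hφ k f x‖ₑ ^ q) ⟨k, hk⟩
    refine lt_of_le_of_lt (cubeMean_mono hle) ?_
    rw [cubeMean_const_mul _ (two_rpow_ne_top _)]
    exact ENNReal.mul_lt_top (two_rpow_ne_top _).lt_top h₁

/-- The integrals are off-diagonal terms with l = 0 at the point 0, so for k ≥ μ they decay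
geometrically by `offDiag_le`. The finitely many k < μ contribute finite amounts. -/
theorem tsum_lintegral_wt_mul_lpProj_lt_top {q s m : ℝ} (hq : 0 < q) (hs : tau d q < s) {M : ℕ}
    (hM : d < M * min 1 q) {μ : ℕ} {f : 𝓢'(Rd d, ℂ)} (h₀ : lowSup hφ (s + m) μ f < ⊤)
    (h₁ : cubeMean μ (fun x => ∑' k : Set.Ici μ,
      2 ^ ((s + m) * (k : ℕ) * q) * ‖lpProj hφ k f x‖ₑ ^ q) < ⊤) :
    ∑' k : ℕ, 2 ^ ((k : ℝ) * m) * ∫⁻ z, ENNReal.ofReal (wt 0 M z) * ‖lpProj hφ k f z‖ₑ < ⊤ := by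
  have hr0 : 0 < min 1 q := lt_min one_pos hq
  have hMd : (d : ℝ) < M := hM.trans_le (mul_le_of_le_one_right (Nat.cast_nonneg M)
    (min_le_left _ _))
  have hbdd := exists_enorm_lpProj_le_of_lt_top hφ hq h₀ h₁
  obtain ⟨C₀, hC₀, hrep⟩ := exists_enorm_lpProj_le d M
  obtain ⟨C, hC, H⟩ := offDiag_le (d := d) (s := s) (m := m) (M := M) hq le_rfl hMd le_rfl C₀ hC₀
  set W : ℕ → ℝ≥0∞ := fun k =>
    2 ^ ((k : ℝ) * m) * ∫⁻ z, ENNReal.ofReal (wt 0 M z) * ‖lpProj hφ k f z‖ₑ with hW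
  have hWt : ∀ k, W k < ⊤ := by
    intro k
    obtain ⟨B, hB, hFB⟩ := hbdd k
    refine ENNReal.mul_lt_top (two_rpow_ne_top _).lt_top (lt_of_le_of_lt
      (b := (∫⁻ z : Rd d, ENNReal.ofReal (wt 0 M z)) * B) ?_ ?_)
    · rw [← lintegral_mul_const' _ _ hB.ne]
      exact lintegral_mono fun z => mul_le_mul_right (hFB z) _
    · rw [lintegral_wt]
      exact ENNReal.mul_lt_top (wtMass_lt_top hMd) hB
  set r : ℝ := M * min 1 q with hr
  have hr' : 0 ≤ r := by positivity
  -- The factor 2^{μr} comes from replacing the weight at scale 0 by the one at scale μ. Its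
  -- dependence on μ is harmless since only finiteness is at stake.
  set X : ℝ≥0∞ := (C * (ENNReal.ofReal (((2 : ℝ) ^ μ) ^ r) *
    (ENNReal.ofReal ((1 + Real.sqrt d) ^ r) * wtMass d r *
      cubeMean μ (fun x => ∑' k : Set.Ici μ,
      2 ^ ((s + m) * (k : ℕ) * q) * ‖lpProj hφ k f x‖ₑ ^ q)))) ^ q⁻¹ with hX
  have hXt : X < ⊤ := by
    refine ENNReal.rpow_lt_top_of_nonneg (by positivity) (ENNReal.mul_lt_top hC
      (ENNReal.mul_lt_top ENNReal.ofReal_lt_top (ENNReal.mul_lt_top (ENNReal.mul_lt_top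
        ENNReal.ofReal_lt_top (wtMass_lt_top hM)) h₁))).ne
  have hhigh : ∀ k, μ ≤ k → W k ≤ geo (s - tau d q) 0 k * X := by
    intro k hk
    have h := H 0 k (fun x => ‖lpProj hφ k f x‖ₑ) (measurable_enorm_lpProj hφ k f)
      (fun _ => hbdd k) (fun y => hrep hφ f k y) 0
    have e : (2 : ℝ≥0∞) ^ (s * (0 : ℕ)) * offDiag m (s + (s - tau d q)) M 0 k
        (fun x => ‖lpProj hφ k f x‖ₑ) 0 = W k := by
      have hmax : max (((0 : ℕ) : ℝ) - k) 0 = 0 := max_eq_right (by simp)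
      simp only [offDiag, hW, hmax, Nat.zero_min]
      simp [wt_neg]
    rw [e] at h
    refine h.trans ?_
    rw [hX]
    gcongr
    refine le_trans ?_ (mul_le_mul_right (lintegral_wt_mul_le_cubeMean μ hr' 0 _) _)
    rw [← lintegral_const_mul' _ _ ENNReal.ofReal_ne_top]
    refine lintegral_mono fun z => ?_
    rw [← mul_assoc (ENNReal.ofReal (((2 : ℝ) ^ μ) ^ r)), ← ENNReal.ofReal_mul (by positivity),
      Nat.zero_min]
    gcongr
    · exact wt_zero_le μ hr' _
    · exact ENNReal.le_tsum (f := fun k : Set.Ici μ =>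
        (2 : ℝ≥0∞) ^ ((s + m) * (k : ℕ) * q) * ‖lpProj hφ k f z‖ₑ ^ q) ⟨k, hk⟩
  calc ∑' k, W k ≤ ∑' k, ((if k ∈ Finset.range μ then W k else 0) +
        geo (s - tau d q) 0 k * X) := by
        refine ENNReal.tsum_le_tsum fun k => ?_
        rcases lt_or_ge k μ with hk | hk
        · rw [if_pos (Finset.mem_range.2 hk)]
          exact le_self_add
        · exact (hhigh k hk).trans le_add_self
    _ = ∑ k ∈ Finset.range μ, W k + (∑' k, geo (s - tau d q) 0 k) * X := by
        rw [ENNReal.tsum_add, ENNReal.tsum_mul_right]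
        congr 1
        rw [tsum_eq_sum (s := Finset.range μ)]
        · exact Finset.sum_congr rfl fun k hk => if_pos hk
        · exact fun k hk => if_neg hk
    _ < ⊤ := by
        refine ENNReal.add_lt_top.2 ⟨ENNReal.sum_lt_top.2 fun k _ => hWt k,
          ENNReal.mul_lt_top (lt_of_le_of_lt (tsum_geo_le _ 0) ?_) hXt⟩
        exact geoSum_lt_top (by linarith)

end

section

/-! ### The operator on distributions with finite localized quantities -/

variable {φ : 𝓢(Rd d, ℂ)} (hφ : IsLittlewoodPaley φ) {m : ℝ} {a : Rd d → Rd d → ℂ}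

theorem sum_sum_pieceOp (ha : IsSymbol 1 1 m a) (f : 𝓢'(Rd d, ℂ)) (N : ℕ) (x : Rd d) :
    ∑ k ∈ Finset.range (N + 1), ∑ j ∈ Finset.range (N + 1), pieceOp hφ ha j k f x =
      truncatedOp a (lowPass hφ) (fun k => lpProj hφ k f) N x := by
  simp_rw [sum_pieceOp]
  rfl

theorem exists_isPseudoDiff (ha : IsSymbol 1 1 m a) {f : 𝓢'(Rd d, ℂ)} {n M : ℕ}
    (hfin : ∫⁻ x, ENNReal.ofReal (wt 0 M x) * majorant m n (fun k => lpProj hφ k f) x < ⊤) :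
    ∃ u : 𝓢'(Rd d, ℂ), IsPseudoDiff hφ ha f u := by
  have hF : ∀ k, Continuous (lpProj hφ k f) := fun k => continuous_lpProj hφ k f
  obtain ⟨C₁, hC₁, h₁⟩ := ha.enorm_truncatedOp_le (lowPass hφ) n
  obtain ⟨C₂, hC₂, h₂⟩ := ha.enorm_limitOp_le n
  choose U hU using fun N => exists_isGivenBy
    (ha.stronglyMeasurable_truncatedOp (lowPass hφ) hF N).aestronglyMeasurable
    (lintegral_wt_mul_enorm_lt_top hC₁ (h₁ (fun k => lpProj hφ k f) N) hfin)
  obtain ⟨u, hu⟩ := exists_isGivenBy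
    (ha.aestronglyMeasurable_limitOp (integral_lowPass hφ) hF hfin)
    (lintegral_wt_mul_enorm_lt_top hC₂ (h₂ fun k => lpProj hφ k f) hfin)
  refine ⟨u, U, fun N => ?_, ?_⟩
  · simp_rw [sum_sum_pieceOp]
    exact hU N
  · rw [PointwiseConvergenceCLM.tendsto_iff_forall_tendsto]
    intro ψ
    rw [(hu ψ).2]
    simp_rw [fun N => (hU N ψ).2]
    exact ha.tendsto_integral_truncatedOp_mul (integral_lowPass hφ) hF hfin ψ

/-- The truncations are given by functions, so their pairings with ψ are fixed, and the limit of
these pairings is unique. -/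
theorem IsPseudoDiff.apply_eq {ha : IsSymbol 1 1 m a} {f u : 𝓢'(Rd d, ℂ)}
    (hu : IsPseudoDiff hφ ha f u) {n M : ℕ}
    (hfin : ∫⁻ x, ENNReal.ofReal (wt 0 M x) * majorant m n (fun k => lpProj hφ k f) x < ⊤)
    (ψ : 𝓢(Rd d, ℂ)) : u ψ = ∫ x, limitOp a (fun k => lpProj hφ k f) x * ψ x := by
  obtain ⟨U, hU, hlim⟩ := hu
  rw [PointwiseConvergenceCLM.tendsto_iff_forall_tendsto] at hlim
  have h1 := hlim ψ
  simp_rw [fun N => (hU N ψ).2, sum_sum_pieceOp] at h1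
  exact tendsto_nhds_unique h1 (ha.tendsto_integral_truncatedOp_mul (integral_lowPass hφ)
    (fun k => continuous_lpProj hφ k f) hfin ψ)

/-- Both A^q and B are at most (A + B^{1/q})^q; hence the factor 2, for q above and below 1 alike.
-/
theorem localSup_le_of_cubeMean_le {q : ℝ} (hq : 0 < q) {C A B V : ℝ≥0∞}
    (h : V ≤ C * (A ^ q + B)) : V ^ (1 / q) ≤ (2 * C) ^ (1 / q) * (A + B ^ (1 / q)) := by
  have hq' : 0 < 1 / q := by positivity
  have h1 : A ^ q ≤ (A + B ^ (1 / q)) ^ q := by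
    gcongr
    exact le_self_add
  have h2 : B ≤ (A + B ^ (1 / q)) ^ q := by
    calc B = (B ^ (1 / q)) ^ q := by
          rw [← ENNReal.rpow_mul, one_div_mul_cancel hq.ne', ENNReal.rpow_one]
      _ ≤ _ := by
          gcongr
          exact le_add_self
  calc V ^ (1 / q) ≤ (2 * C * (A + B ^ (1 / q)) ^ q) ^ (1 / q) := by
        gcongr
        refine h.trans ((mul_le_mul_right (add_le_add h1 h2) _).trans (le_of_eq ?_))
        ring
    _ = _ := by
        rw [ENNReal.mul_rpow_of_nonneg _ _ hq'.le, ← ENNReal.rpow_mul, mul_one_div_cancel hq.ne',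
          ENNReal.rpow_one]

theorem lintegral_wt_mul_majorant_lpProj_lt_top {q s : ℝ} (hq : 0 < q) (hs : tau d q < s) {M : ℕ}
    (hM : d < M * min 1 q) {μ : ℕ} {f : 𝓢'(Rd d, ℂ)} (h₀ : lowSup hφ (s + m) μ f < ⊤)
    (h₁ : cubeMean μ (fun x => ∑' k : Set.Ici μ,
      2 ^ ((s + m) * (k : ℕ) * q) * ‖lpProj hφ k f x‖ₑ ^ q) < ⊤) :
    ∫⁻ x, ENNReal.ofReal (wt 0 M x) * majorant m (M + (d + 1) : ℕ) (fun k => lpProj hφ k f) x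
      < ⊤ := by
  refine lt_of_le_of_lt (lintegral_wt_mul_majorant_le (Nat.cast_nonneg M)
    fun k => continuous_lpProj hφ k f) (ENNReal.mul_lt_top (wtMass_lt_top ?_)
      (tsum_lintegral_wt_mul_lpProj_lt_top hφ hq hs hM h₀ h₁))
  push_cast
  linarith

theorem exists_cubeMean_lpProj_le (ha : IsSymbol 1 1 m a) {q s : ℝ} (hq : 0 < q)
    (hs : tau d q < s) {M : ℕ} (hM : 2 * d + 2 ≤ M * min 1 q) :
    ∃ C : ℝ≥0∞, C < ⊤ ∧ ∀ μ : ℕ, 1 ≤ μ → ∀ f u : 𝓢'(Rd d, ℂ), lowSup hφ (s + m) μ f < ⊤ →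
      cubeMean μ (fun x => ∑' k : Set.Ici μ,
        2 ^ ((s + m) * (k : ℕ) * q) * ‖lpProj hφ k f x‖ₑ ^ q) < ⊤ → IsPseudoDiff hφ ha f u →
      cubeMean μ (fun x => ∑' l : Set.Ici μ, 2 ^ (s * (l : ℕ) * q) * ‖lpProj hφ l u x‖ₑ ^ q) ≤
        C * (lowSup hφ (s + m) μ f ^ q + cubeMean μ fun x => ∑' k : Set.Ici μ,
          2 ^ ((s + m) * (k : ℕ) * q) * ‖lpProj hφ k f x‖ₑ ^ q) := by
  -- L is the number of integrations by parts: s to compensate 2^{s(l-k)}, and s - τ_q for the decay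
  -- that remains.
  obtain ⟨L, hL⟩ := exists_nat_ge (s + (s - tau d q))
  obtain ⟨C₁, hC₁, h₁⟩ := exists_enorm_lpProj_le d M
  obtain ⟨C₂, hC₂, h₂⟩ := ha.enorm_integral_limitOp_mul_le hφ.isAnnular M L
  obtain ⟨C, hC, H⟩ := cubeMean_tsum_le (d := d) (m := m) (N := M) hq hs hL hM le_rfl (C₁ + C₂)
    (ENNReal.add_lt_top.2 ⟨hC₁, hC₂⟩)
  refine ⟨C, hC, fun μ hμ f u hlow hloc hu => ?_⟩
  have hbdd := exists_enorm_lpProj_le_of_lt_top hφ hq hlow hloc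
  have hfin := lintegral_wt_mul_majorant_lpProj_lt_top hφ hq hs (M := M)
    (by have := Nat.cast_nonneg (α := ℝ) d; linarith) hlow hloc
  refine H μ (fun k x => ‖lpProj hφ k f x‖ₑ) (lowSup hφ (s + m) μ f)
    (fun l x => ‖lpProj hφ l u x‖ₑ) (measurable_enorm_lpProj hφ · f)
    (fun k hk => ae_two_rpow_mul_le_lowSup hφ (s + m) hk f) (fun k _ _ => hbdd k)
    (fun k y => (h₁ hφ f k y).trans (by gcongr; exact le_self_add)) (fun l hl x => ?_)
  -- Here μ ≥ 1 is used: l ≥ μ excludes l = 0, so the kernel is a dilate of the annular φ and never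
  -- Φ.
  have e : lpProj hφ l u x =
      ∫ y, limitOp a (fun k => lpProj hφ k f) y * dilate φ l (x - y) := by
    rw [lpProj, hu.apply_eq hφ hfin]
    simp_rw [reflectAt_apply, lpKernel, if_neg (show l ≠ 0 by omega)]
  simp only [e]
  exact (h₂ (fun k => continuous_lpProj hφ k f) hbdd hfin l x).trans
    (by gcongr; exact le_add_self)

end

end TypeOneOne

end

/-! ### The main theorem -/

open TypeOneOne

theorem theorem2p1 (d : ℕ) (hd : 0 < d) (φ : 𝓢(Rd d, ℂ)) (hφ : IsLittlewoodPaley φ)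
    (m q s : ℝ) (hq : 0 < q) (hs : tau d q < s)
    (a : Rd d → Rd d → ℂ) (ha : IsSymbol 1 1 m a) :
    ∃ C : ℝ≥0, 0 < C ∧ ∀ (μ : ℕ), 1 ≤ μ → ∀ f : 𝓢'(Rd d, ℂ),
      (lowSup hφ (s + m) μ f + localSup hφ (s + m) q μ f < ⊤ →
        ∃ u : 𝓢'(Rd d, ℂ), IsPseudoDiff hφ ha f u) ∧
      ∀ u : 𝓢'(Rd d, ℂ), IsPseudoDiff hφ ha f u →
        localSup hφ s q μ u ≤ C * (lowSup hφ (s + m) μ f + localSup hφ (s + m) q μ f) := by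
  have hr0 : 0 < min 1 q := lt_min one_pos hq
  obtain ⟨M, hM⟩ := exists_nat_ge ((2 * d + 2) / min 1 q)
  rw [div_le_iff₀ hr0] at hM
  obtain ⟨C, hC, H⟩ := exists_cubeMean_lpProj_le hφ ha hq hs hM
  have hCt : (2 * C) ^ (1 / q) ≠ ⊤ :=
    ENNReal.rpow_ne_top_of_nonneg (by positivity) (ENNReal.mul_lt_top (by simp) hC).ne
  -- Adding 1 makes the constant positive, so that the bound is trivially true when A_μ(f) = ∞.
  refine ⟨((2 * C) ^ (1 / q)).toNNReal + 1, by positivity, fun μ hμ f => ?_⟩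
  have hfin : lowSup hφ (s + m) μ f + localSup hφ (s + m) q μ f < ⊤ →
      lowSup hφ (s + m) μ f < ⊤ ∧ cubeMean μ (fun x => ∑' k : Set.Ici μ,
        2 ^ ((s + m) * (k : ℕ) * q) * ‖lpProj hφ k f x‖ₑ ^ q) < ⊤ := by
    intro h
    rw [ENNReal.add_lt_top, localSup_eq hφ hq, ENNReal.rpow_lt_top_iff_of_pos (by positivity)] at h
    exact h
  refine ⟨fun h => ?_, fun u hu => ?_⟩
  · obtain ⟨h₀, h₁⟩ := hfin h
    exact exists_isPseudoDiff hφ ha (lintegral_wt_mul_majorant_lpProj_lt_top hφ hq hs (M := M)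
      (by have := Nat.cast_nonneg (α := ℝ) d; linarith) h₀ h₁)
  · rcases eq_or_ne (lowSup hφ (s + m) μ f + localSup hφ (s + m) q μ f) ⊤ with h | h
    · rw [h, ENNReal.mul_top]
      · exact le_top
      · simp
    · obtain ⟨h₀, h₁⟩ := hfin h.lt_top
      rw [localSup_eq hφ hq, localSup_eq hφ hq]
      refine (localSup_le_of_cubeMean_le hq (H μ hμ f u h₀ h₁ hu)).trans ?_
      gcongr
      rw [ENNReal.coe_add, ENNReal.coe_toNNReal hCt]
      exact le_self_add
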